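/- An instance of Weighted Multicut consists of a finite undirected graph $G$, nonnegative vertex weights $w(v)$, and a set $\mathcal T$ of pairs of vertices of $G$. A set $S\subseteq V(G)$ (which may contain vertices of the pairs) is a multicut if for every $(s,t)\in\mathcal T$ the graph $G-S$ has no path between $s$ and $t$; $\mathsf{opt}$ denotes the minimum of $w(S)=\sum_{v\in S}w(v)$ over all multicuts. A fractional multicut is a function $\mathbf x:V(G)\to[0,\infty)$ with $\sum_{v\in V(P)}\mathbf x(v)\ge 1$ for every $(s,t)\in\mathcal T$ and every path $P$ of $G$ between $s$ and $t$; $\mathsf{fopt}$ denotes the minimum of $\sum_{v}w(v)\mathbf x(v)$ over all fractional multicuts. A graph is chordal if every cycle on at least four vertices has a chord. Theorem. Weighted Multicut admits a polynomial-time constant-factor approximation algorithm on chordal graphs. More precisely, there is a deterministic algorithm that, given an instance with $G$ chordal and nonnegative rational weights written in binary, finds in time polynomial in the bit length of the instance (on a random access machine with logarithmic cost) a multicut $S$ together with its weight $r=w(S)$, which satisfies $\mathsf{opt}\le r\le 32\cdot\mathsf{fopt}$, and hence $r\le 32\cdot\mathsf{opt}$. Moreover, for every chordal graph and all nonnegative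 real weights, $\mathsf{opt}\le 32\cdot\mathsf{fopt}$. -/

import Mathlib

open scoped NNRat

/-! ### Chordal graphs and weighted vertex multicut -/

/-- A graph is chordal if every cycle on at least four vertices has a chord: an edge of the graph
that joins two vertices of the cycle and is not an edge of the cycle. -/
def SimpleGraph.IsChordal {V : Type*} (G : SimpleGraph V) : Prop :=
  ∀ (v : V) (c : G.Walk v v), c.IsCycle → 4 ≤ c.length →
    ∃ a ∈ c.support, ∃ b ∈ c.support, G.Adj a b ∧ s(a, b) ∉ c.edges

namespace Multicut

/-- `S` is a multicut for the terminal pairs `T`: for every pair `(s, t)` of `T`, the graph `G - S`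
has no path between `s` and `t`. (Terminals may belong to `S`.) -/
def IsMulticut {V : Type*} (G : SimpleGraph V) (T : Set (V × V)) (S : Set V) : Prop :=
  ∀ p ∈ T, ∀ (hs : p.1 ∈ Sᶜ) (ht : p.2 ∈ Sᶜ),
    ¬ (G.induce Sᶜ).Reachable ⟨p.1, hs⟩ ⟨p.2, ht⟩

/-- `x : V → [0, ∞)` is a fractional multicut: for every pair `(s, t)` of `T` and every path `P`
between `s` and `t`, one has `x(V(P)) ≥ 1`. -/
def IsFractional {V : Type*} [DecidableEq V] (G : SimpleGraph V) (T : Set (V × V))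
    (x : V → ℝ) : Prop :=
  (∀ v, 0 ≤ x v) ∧
    ∀ p ∈ T, ∀ P : G.Walk p.1 p.2, P.IsPath → 1 ≤ ∑ v ∈ P.support.toFinset, x v

/-- The minimum weight of a multicut. -/
noncomputable def opt {V : Type*} (G : SimpleGraph V) (T : Set (V × V))
    (w : V → ℝ) : ℝ :=
  sInf {r | ∃ S : Finset V, IsMulticut G T S ∧ r = ∑ v ∈ S, w v}

/-- The minimum weight `w(x) = ∑ v, w(v) * x(v)` of a fractional multicut. -/
noncomputable def fopt {V : Type*} [Fintype V] [DecidableEq V] (G : SimpleGraph V)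
    (T : Set (V × V)) (w : V → ℝ) : ℝ :=
  sInf {r | ∃ x : V → ℝ, IsFractional G T x ∧ r = ∑ v, w v * x v}

/-- The infimum in `opt` is attained. -/
theorem exists_isMulticut_eq_opt {V : Type*} [Fintype V] (G : SimpleGraph V)
    (T : Set (V × V)) (w : V → ℝ) :
    ∃ S : Finset V, IsMulticut G T S ∧ opt G T w = ∑ v ∈ S, w v := by
  have hne : {r | ∃ S : Finset V, IsMulticut G T S ∧ r = ∑ v ∈ S, w v}.Nonempty :=
    ⟨_, Finset.univ, fun p _ hs => by simp at hs, rfl⟩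
  have hfin : {r | ∃ S : Finset V, IsMulticut G T S ∧ r = ∑ v ∈ S, w v}.Finite :=
    (Set.finite_range fun S : Finset V => ∑ v ∈ S, w v).subset
      (by rintro _ ⟨S, _, rfl⟩; exact ⟨S, rfl⟩)
  exact hne.csInf_mem hfin

/-- The infimum in `fopt` is attained when the weights are nonnegative. -/
theorem exists_isFractional_eq_fopt {V : Type*} [Fintype V] [DecidableEq V] (G : SimpleGraph V)
    (T : Set (V × V)) (w : V → ℝ) (hw : ∀ v, 0 ≤ w v) :
    ∃ x : V → ℝ, IsFractional G T x ∧ fopt G T w = ∑ v, w v * x v := by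
  have hone : IsFractional G T (fun _ => 1) := by
    refine ⟨fun _ => zero_le_one, fun p _ P _ => ?_⟩
    have : 0 < P.support.toFinset.card := Finset.card_pos.2 ⟨p.1, by simp⟩
    simpa only [Finset.sum_const, nsmul_eq_mul, mul_one, Nat.one_le_cast]
  have hclosed : IsClosed {x : V → ℝ | IsFractional G T x} := by
    have : {x : V → ℝ | IsFractional G T x} = (⋂ v, {x | 0 ≤ x v}) ∩
        ⋂ p ∈ T, ⋂ P : G.Walk p.1 p.2, ⋂ _ : P.IsPath,
          {x | 1 ≤ ∑ v ∈ P.support.toFinset, x v} := by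
      ext x; simp [IsFractional]
    rw [this]
    refine (isClosed_iInter fun v => isClosed_le continuous_const (continuous_apply v)).inter ?_
    refine isClosed_biInter fun p _ => isClosed_iInter fun P => isClosed_iInter fun _ => ?_
    exact isClosed_le continuous_const (by fun_prop)
  have hcomp : IsCompact ({x : V → ℝ | IsFractional G T x} ∩ Set.Icc 0 1) :=
    isCompact_Icc.inter_left hclosed
  obtain ⟨x, hx, hmin⟩ := hcomp.exists_isMinOn (f := fun x => ∑ v, w v * x v)
    ⟨fun _ => 1, hone, fun _ => zero_le_one, fun _ => le_rfl⟩ (by fun_prop)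
  refine ⟨x, hx.1, (IsLeast.csInf_eq ⟨⟨x, hx.1, rfl⟩, ?_⟩)⟩
  rintro _ ⟨y, hy, rfl⟩
  have hclip : IsFractional G T (fun v => min (y v) 1) := by
    refine ⟨fun v => le_min (hy.1 v) zero_le_one, fun p hp P hP => ?_⟩
    by_cases h : ∃ v ∈ P.support.toFinset, 1 ≤ y v
    · obtain ⟨v, hv, h1⟩ := h
      calc (1 : ℝ) = min (y v) 1 := (min_eq_right h1).symm
        _ ≤ _ := Finset.single_le_sum (f := fun v => min (y v) 1)
          (fun u _ => le_min (hy.1 u) zero_le_one) hv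
    · push Not at h
      rw [Finset.sum_congr rfl fun v hv => min_eq_left (h v hv).le]
      exact hy.2 p hp P hP
  calc _ ≤ ∑ v, w v * min (y v) 1 :=
        hmin ⟨hclip, fun v => le_min (hy.1 v) zero_le_one, fun v => min_le_right _ _⟩
    _ ≤ _ := Finset.sum_le_sum fun v _ => mul_le_mul_of_nonneg_left (min_le_left _ _) (hw v)

end Multicut

/-! ### Random access machines with logarithmic cost -/

namespace RAM

/-- The arithmetic operations of the machine, on natural numbers. -/
inductive Op
  | add | sub | mul | div | lt | eq

/-- Truncated subtraction, division rounding down (by zero: `0`), comparisons with value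
`0` or `1`. -/
def Op.eval : Op → ℕ → ℕ → ℕ
  | .add, a, b => a + b
  | .sub, a, b => a - b
  | .mul, a, b => a * b
  | .div, a, b => a / b
  | .lt, a, b => if a < b then 1 else 0
  | .eq, a, b => if a = b then 1 else 0

/-- Expressions over constants, registers, and cells of arrays (indirect addressing). -/
inductive Expr
  | const (k : ℕ)
  | reg (i : ℕ)
  | cell (a : ℕ) (index : Expr)
  | op (o : Op) (e₁ e₂ : Expr)

/-- The memory: registers `R 0, R 1, …`, arrays `A 0, A 1, …`, each entry a natural number. A program
mentions only finitely many registers and arrays by name. -/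
structure State where
  reg : ℕ → ℕ
  cell : ℕ → ℕ → ℕ

/-- The value of an expression. -/
def Expr.eval (σ : State) : Expr → ℕ
  | .const k => k
  | .reg i => σ.reg i
  | .cell a e => σ.cell a (e.eval σ)
  | .op o e₁ e₂ => o.eval (e₁.eval σ) (e₂.eval σ)

/-- The logarithmic cost of evaluating an expression: the total number of binary digits of the
values of all its subexpressions (hence of all operands, results and addresses), plus one for
every subexpression. -/
def Expr.cost (σ : State) : Expr → ℕ
  | .const k => k.size + 1
  | .reg i => (σ.reg i).size + 1
  | .cell a e => e.cost σ + (σ.cell a (e.eval σ)).size + 1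
  | .op o e₁ e₂ => e₁.cost σ + e₂.cost σ + (o.eval (e₁.eval σ) (e₂.eval σ)).size + 1

/-- Programs. A test succeeds if the value of its expression is not `0`. -/
inductive Prog
  | skip
  | set (i : ℕ) (e : Expr)
  | store (a : ℕ) (index e : Expr)
  | seq (p q : Prog)
  | ite (test : Expr) (p q : Prog)
  | loop (test : Expr) (body : Prog)

/-- `Exec p σ τ t`: started in the memory state `σ`, the program `p` halts in the state `τ`, and
the run costs `t`. -/
inductive Exec : Prog → State → State → ℕ → Prop
  | skip (σ : State) : Exec .skip σ σ 1
  | set (i : ℕ) (e : Expr) (σ : State) :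
      Exec (.set i e) σ ⟨Function.update σ.reg i (e.eval σ), σ.cell⟩ (e.cost σ + 1)
  | store (a : ℕ) (index e : Expr) (σ : State) :
      Exec (.store a index e) σ
        ⟨σ.reg, Function.update σ.cell a
          (Function.update (σ.cell a) (index.eval σ) (e.eval σ))⟩
        (index.cost σ + e.cost σ + 1)
  | seq {p q : Prog} {σ τ υ : State} {t u : ℕ} :
      Exec p σ τ t → Exec q τ υ u → Exec (.seq p q) σ υ (t + u + 1)
  | ite_true {test : Expr} {p q : Prog} {σ τ : State} {t : ℕ} :
      test.eval σ ≠ 0 → Exec p σ τ t → Exec (.ite test p q) σ τ (test.cost σ + t + 1)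
  | ite_false {test : Expr} {p q : Prog} {σ τ : State} {t : ℕ} :
      test.eval σ = 0 → Exec q σ τ t → Exec (.ite test p q) σ τ (test.cost σ + t + 1)
  | loop_true {test : Expr} {body : Prog} {σ τ υ : State} {t u : ℕ} :
      test.eval σ ≠ 0 → Exec body σ τ t → Exec (.loop test body) τ υ u →
        Exec (.loop test body) σ υ (test.cost σ + t + u + 1)
  | loop_false {test : Expr} {body : Prog} {σ : State} :
      test.eval σ = 0 → Exec (.loop test body) σ σ (test.cost σ + 1)

/-- The machine is deterministic. -/
theorem Exec.deterministic {p : Prog} {σ τ τ' : State} {t t' : ℕ}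
    (h : Exec p σ τ t) (h' : Exec p σ τ' t') : τ = τ' ∧ t = t' := by
  induction h generalizing τ' t' with
  | skip σ => cases h'; exact ⟨rfl, rfl⟩
  | set i e σ => cases h'; exact ⟨rfl, rfl⟩
  | store a index e σ => cases h'; exact ⟨rfl, rfl⟩
  | seq _ _ ih₁ ih₂ =>
    cases h' with
    | seq h₁ h₂ =>
      obtain ⟨rfl, rfl⟩ := ih₁ h₁
      obtain ⟨rfl, rfl⟩ := ih₂ h₂
      exact ⟨rfl, rfl⟩
  | ite_true hc _ ih =>
    cases h' with
    | ite_true _ h => obtain ⟨rfl, rfl⟩ := ih h; exact ⟨rfl, rfl⟩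
    | ite_false hc' _ => exact absurd hc' hc
  | ite_false hc _ ih =>
    cases h' with
    | ite_true hc' _ => exact absurd hc hc'
    | ite_false _ h => obtain ⟨rfl, rfl⟩ := ih h; exact ⟨rfl, rfl⟩
  | loop_true hc _ _ ih₁ ih₂ =>
    cases h' with
    | loop_true _ h₁ h₂ =>
      obtain ⟨rfl, rfl⟩ := ih₁ h₁
      obtain ⟨rfl, rfl⟩ := ih₂ h₂
      exact ⟨rfl, rfl⟩
    | loop_false hc' => exact absurd hc' hc
  | loop_false hc =>
    cases h' with
    | loop_true hc' _ _ => exact absurd hc hc'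
    | loop_false _ => exact ⟨rfl, rfl⟩

/-- The initial state on the input list `l`: the list is stored in the array `A 0`, its length in
the register `R 0`, and everything else is `0`. -/
def State.init (l : List ℕ) : State where
  reg i := if i = 0 then l.length else 0
  cell a i := if a = 0 then l.getD i 0 else 0

/-- The state `σ` holds the output list `l`: its length in the register `R 0`, its entries in the
array `A 1`. -/
def State.Outputs (σ : State) (l : List ℕ) : Prop :=
  σ.reg 0 = l.length ∧ ∀ i : Fin l.length, σ.cell 1 i = l.get i

/-- The length of an input list in bits: the number of binary digits of its entries, plus one
(a separator) for every entry. -/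
def bitSize (l : List ℕ) : ℕ :=
  (l.map fun k => k.size + 1).sum

end RAM

/-! ### Instances as inputs of algorithms -/

namespace Multicut

/-- An instance of Weighted Multicut as the input of an algorithm: a graph on `n` vertices,
nonnegative rational vertex weights, and a list of pairs of vertices. -/
structure Instance where
  n : ℕ
  graph : SimpleGraph (Fin n)
  weight : Fin n → ℚ≥0
  pairs : List (Fin n × Fin n)

namespace Instance

/-- The set of terminal pairs. -/
def pairSet (I : Instance) : Set (Fin I.n × Fin I.n) :=
  {p | p ∈ I.pairs}

/-- The weights as real numbers. -/
def realWeight (I : Instance) (v : Fin I.n) : ℝ :=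
  (I.weight v : ℝ)

open Classical in
/-- The input list: the number of vertices, the rows of the adjacency matrix, numerator and
denominator of each weight, the number of pairs, and the pairs. -/
noncomputable def encode (I : Instance) : List ℕ :=
  I.n ::
    ((List.finRange I.n).flatMap fun u =>
      (List.finRange I.n).map fun v => if I.graph.Adj u v then 1 else 0) ++
    ((List.finRange I.n).flatMap fun v => [(I.weight v).num, (I.weight v).den]) ++
    I.pairs.length :: (I.pairs.flatMap fun p => [(p.1 : ℕ), (p.2 : ℕ)])

end Instance

/-- The output list for a solution of value `a / b` realized by the vertex set `S`: the numbers
`a` and `b`, and the characteristic vector of `S`. -/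
def encodeSolution {n : ℕ} (a b : ℕ) (S : Finset (Fin n)) : List ℕ :=
  a :: b :: (List.finRange n).map fun v => if v ∈ S then 1 else 0

end Multicut

/-! Rounding. Take integer vertex lengths `x`, a root in every component, and the distances `d` from
the roots. For an offset `θ < n`, cut every vertex whose interval from `d v - x v` to `d v` crosses
one of the levels `n - θ, 2n - θ, …`. Over the `n` offsets a vertex is cut at most `x v` times, so
some offset cuts weight at most `(∑ w x) / n`. What stays connected lies between two consecutive
levels. Chordality bounds its diameter: if `a` and `b` are connected beyond level `c`, the vertices
where their shortest paths from the root cross `c` are joined both inside and outside the level,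
hence are equal or adjacent (`IsChordal.eq_or_adj`), since otherwise two chordless paths would form
a chordless cycle. So `a` and `b` are at distance less than `4n` (`IsRootDist.exists_short_walk`).
For `x = ⌊5 n z⌋` with `z` a fractional multicut, every path of a terminal pair has length at least
`5n - n = 4n`, so the cut is a multicut, of weight at most `5 ∑ w z` (`opt_le_mul_fopt`).

Algorithm. The linear program is not solved exactly. Multiplicative weights keep a power of two `y
v` per vertex and use lengths proportional to `y v / w v`. Let `α` be the least distance of a
terminal pair. Dividing the lengths by `α` gives a fractional multicut, which is rounded, and the
best multicut so far is kept; flow is then sent along a shortest path, and `y v` doubles whenever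
another `w v` units have passed through `v`. Fix any fractional multicut `z` of value `β`. A round
whose normalized lengths have value at most `6β` yields a multicut of weight at most `30β`. In any
other round, sending `c` units multiplies a potential that dominates `∑ y` by at most `exp (c /
(6β))` (`Progress.step`), whereas weak duality bounds the total flow by `β` times the largest
relative load. A vertex doubled `k` times then gives `2 ^ k ≤ n * exp ((k + 1) / 6)`, which fails
for `k > 4n`. As every round doubles some vertex, `4n² + 1` rounds contain a good one
(`Progress.lt`, `iteration_spec`).

Running time. Programs are written with counting loops and checked by a decidable criterion,
`Cmd.tame`: loop bounds are read-only, and every product has a read-only or constant right factor.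
Then the number of steps is polynomial, and each step adds only boundedly many digits
(`Cmd.exec_aux`). Phases with different read-only memory are composed by `PolyTime.seq`. -/

namespace RAM

/-! ### Structured programs with bounded loops -/

/-- Assignment to a register. -/
def State.setReg (σ : State) (i v : ℕ) : State := ⟨Function.update σ.reg i v, σ.cell⟩

/-- Assignment to an array cell. -/
def State.setCell (σ : State) (a i v : ℕ) : State :=
  ⟨σ.reg, Function.update σ.cell a (Function.update (σ.cell a) i v)⟩

@[simp] theorem State.setReg_reg (σ : State) (i v j : ℕ) :
    (σ.setReg i v).reg j = if j = i then v else σ.reg j := by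
  simp [State.setReg, Function.update_apply]

@[simp] theorem State.setReg_cell (σ : State) (i v : ℕ) : (σ.setReg i v).cell = σ.cell := rfl

@[simp] theorem State.setCell_reg (σ : State) (a i v : ℕ) : (σ.setCell a i v).reg = σ.reg := rfl

theorem State.setCell_cell (σ : State) (a i v b : ℕ) :
    (σ.setCell a i v).cell b = if b = a then Function.update (σ.cell a) i v else σ.cell b := by
  simp only [State.setCell, Function.update_apply]

@[simp] theorem State.setCell_cell_apply (σ : State) (a i v b j : ℕ) :
    (σ.setCell a i v).cell b j = if b = a ∧ j = i then v else σ.cell b j := by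
  rw [State.setCell_cell]
  by_cases h : b = a
  · subst h; simp [Function.update_apply]
  · simp [h]

/-- Programs whose loops run a counter register up to the value of a register. -/
inductive Cmd
  | skip
  | set (i : ℕ) (e : Expr)
  | store (a : ℕ) (index e : Expr)
  | seq (p q : Cmd)
  | ite (test : Expr) (p q : Cmd)
  | for (i bound : ℕ) (body : Cmd)

namespace Cmd

/-- The states at the beginning of the rounds of a counting loop. -/
def iterate (f : State → State) (i : ℕ) (σ : State) : ℕ → State
  | 0 => σ.setReg i 0
  | k + 1 => (f (iterate f i σ k)).setReg i (k + 1)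

/-- The state transformation defined by a structured program. -/
def run : Cmd → State → State
  | skip, σ => σ
  | set i e, σ => σ.setReg i (e.eval σ)
  | store a index e, σ => σ.setCell a (index.eval σ) (e.eval σ)
  | seq p q, σ => q.run (p.run σ)
  | ite test p q, σ => if test.eval σ ≠ 0 then p.run σ else q.run σ
  | .for i bound body, σ => iterate body.run i σ (σ.reg bound)

/-- Translation into programs of the machine. -/
def compile : Cmd → Prog
  | skip => .skip
  | set i e => .set i e
  | store a index e => .store a index e
  | seq p q => .seq p.compile q.compile
  | ite test p q => .ite test p.compile q.compile
  | .for i bound body => .seq (.set i (.const 0)) (.loop (.op .lt (.reg i) (.reg bound))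
      (.seq body.compile (.set i (.op .add (.reg i) (.const 1)))))

/-- The registers a program may change. -/
def writesReg : Cmd → List ℕ
  | skip => []
  | set i _ => [i]
  | store _ _ _ => []
  | seq p q => p.writesReg ++ q.writesReg
  | ite _ p q => p.writesReg ++ q.writesReg
  | .for i _ body => i :: body.writesReg

/-- The arrays a program may change. -/
def writesCell : Cmd → List ℕ
  | skip => []
  | set _ _ => []
  | store a _ _ => [a]
  | seq p q => p.writesCell ++ q.writesCell
  | ite _ p q => p.writesCell ++ q.writesCell
  | .for _ _ body => body.writesCell

/-- Frame rule. The list of written registers is computable, so for a concrete program the side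
condition is settled by `decide`; `run_cell` plays the same role for arrays. -/
theorem run_reg : ∀ (c : Cmd) (σ : State) {j : ℕ}, j ∉ c.writesReg → (c.run σ).reg j = σ.reg j
  | skip, _, _, _ => rfl
  | set i e, σ, j, h => by simp_all [run, writesReg]
  | store a index e, σ, j, _ => by simp [run]
  | seq p q, σ, j, h => by
      simp only [writesReg, List.mem_append, not_or] at h
      rw [run, q.run_reg _ h.2, p.run_reg _ h.1]
  | ite test p q, σ, j, h => by
      simp only [writesReg, List.mem_append, not_or] at h
      rw [run]; split
      · exact p.run_reg _ h.1
      · exact q.run_reg _ h.2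
  | .for i bound body, σ, j, h => by
      simp only [writesReg, List.mem_cons, not_or] at h
      rw [run]
      induction σ.reg bound with
      | zero => simp [iterate, h.1]
      | succ k ih => simp [iterate, h.1, body.run_reg _ h.2, ih]

theorem run_cell : ∀ (c : Cmd) (σ : State) {a : ℕ}, a ∉ c.writesCell → (c.run σ).cell a = σ.cell a
  | skip, _, _, _ => rfl
  | set i e, σ, a, h => by simp [run]
  | store b index e, σ, a, h => by
      simp only [writesCell, List.mem_singleton] at h
      rw [run, State.setCell_cell, if_neg h]
  | seq p q, σ, j, h => by
      simp only [writesCell, List.mem_append, not_or] at h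
      rw [run, q.run_cell _ h.2, p.run_cell _ h.1]
  | ite test p q, σ, j, h => by
      simp only [writesCell, List.mem_append, not_or] at h
      rw [run]; split
      · exact p.run_cell _ h.1
      · exact q.run_cell _ h.2
  | .for i bound body, σ, j, h => by
      simp only [writesCell] at h
      rw [run]
      induction σ.reg bound with
      | zero => simp [iterate]
      | succ k ih => simp [iterate, body.run_cell _ h, ih]

/-- The invariant rule for counting loops. In the loop body one may use that everything the loop
does not write to has its original value. -/
theorem run_for_induction {i bound : ℕ} {body : Cmd} {σ : State} (I : ℕ → State → Prop)
    (zero : I 0 (σ.setReg i 0))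
    (succ : ∀ k < σ.reg bound, ∀ τ : State, τ.reg i = k →
      (∀ j ∉ (Cmd.for i bound body).writesReg, τ.reg j = σ.reg j) →
      (∀ a ∉ (Cmd.for i bound body).writesCell, τ.cell a = σ.cell a) →
      I k τ → I (k + 1) ((body.run τ).setReg i (k + 1))) :
    I (σ.reg bound) ((Cmd.for i bound body).run σ) := by
  have key : ∀ k ≤ σ.reg bound, I k (iterate body.run i σ k) ∧
      (iterate body.run i σ k).reg i = k ∧
      (∀ j ∉ (Cmd.for i bound body).writesReg, (iterate body.run i σ k).reg j = σ.reg j) ∧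
      (∀ a ∉ (Cmd.for i bound body).writesCell,
        (iterate body.run i σ k).cell a = σ.cell a) := by
    intro k
    induction k with
    | zero =>
      refine fun _ => ⟨zero, by simp [iterate], fun j hj => ?_, fun a _ => rfl⟩
      simp only [writesReg, List.mem_cons, not_or] at hj
      simp [iterate, hj.1]
    | succ k ih =>
      intro hk
      obtain ⟨h1, h2, h3, h4⟩ := ih (by omega)
      refine ⟨succ k (by omega) _ h2 h3 h4 h1, by simp [iterate], fun j hj => ?_, fun a ha => ?_⟩
      · have := h3 j hj
        simp only [writesReg, List.mem_cons, not_or] at hj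
        simp [iterate, hj.1, body.run_reg _ hj.2, this]
      · have := h4 a ha
        simp only [writesCell] at ha
        simp [iterate, body.run_cell _ ha, this]
  exact (key _ le_rfl).1

end Cmd

/-! ### A syntactic criterion for polynomial running time -/

/-- Whether the expression is a constant, or an entry of the frozen part of the memory. -/
def Expr.frozen (Fr Fa : List ℕ) : Expr → Bool
  | .const _ => true
  | .reg i => i ∈ Fr
  | .cell a _ => a ∈ Fa
  | .op _ _ _ => false

/-- Whether every product in the expression has a frozen factor on the right. -/
def Expr.tame (Fr Fa : List ℕ) : Expr → Bool
  | .const _ => true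
  | .reg _ => true
  | .cell _ e => e.tame Fr Fa
  | .op .mul e₁ e₂ => e₁.tame Fr Fa && e₂.tame Fr Fa && e₂.frozen Fr Fa
  | .op _ e₁ e₂ => e₁.tame Fr Fa && e₂.tame Fr Fa

/-- The size of an expression. -/
def Expr.weight : Expr → ℕ
  | .const k => k.size + 1
  | .reg _ => 1
  | .cell _ e => e.weight + 1
  | .op _ e₁ e₂ => e₁.weight + e₂.weight + 1

/-- All entries of the memory have at most `s` binary digits. -/
def State.Bounded (s : ℕ) (σ : State) : Prop :=
  (∀ i, (σ.reg i).size ≤ s) ∧ ∀ a j, (σ.cell a j).size ≤ s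

/-- The frozen entries of the memory have at most `s` binary digits. -/
def State.FrozenBounded (Fr Fa : List ℕ) (s : ℕ) (σ : State) : Prop :=
  (∀ i ∈ Fr, (σ.reg i).size ≤ s) ∧ ∀ a ∈ Fa, ∀ j, (σ.cell a j).size ≤ s

theorem size_add_le (a b : ℕ) : (a + b).size ≤ max a.size b.size + 1 := by
  rw [Nat.size_le, pow_succ]
  have h1 : a < 2 ^ max a.size b.size :=
    (Nat.lt_size_self a).trans_le (Nat.pow_le_pow_right (by norm_num) (le_max_left _ _))
  have h2 : b < 2 ^ max a.size b.size :=
    (Nat.lt_size_self b).trans_le (Nat.pow_le_pow_right (by norm_num) (le_max_right _ _))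
  omega

theorem size_mul_le (a b : ℕ) : (a * b).size ≤ a.size + b.size := by
  rw [Nat.size_le, pow_add]
  exact Nat.mul_lt_mul'' (Nat.lt_size_self a) (Nat.lt_size_self b)

/-- The digit bound `s` of the memory enters with coefficient one: in a product only the left factor
can have about `s` digits, because the right one is a constant or frozen. This excludes repeated
squaring and keeps the growth additive from step to step. -/
theorem Expr.size_eval_le {Fr Fa : List ℕ} {s s₀ : ℕ} {σ : State} (hσ : σ.Bounded s)
    (hf : σ.FrozenBounded Fr Fa s₀) :
    ∀ e : Expr, e.tame Fr Fa → (e.eval σ).size ≤ s + e.weight * (s₀ + 1)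
  | .const k, _ => by simp only [eval, weight]; nlinarith [Nat.zero_le (k.size * s₀)]
  | .reg i, _ => (hσ.1 i).trans (Nat.le_add_right _ _)
  | .cell a e, _ => (hσ.2 a _).trans (Nat.le_add_right _ _)
  | .op o e₁ e₂, h => by
      have key : e₁.tame Fr Fa ∧ e₂.tame Fr Fa := by cases o <;> simp_all [tame]
      have h₁ := size_eval_le hσ hf e₁ key.1
      have h₂ := size_eval_le hσ hf e₂ key.2
      set a := e₁.eval σ with ha
      set b := e₂.eval σ with hb
      have hw : (Expr.op o e₁ e₂).weight * (s₀ + 1) =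
          e₁.weight * (s₀ + 1) + e₂.weight * (s₀ + 1) + (s₀ + 1) := by simp only [weight]; ring
      rw [hw]
      change (o.eval a b).size ≤ _
      cases o with
      | add =>
        refine (size_add_le a b).trans ?_
        have := max_le_iff.2 ⟨h₁.trans (Nat.le_add_right _ (e₂.weight * (s₀ + 1))),
          h₂.trans (by omega : _ ≤ s + e₁.weight * (s₀ + 1) + e₂.weight * (s₀ + 1))⟩
        omega
      | sub => exact (Nat.size_le_size (Nat.sub_le a b)).trans (by omega)
      | mul =>
        have hfro : e₂.frozen Fr Fa := by simp_all [tame]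
        have hb' : b.size ≤ e₂.weight * (s₀ + 1) + s₀ := by
          cases e₂ with
          | const k => simp only [hb, eval, weight]; nlinarith [Nat.zero_le (k.size * s₀)]
          | reg i => exact (hf.1 i (by simpa [frozen] using hfro)).trans (Nat.le_add_left _ _)
          | cell c e => exact (hf.2 c (by simpa [frozen] using hfro) _).trans (Nat.le_add_left _ _)
          | op => simp [frozen] at hfro
        exact (size_mul_le a b).trans (by omega)
      | div => exact (Nat.size_le_size (Nat.div_le_self a b)).trans (by omega)
      | lt | eq =>
        refine le_trans ?_ (show 1 ≤ _ by omega)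
        simp only [Op.eval]; split <;> simp

theorem Expr.cost_le {Fr Fa : List ℕ} {s s₀ : ℕ} {σ : State} (hσ : σ.Bounded s)
    (hf : σ.FrozenBounded Fr Fa s₀) :
    ∀ e : Expr, e.tame Fr Fa → ∀ w, e.weight ≤ w → e.cost σ ≤ e.weight * (s + w * (s₀ + 1) + 1)
  | .const k, _, w, _ => by
      simp only [cost, weight]; exact Nat.le_mul_of_pos_right _ (by omega)
  | .reg i, _, w, _ => by
      have := hσ.1 i
      simp only [cost, weight]; omega
  | .cell a e, h, w, hw => by
      have := hσ.2 a (e.eval σ)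
      simp only [weight] at hw
      have := cost_le hσ hf e h w (by omega)
      simp only [cost, weight, add_mul, one_mul] at *; omega
  | .op o e₁ e₂, h, w, hw => by
      have key : e₁.tame Fr Fa ∧ e₂.tame Fr Fa := by cases o <;> simp_all [tame]
      have hs := size_eval_le hσ hf _ h
      have hs' := Nat.mul_le_mul_right (s₀ + 1) hw
      have h₁ := cost_le hσ hf e₁ key.1 w (by simp only [weight] at hw; omega)
      have h₂ := cost_le hσ hf e₂ key.2 w (by simp only [weight] at hw; omega)
      have e : (Expr.op o e₁ e₂).weight * (s + w * (s₀ + 1) + 1) =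
        e₁.weight * (s + w * (s₀ + 1) + 1) + e₂.weight * (s + w * (s₀ + 1) + 1) +
          (s + w * (s₀ + 1) + 1) := by simp only [weight]; ring
      rw [e]
      simp only [cost]
      simp only [eval] at hs
      omega

namespace Cmd

/-- Whether the program leaves the registers `Ls`, `Fr` and the arrays `Fa` alone, uses only
registers of `Ls` as loop bounds, and every product has a frozen factor. -/
def tame (Ls Fr Fa : List ℕ) : Cmd → Bool
  | skip => true
  | set i e => i ∉ Ls && i ∉ Fr && e.tame Fr Fa
  | store a index e => a ∉ Fa && index.tame Fr Fa && e.tame Fr Fa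
  | seq p q => p.tame Ls Fr Fa && q.tame Ls Fr Fa
  | ite test p q => test.tame Fr Fa && p.tame Ls Fr Fa && q.tame Ls Fr Fa
  | .for i bound body => i ∉ Ls && i ∉ Fr && bound ∈ Ls && body.tame (i :: Ls) (i :: Fr) Fa

/-- A bound for the number of steps of the program, as a polynomial in a bound for the number of
rounds of every loop. -/
noncomputable def steps : Cmd → Polynomial ℕ
  | skip => 1
  | set _ e => (e.weight + 1 : ℕ)
  | store _ index e => (index.weight + e.weight + 1 : ℕ)
  | seq p q => p.steps + q.steps + 1
  | ite test p q => (test.weight + 1 : ℕ) + p.steps + q.steps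
  | .for _ _ body => Polynomial.X * (body.steps + 12) + 12

theorem not_mem_of_tame : ∀ (c : Cmd) {Ls Fr Fa : List ℕ}, c.tame Ls Fr Fa →
    (∀ i ∈ Ls, i ∉ c.writesReg) ∧ (∀ i ∈ Fr, i ∉ c.writesReg) ∧ (∀ a ∈ Fa, a ∉ c.writesCell)
  | skip, _, _, _, _ => by simp [writesReg, writesCell]
  | set i e, Ls, Fr, Fa, h => by
      simp only [tame, Bool.and_eq_true, decide_eq_true_eq] at h
      simp only [writesReg, writesCell, List.mem_singleton]
      exact ⟨by rintro _ h' rfl; exact h.1.1 h', by rintro _ h' rfl; exact h.1.2 h', by simp⟩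
  | store a index e, Ls, Fr, Fa, h => by
      simp only [tame, Bool.and_eq_true, decide_eq_true_eq] at h
      simp only [writesReg, writesCell, List.mem_singleton]
      exact ⟨by simp, by simp, by rintro _ h' rfl; exact h.1.1 h'⟩
  | seq p q, Ls, Fr, Fa, h => by
      simp only [tame, Bool.and_eq_true] at h
      have hp := p.not_mem_of_tame h.1
      have hq := q.not_mem_of_tame h.2
      simp only [writesReg, writesCell, List.mem_append, not_or]
      exact ⟨fun i hi => ⟨hp.1 i hi, hq.1 i hi⟩, fun i hi => ⟨hp.2.1 i hi, hq.2.1 i hi⟩,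
        fun i hi => ⟨hp.2.2 i hi, hq.2.2 i hi⟩⟩
  | ite test p q, Ls, Fr, Fa, h => by
      simp only [tame, Bool.and_eq_true] at h
      have hp := p.not_mem_of_tame h.1.2
      have hq := q.not_mem_of_tame h.2
      simp only [writesReg, writesCell, List.mem_append, not_or]
      exact ⟨fun i hi => ⟨hp.1 i hi, hq.1 i hi⟩, fun i hi => ⟨hp.2.1 i hi, hq.2.1 i hi⟩,
        fun i hi => ⟨hp.2.2 i hi, hq.2.2 i hi⟩⟩
  | .for i bound body, Ls, Fr, Fa, h => by
      simp only [tame, Bool.and_eq_true, decide_eq_true_eq] at h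
      have hb := body.not_mem_of_tame h.2
      simp only [writesReg, writesCell, List.mem_cons, not_or]
      refine ⟨fun j hj => ⟨?_, hb.1 j (by simp [hj])⟩, fun j hj => ⟨?_, hb.2.1 j (by simp [hj])⟩,
        hb.2.2⟩
      · rintro rfl; exact h.1.1.1 hj
      · rintro rfl; exact h.1.1.2 hj

/-- Invariants of a tame run: bounds for the loop bounds, for the frozen memory, and for the whole
memory. -/
structure Limits (Ls Fr Fa : List ℕ) (m s₀ s : ℕ) (σ : State) : Prop where
  loop : ∀ i ∈ Ls, σ.reg i ≤ m
  frozen : σ.FrozenBounded Fr Fa s₀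
  all : σ.Bounded s

theorem Limits.run {Ls Fr Fa : List ℕ} {m s₀ s s' : ℕ} {σ : State} (h : Limits Ls Fr Fa m s₀ s σ)
    {c : Cmd} (hc : c.tame Ls Fr Fa) (hs : (c.run σ).Bounded s') :
    Limits Ls Fr Fa m s₀ s' (c.run σ) := by
  obtain ⟨h1, h2, h3⟩ := c.not_mem_of_tame hc
  refine ⟨fun i hi => ?_, ⟨fun i hi => ?_, fun a ha j => ?_⟩, hs⟩
  · rw [c.run_reg _ (h1 i hi)]; exact h.loop i hi
  · rw [c.run_reg _ (h2 i hi)]; exact h.frozen.1 i hi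
  · rw [c.run_cell _ (h3 a ha)]; exact h.frozen.2 a ha j

theorem _root_.RAM.State.Bounded.mono {s s' : ℕ} {σ : State} (h : σ.Bounded s) (hs : s ≤ s') :
    σ.Bounded s' :=
  ⟨fun i => (h.1 i).trans hs, fun a j => (h.2 a j).trans hs⟩

theorem _root_.RAM.State.Bounded.setReg {s : ℕ} {σ : State} (h : σ.Bounded s) {i v : ℕ}
    (hv : v.size ≤ s) : (σ.setReg i v).Bounded s := by
  refine ⟨fun j => ?_, h.2⟩
  rw [State.setReg_reg]; split
  · exact hv
  · exact h.1 j

theorem _root_.RAM.State.Bounded.setCell {s : ℕ} {σ : State} (h : σ.Bounded s) {a i v : ℕ}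
    (hv : v.size ≤ s) : (σ.setCell a i v).Bounded s := by
  refine ⟨h.1, fun b j => ?_⟩
  rw [State.setCell_cell_apply]; split
  · exact hv
  · exact h.2 b j

/-- Each elementary step adds a multiple of `s₀ + 1` to the digit bound, so sizes grow linearly in
the number of steps, and the time is at most the number of steps times the final size. The bound
`s₀` for frozen entries stays fixed while `s` grows, which is why the two are kept apart. -/
theorem exec_aux {m s₀ : ℕ} (hm : m.size ≤ s₀) :
    ∀ (c : Cmd) {Ls Fr Fa : List ℕ} {s : ℕ} {σ : State}, c.tame Ls Fr Fa →
      Limits Ls Fr Fa m s₀ s σ → ∃ t, Exec c.compile σ (c.run σ) t ∧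
        t ≤ c.steps.eval m * (s + c.steps.eval m * (s₀ + 1) + 1) ∧
        (c.run σ).Bounded (s + c.steps.eval m * (s₀ + 1))
  | skip, Ls, Fr, Fa, s, σ, hc, hσ => by
      refine ⟨_, Exec.skip σ, ?_, hσ.all.mono (Nat.le_add_right _ _)⟩
      simp only [steps, Polynomial.eval_one, one_mul]; omega
  | set i e, Ls, Fr, Fa, s, σ, hc, hσ => by
      simp only [tame, Bool.and_eq_true, decide_eq_true_eq] at hc
      have h1 := e.size_eval_le hσ.all hσ.frozen hc.2
      have h2 := e.cost_le hσ.all hσ.frozen hc.2 (e.weight + 1) (by omega)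
      have h3 : (e.weight + 1) * (s₀ + 1) = e.weight * (s₀ + 1) + (s₀ + 1) := by ring
      refine ⟨_, Exec.set i e σ, ?_, ?_⟩
      · simp only [steps, Polynomial.eval_natCast, Nat.cast_id]
        rw [add_mul, one_mul]; omega
      · simp only [steps, Polynomial.eval_natCast, Nat.cast_id]
        exact (hσ.all.mono (Nat.le_add_right _ _)).setReg (by omega)
  | store a index e, Ls, Fr, Fa, s, σ, hc, hσ => by
      simp only [tame, Bool.and_eq_true, decide_eq_true_eq] at hc
      have h1 := e.size_eval_le hσ.all hσ.frozen hc.2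
      have h2 := e.cost_le hσ.all hσ.frozen hc.2 (index.weight + e.weight + 1) (by omega)
      have h4 := index.cost_le hσ.all hσ.frozen hc.1.2 (index.weight + e.weight + 1) (by omega)
      have h3 : (index.weight + e.weight + 1) * (s₀ + 1) =
        index.weight * (s₀ + 1) + e.weight * (s₀ + 1) + (s₀ + 1) := by ring
      refine ⟨_, Exec.store a index e σ, ?_, ?_⟩
      · simp only [steps, Polynomial.eval_natCast, Nat.cast_id]
        rw [add_mul, add_mul, one_mul]; omega
      · simp only [steps, Polynomial.eval_natCast, Nat.cast_id]
        exact (hσ.all.mono (Nat.le_add_right _ _)).setCell (by omega)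
  | seq p q, Ls, Fr, Fa, s, σ, hc, hσ => by
      simp only [tame, Bool.and_eq_true] at hc
      obtain ⟨t, ht, ht', hb⟩ := exec_aux hm p hc.1 hσ
      obtain ⟨u, hu, hu', hb'⟩ := exec_aux hm q hc.2 (hσ.run hc.1 hb)
      refine ⟨_, Exec.seq ht hu, ?_, ?_⟩
      · simp only [steps, Polynomial.eval_add, Polynomial.eval_one]
        have e1 : (p.steps.eval m + q.steps.eval m + 1) * (s₀ + 1) =
          p.steps.eval m * (s₀ + 1) + q.steps.eval m * (s₀ + 1) + (s₀ + 1) := by ring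
        have e2 : t ≤ p.steps.eval m *
            (s + (p.steps.eval m + q.steps.eval m + 1) * (s₀ + 1) + 1) :=
          ht'.trans (Nat.mul_le_mul_left _ (by omega))
        have e3 : u ≤ q.steps.eval m *
            (s + (p.steps.eval m + q.steps.eval m + 1) * (s₀ + 1) + 1) :=
          hu'.trans (Nat.mul_le_mul_left _ (by omega))
        rw [add_mul, add_mul, one_mul]
        omega
      · refine hb'.mono ?_
        simp only [steps, Polynomial.eval_add, Polynomial.eval_one, add_mul]
        omega
  | ite test p q, Ls, Fr, Fa, s, σ, hc, hσ => by
      simp only [tame, Bool.and_eq_true] at hc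
      simp only [steps, Polynomial.eval_add, Polynomial.eval_natCast, Nat.cast_id]
      set G := test.weight + 1 + p.steps.eval m + q.steps.eval m with hG
      have hcost := test.cost_le hσ.all hσ.frozen hc.1.1 G (by omega)
      by_cases h : test.eval σ = 0
      · obtain ⟨t, ht, ht', hb⟩ := exec_aux hm q hc.2 hσ
        have hr : (ite test p q).run σ = q.run σ := by simp [run, h]
        have hG' : q.steps.eval m * (s₀ + 1) ≤ G * (s₀ + 1) := Nat.mul_le_mul_right _ (by omega)
        rw [hr]
        refine ⟨_, Exec.ite_false h ht, ?_, hb.mono (by omega)⟩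
        have e3 : t ≤ q.steps.eval m * (s + G * (s₀ + 1) + 1) :=
          ht'.trans (Nat.mul_le_mul_left _ (by omega))
        have : G * (s + G * (s₀ + 1) + 1) = test.weight * (s + G * (s₀ + 1) + 1) +
          (s + G * (s₀ + 1) + 1) + p.steps.eval m * (s + G * (s₀ + 1) + 1) +
            q.steps.eval m * (s + G * (s₀ + 1) + 1) := by rw [hG]; ring
        omega
      · obtain ⟨t, ht, ht', hb⟩ := exec_aux hm p hc.1.2 hσ
        have hr : (ite test p q).run σ = p.run σ := by simp [run, h]
        have hG' : p.steps.eval m * (s₀ + 1) ≤ G * (s₀ + 1) := Nat.mul_le_mul_right _ (by omega)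
        rw [hr]
        refine ⟨_, Exec.ite_true h ht, ?_, hb.mono (by omega)⟩
        have e3 : t ≤ p.steps.eval m * (s + G * (s₀ + 1) + 1) :=
          ht'.trans (Nat.mul_le_mul_left _ (by omega))
        have : G * (s + G * (s₀ + 1) + 1) = test.weight * (s + G * (s₀ + 1) + 1) +
          (s + G * (s₀ + 1) + 1) + p.steps.eval m * (s + G * (s₀ + 1) + 1) +
            q.steps.eval m * (s + G * (s₀ + 1) + 1) := by rw [hG]; ring
        omega
  | .for i bound body, Ls, Fr, Fa, s, σ, hc, hσ => by
      have hc' := hc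
      simp only [tame, Bool.and_eq_true, decide_eq_true_eq] at hc
      obtain ⟨⟨⟨hiL, hiF⟩, hbL⟩, hbody⟩ := hc
      simp only [steps, Polynomial.eval_add, Polynomial.eval_mul, Polynomial.eval_X,
        Polynomial.eval_ofNat]
      set N := σ.reg bound with hN
      have hNm : N ≤ m := hσ.loop bound hbL
      set b := body.steps.eval m with hb
      set w := s₀ + 1 with hw
      obtain ⟨hw1, hw2, hw3⟩ := body.not_mem_of_tame hbody
      -- `run` reads the loop bound once, whereas the compiled loop rereads it before every round.
      -- They agree because tameness forbids the body to write the bound or the counter. The summand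
      -- `w` leaves room for the counter itself.
      have hst : ∀ k ≤ N, Limits (i :: Ls) (i :: Fr) Fa m s₀ (s + (k * b) * w + w)
          (iterate body.run i σ k) ∧ (iterate body.run i σ k).reg i = k ∧
          (iterate body.run i σ k).reg bound = N := by
        have hsz : ∀ k ≤ N, k.size ≤ s₀ := fun k hk =>
          (Nat.size_le_size (hk.trans hNm)).trans hm
        have hib : bound ≠ i := by rintro rfl; exact hiL hbL
        intro k
        induction k with
        | zero =>
          intro _
          refine ⟨⟨?_, ⟨?_, ?_⟩, ?_⟩, by simp [iterate], by simp [iterate, hib, hN]⟩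
          · intro j hj
            rcases List.mem_cons.1 hj with rfl | hj'
            · simp [iterate]
            · have : j ≠ i := by rintro rfl; exact hiL hj'
              simpa [iterate, this] using hσ.loop j hj'
          · intro j hj
            rcases List.mem_cons.1 hj with rfl | hj'
            · simp [iterate]
            · have : j ≠ i := by rintro rfl; exact hiF hj'
              simpa [iterate, this] using hσ.frozen.1 j hj'
          · exact hσ.frozen.2
          · exact (hσ.all.mono (by omega)).setReg (by simp)
        | succ k ih =>
          intro hk
          obtain ⟨h1, h2, h3⟩ := ih (by omega)
          obtain ⟨t, -, -, hbd⟩ := exec_aux hm body hbody h1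
          have h4 := h1.run hbody hbd
          refine ⟨⟨?_, ⟨?_, ?_⟩, ?_⟩, by simp [iterate], ?_⟩
          · intro j hj
            by_cases hji : j = i
            · subst hji; simpa [iterate] using hk.trans hNm
            · simpa [iterate, hji] using h4.loop j hj
          · intro j hj
            by_cases hji : j = i
            · subst hji; simpa [iterate] using hsz _ hk
            · simpa [iterate, hji] using h4.frozen.1 j hj
          · exact h4.frozen.2
          · refine State.Bounded.setReg (hbd.mono ?_) ?_
            · have : (k + 1) * b * w = k * b * w + b * w := by ring
              change s + k * b * w + w + b * w ≤ s + (k + 1) * b * w + w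
              omega
            · have := hsz _ hk; omega
          · simp [iterate, hib, body.run_reg _ (hw1 bound (by simp [hbL])), h3]
      -- `B` dominates the digit bound in every round. The constants `12` in `steps` are slack that
      -- pays for initializing, testing and incrementing the counter.
      set B := s + (m * (b + 12) + 12) * w + 1 with hB
      have hBk' : ∀ k < N, s + (k * b) * w + w + b * w + 1 ≤ B := by
        intro k hk
        have : (k + 1) * b * w ≤ m * (b + 12) * w :=
          Nat.mul_le_mul_right _ (Nat.mul_le_mul (by omega) (by omega))
        have e : (m * (b + 12) + 12) * w = m * (b + 12) * w + 12 * w := by ring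
        have e' : (k + 1) * b * w = k * b * w + b * w := by ring
        omega
      have hs₀ : w + 3 * w + 1 ≤ B := by
        have e : (m * (b + 12) + 12) * w = m * (b + 12) * w + 12 * w := by ring
        omega
      have hsz : ∀ k ≤ N, k.size + 1 ≤ w := fun k hk =>
        Nat.succ_le_succ ((Nat.size_le_size (hk.trans hNm)).trans hm)
      -- Induction on the number `j` of rounds still to come, since `Exec.loop_true` splits off the
      -- first round.
      have hrun : ∀ j ≤ N, ∃ t, Exec (.loop (.op .lt (.reg i) (.reg bound)) (.seq body.compile
              (.set i (.op .add (.reg i) (.const 1))))) (iterate body.run i σ (N - j))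
              (iterate body.run i σ N) t ∧ t ≤ j * ((b + 12) * B) + 4 * B := by
        intro j
        induction j with
        | zero =>
          intro _
          obtain ⟨-, h2, h3⟩ := hst N le_rfl
          refine ⟨_, Exec.loop_false ?_, ?_⟩
          · simp [Expr.eval, Op.eval, h2, h3]
          · simp only [Nat.sub_zero, Expr.cost, Expr.eval, Op.eval, h2, h3, lt_irrefl, if_false]
            have := hsz N le_rfl
            simp only [Nat.size_zero]; omega
        | succ j ih =>
          intro hj
          obtain ⟨t, ht, ht'⟩ := ih (by omega)
          obtain ⟨k, hk, hkN⟩ : ∃ k, N - (j + 1) = k ∧ N - j = k + 1 := ⟨_, rfl, by omega⟩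
          rw [hkN] at ht
          rw [hk]
          have hkN' : k < N := by omega
          obtain ⟨h1, h2, h3⟩ := hst k (by omega)
          obtain ⟨u, hu, hu', -⟩ := exec_aux hm body hbody h1
          have hri : (body.run (iterate body.run i σ k)).reg i = k := by
            rw [body.run_reg _ (hw1 i (by simp)), h2]
          have hset : Exec (.set i (.op .add (.reg i) (.const 1)))
              (body.run (iterate body.run i σ k)) (iterate body.run i σ (k + 1))
              ((Expr.op .add (.reg i) (.const 1)).cost (body.run (iterate body.run i σ k)) + 1) := by
            have := Exec.set i (.op .add (.reg i) (.const 1)) (body.run (iterate body.run i σ k))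
            simp only [Expr.eval, Op.eval, hri] at this
            exact this
          refine ⟨_, Exec.loop_true ?_ (Exec.seq hu hset) ht, ?_⟩
          · simp [Expr.eval, Op.eval, h2, h3, hkN']
          · simp only [Expr.cost, Expr.eval, Op.eval, h2, h3, hri, hkN', if_true, Nat.size_one]
            have e1 := hsz k (by omega)
            have e2 := hsz (k + 1) (by omega)
            have e3 := hsz N le_rfl
            have e4 : u ≤ b * B := hu'.trans (Nat.mul_le_mul_left _ (hBk' k hkN'))
            have e5 : (j + 1) * ((b + 12) * B) = j * ((b + 12) * B) + b * B + 12 * B := by ring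
            omega
      obtain ⟨t, ht, ht'⟩ := hrun N le_rfl
      rw [Nat.sub_self] at ht
      refine ⟨_, Exec.seq (Exec.set i (.const 0) σ) ht, ?_, ?_⟩
      · have e1 : N * ((b + 12) * B) ≤ m * ((b + 12) * B) := Nat.mul_le_mul_right _ hNm
        have e2 : (m * (b + 12) + 12) * B = m * ((b + 12) * B) + 12 * B := by ring
        simp only [Expr.cost, Nat.size_zero]
        rw [e2]
        omega
      · refine (hst N le_rfl).1.all.mono ?_
        have : N * b * w ≤ m * (b + 12) * w :=
          Nat.mul_le_mul_right _ (Nat.mul_le_mul hNm (by omega))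
        have e : (m * (b + 12) + 12) * w = m * (b + 12) * w + 12 * w := by ring
        omega

/-- A tame program whose loop bounds are at most `m`, started on a memory with entries of at most
`s` digits, has polynomial running time in `m` and `s`. -/
theorem exec {c : Cmd} {Ls Fr Fa : List ℕ} (hc : c.tame Ls Fr Fa) {m s : ℕ} (hm : m.size ≤ s)
    {σ : State} (hL : ∀ i ∈ Ls, σ.reg i ≤ m) (hσ : σ.Bounded s) :
    ∃ t, Exec c.compile σ (c.run σ) t ∧
      t ≤ c.steps.eval m * (s + c.steps.eval m * (s + 1) + 1) ∧
      (c.run σ).Bounded (s + c.steps.eval m * (s + 1)) :=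
  exec_aux hm c hc ⟨hL, ⟨fun i _ => hσ.1 i, fun a _ j => hσ.2 a j⟩, hσ⟩

end Cmd

end RAM

/-! ### Chordless paths and separators of chordal graphs -/

namespace SimpleGraph

variable {V : Type*} {G : SimpleGraph V}

/-- A shortest walk among those inside the support of `p` is chordless: replacing the stretch
between positions `i < j` by an edge shortens it unless `j = i + 1`. Passing to `bypass` makes it a
path without making it longer. -/
theorem Walk.exists_isPath_isChordless {a b : V} (p : G.Walk a b) :
    ∃ q : G.Walk a b, q.IsPath ∧ q.support ⊆ p.support ∧ q.IsChordless := by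
  classical
  have hex : ∃ m, ∃ q : G.Walk a b, q.length = m ∧ q.support ⊆ p.support :=
    ⟨_, p, rfl, fun _ h => h⟩
  obtain ⟨q₀, hq₀, hs₀⟩ := Nat.find_spec hex
  have hmin : ∀ r : G.Walk a b, r.support ⊆ p.support → q₀.length ≤ r.length := fun r hr =>
    hq₀ ▸ Nat.find_min' hex ⟨r, rfl, hr⟩
  set q := q₀.bypass with hq
  have hqs : q.support ⊆ p.support := fun _ h => hs₀ (Walk.support_bypass_subset_support q₀ h)
  have hlen : q.length ≤ q₀.length := Walk.length_bypass_le_length q₀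
  refine ⟨q, q₀.bypass_isPath, hqs, Walk.isChordless_iff_forall_mem_edges.2 ?_⟩
  have key : ∀ i j, i < j → j ≤ q.length → G.Adj (q.getVert i) (q.getVert j) →
      s(q.getVert i, q.getVert j) ∈ q.edges := by
    intro i j hij hj hadj
    have hsub : ((q.take i).append (Walk.cons hadj (q.drop j))).support ⊆ p.support := by
      intro z hz
      rw [Walk.mem_support_append_iff, Walk.support_cons, List.mem_cons] at hz
      rcases hz with hz | rfl | hz
      · exact hqs (by rw [Walk.support_take] at hz; exact List.mem_of_mem_take hz)
      · exact hqs (q.getVert_mem_support i)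
      · exact hqs (by rw [Walk.drop_support_eq_support_drop_min] at hz; exact List.mem_of_mem_drop hz)
    have := hmin _ hsub
    rw [Walk.length_append, Walk.length_cons, Walk.take_length, Walk.drop_length] at this
    obtain rfl : j = i + 1 := by omega
    have hi : i < q.edges.length := by rw [Walk.length_edges]; omega
    have : q.edges[i] = s(q.getVert i, q.getVert (i + 1)) := by
      simp [Walk.edges, Walk.darts_getElem_eq_getVert]
    rw [← this]
    exact List.getElem_mem _
  intro u v hu hv hadj
  obtain ⟨i, rfl, hi⟩ := Walk.mem_support_iff_exists_getVert.1 hu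
  obtain ⟨j, rfl, hj⟩ := Walk.mem_support_iff_exists_getVert.1 hv
  rcases lt_trichotomy i j with h | rfl | h
  · exact key i j h hj hadj
  · exact absurd hadj (G.irrefl)
  · rw [Sym2.eq_swap]; exact key j i h hi hadj.symm

/-- In a chordal graph, two vertices that are joined on both sides of a separation are equal or
adjacent. -/
theorem IsChordal.eq_or_adj (hG : G.IsChordal) {C Z : Set V} {a b : V}
    (hCZ : ∀ u ∈ C, ∀ v ∈ Z, u ≠ v ∧ ¬ G.Adj u v) (haC : a ∉ C) (hbC : b ∉ C)
    (haZ : a ∉ Z) (hbZ : b ∉ Z) (p : G.Walk a b) (hp : ∀ z ∈ p.support, z = a ∨ z = b ∨ z ∈ C)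
    (q : G.Walk a b) (hq : ∀ z ∈ q.support, z = a ∨ z = b ∨ z ∈ Z) : a = b ∨ G.Adj a b := by
  by_contra hab
  push Not at hab
  obtain ⟨hne, hnadj⟩ := hab
  obtain ⟨p, hpp, hps, hpc⟩ := p.exists_isPath_isChordless
  obtain ⟨q, hqp, hqs, hqc⟩ := q.exists_isPath_isChordless
  replace hp := fun z hz => hp z (hps hz)
  replace hq := fun z hz => hq z (hqs hz)
  clear hps hqs
  have hql : 2 ≤ q.length := by
    by_contra h
    have : q.length = 0 ∨ q.length = 1 := by omega
    rcases this with h | h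
    · exact hne (Walk.eq_of_length_eq_zero h)
    · exact hnadj (Walk.adj_of_length_eq_one h)
  cases p with
  | nil => exact hne rfl
  | @cons _ a' _ h p =>
    rw [Walk.cons_isPath_iff] at hpp
    have hap : a ∉ p.support := hpp.2
    have ha' : a' ∈ C := by
      rcases hp a' (by simp) with h' | h' | h'
      · exact absurd (h' ▸ p.start_mem_support) hap
      · exact absurd (h' ▸ h) hnadj
      · exact h'
    have hpl : 1 ≤ p.length := by
      by_contra h'
      exact hbC (Walk.eq_of_length_eq_zero (p := p) (by omega) ▸ ha')
    have hqr : q.reverse.support = b :: q.reverse.support.tail := q.reverse.cons_tail_support.symm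
    have hqrn : (b :: q.reverse.support.tail).Nodup := by
      rw [← hqr, Walk.support_reverse, List.nodup_reverse]; exact hqp.support_nodup
    have hpath : (p.append q.reverse).IsPath := by
      rw [Walk.isPath_def, Walk.support_append, List.nodup_append']
      refine ⟨hpp.1.support_nodup, hqrn.of_cons, fun z hzp hzq => ?_⟩
      have hzb : z ≠ b := by rintro rfl; exact (List.nodup_cons.1 hqrn).1 hzq
      have hza : z ≠ a := by rintro rfl; exact hap hzp
      have h1 : z ∈ C := by
        rcases hp z (by simp [hzp]) with h' | h' | h'
        exacts [absurd h' hza, absurd h' hzb, h']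
      have h2 : z ∈ Z := by
        rcases hq z (by
          have := List.mem_of_mem_tail hzq
          rwa [Walk.support_reverse, List.mem_reverse] at this) with h' | h' | h'
        exacts [absurd h' hza, absurd h' hzb, h']
      exact (hCZ z h1 z h2).1 rfl
    have ha'q : a' ∉ q.support := by
      intro h'
      rcases hq a' h' with h'' | h'' | h''
      · exact haC (h'' ▸ ha')
      · exact hbC (h'' ▸ ha')
      · exact (hCZ a' ha' a' h'').1 rfl
    -- The two paths meet only in `a` and `b`, since `C` and `Z` are disjoint. Each has at least two
    -- edges, because `a` and `b` are distinct and not adjacent, so the cycle has length at least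
    -- four.
    have hcyc : (Walk.cons h (p.append q.reverse)).IsCycle := by
      rw [Walk.cons_isCycle_iff]
      refine ⟨hpath, ?_⟩
      rw [Walk.edges_append, Walk.edges_reverse, List.mem_append, List.mem_reverse]
      rintro (h' | h')
      · exact hap (p.fst_mem_support_of_mem_edges h')
      · exact ha'q (q.snd_mem_support_of_mem_edges h')
    obtain ⟨x, hx, y, hy, hxy, hchord⟩ := hG _ _ hcyc (by
      rw [Walk.length_cons, Walk.length_append, Walk.length_reverse]; omega)
    rw [← Walk.cons_append, Walk.mem_support_append_iff, Walk.support_reverse,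
      List.mem_reverse] at hx hy
    rw [← Walk.cons_append, Walk.edges_append, List.mem_append, Walk.edges_reverse,
      List.mem_reverse, not_or] at hchord
    -- A chord with both ends on one of the paths contradicts chordlessness of that path. Otherwise
    -- its ends are inner vertices of different paths, and it would join `C` to `Z`.
    have hcases : ∀ u v, u ∈ (Walk.cons h p).support → v ∈ q.support → G.Adj u v →
        s(u, v) ∉ (Walk.cons h p).edges → s(u, v) ∉ q.edges → False := by
      intro u v hu hv huv h1 h2
      have hvp : v ∉ (Walk.cons h p).support := fun h' => h1 (hpc.mem_edges hu h' huv)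
      have huq : u ∉ q.support := fun h' => h2 (hqc.mem_edges h' hv huv)
      have hu' : u ∈ C := by
        rcases hp u hu with rfl | rfl | h'
        exacts [absurd q.start_mem_support huq, absurd q.end_mem_support huq, h']
      have hv' : v ∈ Z := by
        rcases hq v hv with rfl | rfl | h'
        exacts [absurd (Walk.start_mem_support _) hvp, absurd (Walk.end_mem_support _) hvp, h']
      exact (hCZ u hu' v hv').2 huv
    rcases hx with hx | hx <;> rcases hy with hy | hy
    · exact hchord.1 (hpc.mem_edges hx hy hxy)
    · exact hcases x y hx hy hxy hchord.1 hchord.2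
    · exact hcases y x hy hx hxy.symm (Sym2.eq_swap ▸ hchord.1) (Sym2.eq_swap ▸ hchord.2)
    · exact hchord.2 (hqc.mem_edges hx hy hxy)

end SimpleGraph

namespace Multicut

open SimpleGraph

variable {V : Type*} {G : SimpleGraph V} {A : Set V} {x : V → ℕ}

theorem isMulticut_iff {T : Set (V × V)} {S : Set V} :
    IsMulticut G T S ↔ ∀ p ∈ T, ∀ q : G.Walk p.1 p.2, ∃ z ∈ q.support, z ∈ S := by
  constructor
  · intro h p hp q
    by_contra! hq
    exact h p hp (hq _ q.start_mem_support) (hq _ q.end_mem_support) ⟨q.induce Sᶜ hq⟩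
  · rintro h p hp hs ht ⟨q⟩
    obtain ⟨z, hz, hzS⟩ := h p hp (q.map (Embedding.induce Sᶜ).toHom)
    obtain ⟨z', -, rfl⟩ := List.mem_map.1
      ((congrArg (z ∈ ·) (Walk.support_map (Embedding.induce Sᶜ).toHom q)).mp hz)
    exact z'.2 hzS

/-! ### Walks with vertex lengths -/

/-- The sum of the lengths of the vertices of a walk, with multiplicity. -/
def walkLength (x : V → ℕ) {a b : V} (p : G.Walk a b) : ℕ := (p.support.map x).sum

theorem walkLength_append_le {a b c : V} (p : G.Walk a b) (q : G.Walk b c) :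
    walkLength x (p.append q) ≤ walkLength x p + walkLength x q := by
  simp only [walkLength, Walk.support_append, List.map_append, List.sum_append]
  refine Nat.add_le_add_left ?_ _
  rw [← q.cons_tail_support, List.map_cons, List.sum_cons, List.tail_cons]
  exact Nat.le_add_left _ _

theorem walkLength_reverse {a b : V} (p : G.Walk a b) :
    walkLength x p.reverse = walkLength x p := by
  simp [walkLength, Walk.support_reverse, List.sum_reverse]

theorem walkLength_concat {a b c : V} (p : G.Walk a b) (h : G.Adj b c) :
    walkLength x (p.concat h) = walkLength x p + x c := by
  simp [walkLength, Walk.support_concat]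

/-- `LenWalk G A x s v r l`: some walk in `A` from `s` to `v` has `r` edges and length `l`. -/
inductive LenWalk (G : SimpleGraph V) (A : Set V) (x : V → ℕ) (s : V) : V → ℕ → ℕ → Prop
  | nil : s ∈ A → LenWalk G A x s s 0 (x s)
  | snoc {u v : V} {r l : ℕ} : LenWalk G A x s u r l → G.Adj u v → v ∈ A →
      LenWalk G A x s v (r + 1) (l + x v)

theorem LenWalk.exists_walk {s v : V} {r l : ℕ} (h : LenWalk G A x s v r l) :
    ∃ p : G.Walk s v, (∀ z ∈ p.support, z ∈ A) ∧ p.length = r ∧ walkLength x p = l := by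
  induction h with
  | nil h => exact ⟨.nil, by simpa using h, rfl, by simp [walkLength]⟩
  | snoc _ hadj hv ih =>
    obtain ⟨p, hp, rfl, rfl⟩ := ih
    refine ⟨p.concat hadj, fun z hz => ?_, by simp, walkLength_concat _ _⟩
    rw [Walk.support_concat, List.mem_append, List.mem_singleton] at hz
    rcases hz with hz | rfl
    exacts [hp z hz, hv]

theorem LenWalk.of_walk {s v : V} (p : G.Walk s v) (hp : ∀ z ∈ p.support, z ∈ A) :
    LenWalk G A x s v p.length (walkLength x p) := by
  induction p using Walk.concatRec with
  | Hnil => simpa [walkLength] using LenWalk.nil (G := G) (x := x) (hp _ (by simp))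
  | Hconcat p h ih =>
    rw [Walk.length_concat, walkLength_concat]
    simp only [Walk.support_concat, List.mem_append, List.mem_singleton] at hp
    exact (ih fun z hz => hp z (Or.inl hz)).snoc h (hp _ (Or.inr rfl))

theorem LenWalk.mem_right {s v : V} {r l : ℕ} (h : LenWalk G A x s v r l) : v ∈ A := by
  cases h <;> assumption

theorem sum_toFinset_le_walkLength [DecidableEq V] {a b : V} (p : G.Walk a b) :
    ∑ v ∈ p.support.toFinset, x v ≤ walkLength x p := by
  unfold walkLength
  generalize p.support = l
  induction l with
  | nil => simp
  | cons a l ih =>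
    rw [List.toFinset_cons, List.map_cons, List.sum_cons]
    by_cases h : a ∈ l.toFinset
    · rw [Finset.insert_eq_of_mem h]; omega
    · rw [Finset.sum_insert h]; omega

theorem walkLength_eq_sum [DecidableEq V] {a b : V} {p : G.Walk a b} (hp : p.IsPath) :
    walkLength x p = ∑ v ∈ p.support.toFinset, x v := by
  rw [walkLength, List.sum_toFinset _ hp.support_nodup]

/-- A walk can be shortened to a path. -/
theorem LenWalk.exists_short [Fintype V] {s v : V} {r l : ℕ} (h : LenWalk G A x s v r l) :
    ∃ r' < Fintype.card V, ∃ l' ≤ l, LenWalk G A x s v r' l' ∧ l' ≤ ∑ v, x v := by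
  classical
  obtain ⟨p, hp, -, rfl⟩ := h.exists_walk
  refine ⟨_, p.bypass_isPath.length_lt, _, ?_,
    LenWalk.of_walk p.bypass fun z hz => hp z (p.support_bypass_subset_support hz), ?_⟩
  · rw [walkLength_eq_sum p.bypass_isPath]
    refine le_trans (Finset.sum_le_sum_of_subset ?_) (sum_toFinset_le_walkLength p)
    intro z hz
    rw [List.mem_toFinset] at hz ⊢
    exact p.support_bypass_subset_support hz
  · rw [walkLength_eq_sum p.bypass_isPath]
    exact Finset.sum_le_sum_of_subset (Finset.subset_univ _)

/-! ### Rounding distances in chordal graphs -/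

/-- `d` is the distance from the root `root v` of the component of `v`, in the graph induced by
`A`. -/
structure IsRootDist (G : SimpleGraph V) (A : Set V) (x : V → ℕ) (root : V → V) (d : V → ℕ) :
    Prop where
  exists_walk : ∀ v ∈ A, ∃ r, LenWalk G A x (root v) v r (d v)
  le : ∀ v ∈ A, ∀ r l, LenWalk G A x (root v) v r l → d v ≤ l
  root_eq : ∀ u ∈ A, ∀ v ∈ A, G.Adj u v → root u = root v

namespace IsRootDist

variable {root : V → V} {d : V → ℕ}

theorem le_add (h : IsRootDist G A x root d) {u v : V} (hu : u ∈ A) (hv : v ∈ A)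
    (huv : G.Adj u v) : d v ≤ d u + x v := by
  obtain ⟨r, hr⟩ := h.exists_walk u hu
  rw [h.root_eq u hu v hv huv] at hr
  exact h.le v hv _ _ (hr.snoc huv hv)

/-- The predecessor of a vertex on a shortest path from the root. -/
theorem pred (h : IsRootDist G A x root d) {s u v : V} {r l : ℕ} (hl : LenWalk G A x s u r l)
    (huv : G.Adj u v) (hv : v ∈ A) (hs : root v = s) (hd : l + x v = d v) :
    u ∈ A ∧ root u = s ∧ l = d u := by
  have hu := hl.mem_right
  have hr := (h.root_eq u hu v hv huv).trans hs
  refine ⟨hu, hr, ?_⟩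
  have h1 := h.le u hu r l (hr ▸ hl)
  have h2 := h.le_add hu hv huv
  omega

/-- Along a shortest walk from the root the distances do not decrease, so the whole walk stays below
the level of its last vertex. -/
theorem exists_inner_walk (h : IsRootDist G A x root d) {c : ℕ} {v : V} (hv : v ∈ A)
    (hc : d v < c) : ∃ p : G.Walk (root v) v, ∀ z ∈ p.support, z ∈ A ∧ d z < c := by
  obtain ⟨r, hr⟩ := h.exists_walk v hv
  generalize hs : root v = s at hr
  generalize hl : d v = l at hr
  clear hv
  induction hr with
  | nil hs' => exact ⟨.nil, fun z hz => by simp only [Walk.support_nil, List.mem_singleton] at hz; subst hz; exact ⟨hs', hc⟩⟩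
  | snoc hr' hadj hv ih =>
    obtain ⟨hu, hru, hlu⟩ := h.pred hr' hadj hv hs hl.symm
    obtain ⟨p, hp⟩ := ih (by omega) hru hlu.symm
    refine ⟨p.concat hadj, fun z hz => ?_⟩
    rw [Walk.support_concat, List.mem_append, List.mem_singleton] at hz
    rcases hz with hz | rfl
    exacts [hp z hz, ⟨hv, hc⟩]

/-- The last vertex of a shortest path from the root that meets level `c`. -/
theorem exists_anchor (h : IsRootDist G A x root d) {c : ℕ} (hc : 0 < c) {v : V} (hv : v ∈ A)
    (hcv : c + x v ≤ d v) : ∃ (a : V) (p : G.Walk a v), a ∈ A ∧ d a < c + x a ∧ c ≤ d a ∧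
      root a = root v ∧ (∀ z ∈ p.support, z = a ∨ z ∈ A ∧ c + x z ≤ d z) ∧
      walkLength x p + d a = d v + x a := by
  obtain ⟨r, hr⟩ := h.exists_walk v hv
  generalize hs : root v = s at hr
  generalize hl : d v = l at hr
  clear hv
  induction hr with
  -- At the root the distance equals the length of the root, so `0 < c` keeps the root from lying
  -- beyond the level.
  | nil hs' => omega
  | @snoc u v r l hr' hadj hv ih =>
    obtain ⟨hu, hru, hlu⟩ := h.pred hr' hadj hv hs hl.symm
    by_cases hcu : c + x u ≤ d u
    · obtain ⟨a, p, h1, h2, h3, h4, h5, h6⟩ := ih hcu hru hlu.symm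
      refine ⟨a, p.concat hadj, h1, h2, h3, h4, fun z hz => ?_, ?_⟩
      · rw [Walk.support_concat, List.mem_append, List.mem_singleton] at hz
        rcases hz with hz | rfl
        exacts [h5 z hz, Or.inr ⟨hv, hcv⟩]
      · rw [walkLength_concat]; omega
    · refine ⟨u, Walk.cons hadj .nil, hu, by omega, by omega, hru, ?_, ?_⟩
      · intro z hz
        simp only [Walk.support_cons, Walk.support_nil, List.mem_cons, List.not_mem_nil,
          or_false] at hz
        rcases hz with rfl | rfl
        exacts [Or.inl rfl, Or.inr ⟨hv, hcv⟩]
      · simp [walkLength]; omega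

/-- The predecessor of `a` on a shortest walk has distance `d a - x a < c`, so everything before `a`
lies strictly inside the level. Only the root itself has no predecessor. -/
theorem eq_root_or_exists_adj (h : IsRootDist G A x root d) {c : ℕ} {a : V} (ha : a ∈ A)
    (hca : d a < c + x a) : a = root a ∨ ∃ p : G.Walk (root a) a,
      (∀ z ∈ p.support, z = a ∨ z ∈ A ∧ d z < c) ∧ d (root a) < c := by
  obtain ⟨r, hr⟩ := h.exists_walk a ha
  generalize hs : root a = s at hr
  generalize hl : d a = l at hr
  cases hr with
  | nil => exact Or.inl rfl
  | snoc hr' hadj hv =>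
    right
    obtain ⟨hu, hru, hlu⟩ := h.pred hr' hadj hv hs hl.symm
    obtain ⟨p, hp⟩ := h.exists_inner_walk (c := c) hu (by omega)
    subst hru
    refine ⟨p.concat hadj, fun z hz => ?_, (hp _ p.start_mem_support).2⟩
    rw [Walk.support_concat, List.mem_append, List.mem_singleton] at hz
    rcases hz with hz | rfl
    exacts [Or.inr (hp z hz), Or.inl rfl]

theorem root_eq_of_walk (h : IsRootDist G A x root d) {a b : V} (p : G.Walk a b)
    (hp : ∀ z ∈ p.support, z ∈ A) : root a = root b := by
  induction p with
  | nil => rfl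
  | cons hadj p ih =>
    simp only [Walk.support_cons, List.mem_cons, forall_eq_or_imp] at hp
    exact (h.root_eq _ hp.1 _ (hp.2 _ p.start_mem_support) hadj).trans (ih hp.2)

/-- Two vertices joined beyond level `c` are joined by a walk that meets level `c` in at most two
vertices. -/
theorem exists_walk_of_level (hG : G.IsChordal) (h : IsRootDist G A x root d) {c : ℕ} (hc : 0 < c)
    {a b : V} (p : G.Walk a b) (hp : ∀ z ∈ p.support, z ∈ A ∧ c + x z ≤ d z) :
    ∃ (a' b' : V) (q : G.Walk a b), a' ∈ A ∧ b' ∈ A ∧ (∀ z ∈ q.support, z ∈ A) ∧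
      walkLength x q + 2 * c ≤ d a + d b + x a' + x b' := by
  have ha := hp a p.start_mem_support
  have hb := hp b p.end_mem_support
  obtain ⟨a', qa, ha'A, ha'1, ha'2, ha'r, hqa, hla⟩ := h.exists_anchor hc ha.1 ha.2
  obtain ⟨b', qb, hb'A, hb'1, hb'2, hb'r, hqb, hlb⟩ := h.exists_anchor hc hb.1 hb.2
  have hrab : root a = root b := h.root_eq_of_walk p fun z hz => (hp z hz).1
  have hqaA : ∀ z ∈ qa.support, z ∈ A := fun z hz => by
    rcases hqa z hz with rfl | h'
    exacts [ha'A, h'.1]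
  have hqbA : ∀ z ∈ qb.support, z ∈ A := fun z hz => by
    rcases hqb z hz with rfl | h'
    exacts [hb'A, h'.1]
  have hroot : root a' = root b' := by rw [ha'r, hb'r, hrab]
  -- Outside the level the anchors are joined through `p`, inside it through the common root; no
  -- edge joins the two sides, because a neighbour of `v` has distance at most `d v` plus its own
  -- length. If just one anchor were the root, the walk to the other one would put that root
  -- strictly inside the level, where no anchor lies.
  have hadj : a' = b' ∨ G.Adj a' b' := by
    rcases h.eq_root_or_exists_adj ha'A ha'1 with ha'0 | ⟨za, hza, hza'⟩
    · rcases h.eq_root_or_exists_adj hb'A hb'1 with hb'0 | ⟨zb, hzb, hzb'⟩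
      · exact Or.inl (by rw [ha'0, hb'0, hroot])
      · rw [← hroot, ← ha'0] at hzb'; omega
    · rcases h.eq_root_or_exists_adj hb'A hb'1 with hb'0 | ⟨zb, hzb, hzb'⟩
      · rw [hroot, ← hb'0] at hza'; omega
      · refine hG.eq_or_adj (C := {z | z ∈ A ∧ c + x z ≤ d z}) (Z := {z | z ∈ A ∧ d z < c})
          ?_ ?_ ?_ ?_ ?_ (qa.append (p.append qb.reverse)) ?_
          (za.reverse.append ((Walk.copy zb hroot.symm rfl))) ?_
        · rintro u ⟨hu, hcu⟩ v ⟨hv, hcv⟩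
          refine ⟨?_, fun huv => ?_⟩
          · rintro rfl; omega
          · have := h.le_add hv hu huv.symm; omega
        · rintro ⟨-, h'⟩; omega
        · rintro ⟨-, h'⟩; omega
        · rintro ⟨-, h'⟩; omega
        · rintro ⟨-, h'⟩; omega
        · intro z hz
          rw [Walk.mem_support_append_iff, Walk.mem_support_append_iff, Walk.support_reverse,
            List.mem_reverse] at hz
          rcases hz with hz | hz | hz
          · rcases hqa z hz with h' | h'
            exacts [Or.inl h', Or.inr (Or.inr h')]
          · exact Or.inr (Or.inr (hp z hz))
          · rcases hqb z hz with h' | h'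
            exacts [Or.inr (Or.inl h'), Or.inr (Or.inr h')]
        · intro z hz
          rw [Walk.mem_support_append_iff, Walk.support_copy, Walk.support_reverse,
            List.mem_reverse] at hz
          rcases hz with hz | hz
          · rcases hza z hz with h' | h'
            exacts [Or.inl h', Or.inr (Or.inr h')]
          · rcases hzb z hz with h' | h'
            exacts [Or.inr (Or.inl h'), Or.inr (Or.inr h')]
  rcases hadj with rfl | hadj
  · refine ⟨a', a', qa.reverse.append qb, ha'A, ha'A, fun z hz => ?_, ?_⟩
    · rw [Walk.mem_support_append_iff, Walk.support_reverse, List.mem_reverse] at hz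
      exact hz.elim (hqaA z) (hqbA z)
    · have := walkLength_append_le (x := x) qa.reverse qb
      rw [walkLength_reverse] at this
      omega
  · refine ⟨a', b', qa.reverse.append (Walk.cons hadj qb), ha'A, hb'A, fun z hz => ?_, ?_⟩
    · rw [Walk.mem_support_append_iff, Walk.support_reverse, List.mem_reverse, Walk.support_cons,
        List.mem_cons] at hz
      rcases hz with hz | rfl | hz
      exacts [hqaA z hz, ha'A, hqbA z hz]
    · have : walkLength x (qa.reverse.append (Walk.cons hadj qb)) =
          walkLength x qa + walkLength x qb := by
        simp [walkLength, Walk.support_append, List.sum_reverse]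
      omega

end IsRootDist

/-- The vertices removed by the rounding with offset `θ`: those outside of `A`, and those whose
distance interval crosses one of the levels `-θ, n - θ, 2n - θ, …`. -/
def Cut (A : Set V) (x d : V → ℕ) (n θ : ℕ) (v : V) : Prop :=
  v ∉ A ∨ (d v - x v + θ) / n ≠ (d v + θ) / n

/-- Vertices joined by a walk that is not cut have distance less than `4n`. -/
theorem IsRootDist.exists_short_walk (hG : G.IsChordal) {root : V → V} {d : V → ℕ}
    (h : IsRootDist G A x root d) {n θ : ℕ} (hθ : θ < n) (hx : ∀ v ∈ A, x v < n) {a b : V}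
    (p : G.Walk a b) (hp : ∀ z ∈ p.support, ¬ Cut A x d n θ z) :
    ∃ q : G.Walk a b, (∀ z ∈ q.support, z ∈ A) ∧ walkLength x q < 4 * n := by
  have hn : 0 < n := by omega
  simp only [Cut, not_or, not_not] at hp
  -- The interval of an uncut vertex lies in one slot. For neighbours, each interval begins no later
  -- than the other one ends, so they share the slot.
  have hslot : ∀ z ∈ p.support, (d z + θ) / n = (d a + θ) / n := by
    induction p with
    | nil => simp
    | @cons a a' b hadj p ih =>
      simp only [Walk.support_cons, List.mem_cons, forall_eq_or_imp] at hp ⊢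
      refine ⟨trivial, fun z hz => (ih hp.2 z hz).trans ?_⟩
      have ha := hp.1
      have ha' := hp.2 a' p.start_mem_support
      have h1 := h.le_add ha.1 ha'.1 hadj
      have h2 := h.le_add ha'.1 ha.1 hadj.symm
      refine le_antisymm ?_ ?_
      · rw [← ha'.2]; exact Nat.div_le_div_right (by omega)
      · rw [← ha.2]; exact Nat.div_le_div_right (by omega)
  set k := (d a + θ) / n with hk
  have hlevel : ∀ z ∈ p.support, k * n ≤ d z - x z + θ ∧ d z + θ < k * n + n := by
    intro z hz
    have h1 := (hp z hz).2
    have h2 := hslot z hz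
    refine ⟨?_, ?_⟩
    · rw [← h2, ← h1]; exact Nat.div_mul_le_self _ _
    · rw [← h2]; exact Nat.lt_div_mul_add hn
  have ha := hlevel a p.start_mem_support
  have hb := hlevel b p.end_mem_support
  have hxd : ∀ z ∈ A, x z ≤ d z := fun z hz => by
    obtain ⟨r, hr⟩ := h.exists_walk z hz
    generalize root z = s at hr
    generalize d z = l at hr
    cases hr <;> omega
  -- Here `k = 0`, as `θ < n`: all distances are below `n`, and the detour through the root is
  -- shorter than `2n`. Otherwise `k * n - θ` is a genuine level, exceeded by less than `n` at both
  -- ends, and the two anchors contribute less than `2n` more.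
  by_cases hc : k * n ≤ θ
  · obtain ⟨ra, hra⟩ := h.exists_walk a (hp a p.start_mem_support).1
    obtain ⟨rb, hrb⟩ := h.exists_walk b (hp b p.end_mem_support).1
    obtain ⟨qa, hqa, -, hla⟩ := hra.exists_walk
    rw [← h.root_eq_of_walk p fun z hz => (hp z hz).1] at hrb
    obtain ⟨qb, hqb, -, hlb⟩ := hrb.exists_walk
    refine ⟨qa.reverse.append qb, fun z hz => ?_, ?_⟩
    · rw [Walk.mem_support_append_iff, Walk.support_reverse, List.mem_reverse] at hz
      exact hz.elim (hqa z) (hqb z)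
    · have := walkLength_append_le (x := x) qa.reverse qb
      rw [walkLength_reverse] at this
      omega
  · obtain ⟨a', b', q, ha', hb', hq, hl⟩ := h.exists_walk_of_level hG (c := k * n - θ) (by omega) p
      fun z hz => ⟨(hp z hz).1, by
        have := hlevel z hz; have := hxd z (hp z hz).1; omega⟩
    have := hx a' ha'
    have := hx b' hb'
    exact ⟨q, hq, by omega⟩

/-- Hermite's identity. Increasing `z` by one shifts the summation window, which drops `z / n` and
gains `(z + n) / n = z / n + 1`. -/
theorem sum_range_add_div (n z : ℕ) (hn : 0 < n) : ∑ θ ∈ Finset.range n, (z + θ) / n = z := by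
  induction z with
  | zero =>
    refine Finset.sum_eq_zero fun θ hθ => ?_
    rw [zero_add]; exact Nat.div_eq_of_lt (Finset.mem_range.1 hθ)
  | succ z ih =>
    have h1 := Finset.sum_range_succ (fun θ => (z + θ) / n) n
    have h2 := Finset.sum_range_succ' (fun θ => (z + θ) / n) n
    have h4 : (z + n) / n = z / n + 1 := Nat.add_div_right z hn
    have h5 : (z + 0) / n = z / n := rfl
    rw [h1, ih, h4, h5] at h2
    have h3 : ∀ θ, (z + 1 + θ) / n = (z + (θ + 1)) / n := fun θ => by congr 1; omega
    simp only [h3]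
    omega

open Classical in
/-- Some offset cuts vertices of small weight. -/
theorem exists_cut_weight_le [Fintype V] {d : V → ℕ} {n : ℕ} (hn : 0 < n) (w : V → ℝ)
    (hw : ∀ v, 0 ≤ w v) (hA : ∀ v, v ∉ A → w v = 0 ∨ n ≤ x v) (hx : ∀ v ∈ A, x v ≤ d v) :
    ∃ θ < n, n * ∑ v, (if Cut A x d n θ v then w v else 0) ≤ ∑ v, w v * x v := by
  -- For `v ∈ A` the indicator of being cut is at most the number of levels crossed, a difference of
  -- two quotients; by Hermite's identity these add up to `d v - (d v - x v) = x v`. A vertex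
  -- outside `A` is cut by all `n` offsets, which `hA` pays for.
  have hcount : ∀ v, ∑ θ ∈ Finset.range n, (if Cut A x d n θ v then w v else 0) ≤ w v * x v := by
    intro v
    by_cases hv : v ∈ A
    · have h1 : ∀ θ, (if Cut A x d n θ v then w v else 0) ≤
          w v * ((((d v + θ) / n : ℕ) : ℝ) - ((d v - x v + θ) / n : ℕ)) := by
        intro θ
        have hle : (d v - x v + θ) / n ≤ (d v + θ) / n := Nat.div_le_div_right (by omega)
        split
        next hc =>
          have hc' : (d v - x v + θ) / n ≠ (d v + θ) / n := by simpa [Cut, hv] using hc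
          have : (((d v - x v + θ) / n : ℕ) : ℝ) + 1 ≤ ((d v + θ) / n : ℕ) := by
            exact_mod_cast lt_of_le_of_ne hle hc'
          nlinarith [hw v]
        next =>
          have : (((d v - x v + θ) / n : ℕ) : ℝ) ≤ ((d v + θ) / n : ℕ) := by exact_mod_cast hle
          nlinarith [hw v]
      refine (Finset.sum_le_sum fun θ _ => h1 θ).trans ?_
      rw [← Finset.mul_sum, Finset.sum_sub_distrib, ← Nat.cast_sum, ← Nat.cast_sum,
        sum_range_add_div _ _ hn, sum_range_add_div _ _ hn, Nat.cast_sub (hx v hv)]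
      exact le_of_eq (by ring)
    · have h1 : ∑ θ ∈ Finset.range n, (if Cut A x d n θ v then w v else 0) = n * w v := by
        simp [Cut, hv]
      rw [h1, mul_comm]
      rcases hA v hv with h0 | h0
      · simp [h0]
      · exact mul_le_mul_of_nonneg_left (by exact_mod_cast h0) (hw v)
  have hsum : ∑ θ ∈ Finset.range n, ∑ v, (if Cut A x d n θ v then w v else 0) ≤
      ∑ θ ∈ Finset.range n, (∑ v, w v * x v) / n := by
    rw [Finset.sum_comm, Finset.sum_const, Finset.card_range, nsmul_eq_mul,
      mul_div_cancel₀ _ (by positivity)]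
    exact Finset.sum_le_sum fun v _ => hcount v
  obtain ⟨θ, hθ, h⟩ := Finset.exists_le_of_sum_le (Finset.nonempty_range_iff.2 hn.ne') hsum
  refine ⟨θ, Finset.mem_range.1 hθ, ?_⟩
  rwa [le_div_iff₀' (by positivity)] at h

/-- The root of `v` is chosen by `Classical.epsilon` from the predicate "reaches `v` inside `A`".
Adjacent vertices of `A` define the same predicate, hence receive the same root. -/
theorem exists_isRootDist (G : SimpleGraph V) (A : Set V) (x : V → ℕ) :
    ∃ root d, IsRootDist G A x root d := by
  classical
  let c : V → V → Prop := fun u v => ∃ r l, LenWalk G A x u v r l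
  have hset : ∃ root : V → V, (∀ v ∈ A, c (root v) v) ∧
      ∀ u ∈ A, ∀ v ∈ A, G.Adj u v → root u = root v := by
    have key : ∀ u ∈ A, ∀ v ∈ A, G.Adj u v → ∀ s, c s u → c s v :=
      fun u _ v hv huv s ⟨r, l, h⟩ => ⟨_, _, h.snoc huv hv⟩
    have heq : ∀ u ∈ A, ∀ v ∈ A, G.Adj u v → (fun s => c s u) = fun s => c s v :=
      fun u hu v hv huv => funext fun s => propext ⟨key u hu v hv huv s, key v hv u hu huv.symm s⟩
    refine ⟨fun v => @Classical.epsilon V ⟨v⟩ fun s => c s v, fun v hv => ?_,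
      fun u hu v hv huv => ?_⟩
    · exact Classical.epsilon_spec (p := fun s => c s v) ⟨v, _, _, LenWalk.nil hv⟩
    · simp only [heq u hu v hv huv]
  obtain ⟨root, h1, h2⟩ := hset
  refine ⟨root, fun v => sInf {l | ∃ r, LenWalk G A x (root v) v r l}, fun v hv => ?_,
    fun v hv r l h => Nat.sInf_le ⟨r, h⟩, h2⟩
  obtain ⟨r, l, h⟩ := h1 v hv
  exact Nat.sInf_mem (s := {l | ∃ r, LenWalk G A x (root v) v r l}) ⟨l, r, h⟩

/-- The integrality gap of weighted multicut on chordal graphs is bounded. -/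
theorem opt_le_mul_fopt [Fintype V] [DecidableEq V] (hG : G.IsChordal) (T : Set (V × V))
    (w : V → ℝ) (hw : ∀ v, 0 ≤ w v) : opt G T w ≤ 5 * fopt G T w := by
  classical
  obtain ⟨z, hz, hfopt⟩ := exists_isFractional_eq_fopt G T w hw
  rcases isEmpty_or_nonempty V with hV | hV
  · obtain ⟨S, -, hS⟩ := exists_isMulticut_eq_opt G T w
    rw [hfopt, hS, Finset.eq_empty_of_isEmpty S]; simp
  set n := Fintype.card V with hn
  have hn0 : 0 < n := Fintype.card_pos
  -- Rounding down loses at most one per vertex, so at most `n` on a path: paths between terminals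
  -- keep length at least `5n - n = 4n`, exactly what the diameter bound `4n` excludes. Vertices of
  -- length at least `n` are left out of `A` and thus always cut.
  set x : V → ℕ := fun v => ⌊5 * n * z v⌋₊ with hxdef
  have hfloor : ∀ v, (x v : ℝ) ≤ 5 * n * z v := fun v =>
    Nat.floor_le (by have := hz.1 v; positivity)
  obtain ⟨root, d, hd⟩ := exists_isRootDist G {v | x v < n} x
  obtain ⟨θ, hθ, hwt⟩ := exists_cut_weight_le (A := {v | x v < n}) (x := x) (d := d) hn0 w hw
    (fun v hv => Or.inr (by simpa using hv)) (fun v hv => by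
      obtain ⟨r, hr⟩ := hd.exists_walk v hv
      generalize root v = s at hr
      generalize d v = l at hr
      cases hr <;> omega)
  have hmc : IsMulticut G T (({v | Cut {v | x v < n} x d n θ v} : Finset V) : Set V) := by
    rw [isMulticut_iff]
    intro p hp q
    by_contra! hq
    obtain ⟨q', -, hq'⟩ := hd.exists_short_walk hG hθ (fun v hv => hv) q (by simpa using hq)
    have h1 := hz.2 p hp q'.bypass q'.bypass_isPath
    have h2 : ∑ v ∈ q'.bypass.support.toFinset, x v < 4 * n :=
      lt_of_le_of_lt ((Finset.sum_le_sum_of_subset (fun v hv => by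
        rw [List.mem_toFinset] at hv ⊢
        exact q'.support_bypass_subset_support hv)).trans (sum_toFinset_le_walkLength q')) hq'
    have h3 : ∑ v ∈ q'.bypass.support.toFinset, (5 * n * z v) ≤
        ∑ v ∈ q'.bypass.support.toFinset, ((x v : ℝ) + 1) :=
      Finset.sum_le_sum fun v _ => (Nat.lt_floor_add_one _).le
    rw [← Finset.mul_sum, Finset.sum_add_distrib, Finset.sum_const, nsmul_eq_mul, mul_one] at h3
    have h4 : ((q'.bypass.support.toFinset.card : ℕ) : ℝ) ≤ n := by
      exact_mod_cast Finset.card_le_univ _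
    have h5 : ∑ v ∈ q'.bypass.support.toFinset, (x v : ℝ) < 4 * n := by exact_mod_cast h2
    have h6 : (0 : ℝ) < n := by exact_mod_cast hn0
    nlinarith
  have hopt : opt G T w ≤ ∑ v ∈ ({v | Cut {v | x v < n} x d n θ v} : Finset V), w v := by
    refine csInf_le ⟨0, ?_⟩ ⟨_, hmc, rfl⟩
    rintro _ ⟨S, -, rfl⟩
    exact Finset.sum_nonneg fun v _ => hw v
  rw [Finset.sum_filter] at hopt
  have h7 : ∑ v, w v * x v ≤ n * (5 * fopt G T w) := by
    rw [hfopt, Finset.mul_sum, Finset.mul_sum]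
    refine Finset.sum_le_sum fun v _ => ?_
    have := mul_le_mul_of_nonneg_left (hfloor v) (hw v)
    linarith
  have h6 : (0 : ℝ) < n := by exact_mod_cast hn0
  exact hopt.trans (le_of_mul_le_mul_left (hwt.trans h7) h6)

end Multicut

namespace Multicut

/-! ### Lazy multiplicative weights -/

/-- An invariant of the multiplicative weights method after `i` rounds: `F` is the amount of flow
sent so far, `k v` is the number of times the weight of `v` was doubled, and `rem v` is the amount
of flow through `v` before the next doubling. Loads are compared with a fractional multicut `z`. -/
def Progress {V : Type*} [Fintype V] (w : V → ℕ) (z : V → ℝ) (i : ℕ) (y rem : V → ℕ) : Prop :=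
  ∃ (k : V → ℕ) (F : ℝ), (∀ v, y v = 2 ^ k v) ∧ (∀ v, rem v ≤ w v) ∧
    (∀ v, w v ≠ 0 → 0 < rem v) ∧ (∀ v, w v = 0 → k v = 0) ∧ i ≤ ∑ v, k v ∧ 0 ≤ F ∧
    F ≤ ∑ v, z v * (k v * w v + (w v - rem v)) ∧
    ∑ v, (if w v = 0 then 0 else (y v : ℝ) * (2 - rem v / w v)) ≤
      Fintype.card V * Real.exp (F / (6 * ∑ v, w v * z v))

variable {V : Type*} [Fintype V] {w : V → ℕ} {z : V → ℝ}

theorem Progress.init : Progress w z 0 (fun _ => 1) w := by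
  refine ⟨fun _ => 0, 0, by simp, by simp, fun v hv => by omega, by simp, by simp, le_rfl, by simp,
    ?_⟩
  rw [zero_div, Real.exp_zero, mul_one, Fintype.card_eq_sum_ones, Nat.cast_sum]
  refine Finset.sum_le_sum fun v _ => ?_
  by_cases hv : w v = 0
  · simp [hv]
  · rw [if_neg hv, div_self (by exact_mod_cast hv)]; norm_num

/-- The load of a vertex is at most `k v + 1` times its weight; this turns the weak duality bound on
the flow into a multiple of the value of `z`. -/
theorem load_le (hz : ∀ v, 0 ≤ z v) {k rem : V → ℕ} {m : ℕ} (hk : ∀ v, k v ≤ m) :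
    ∑ v, z v * (k v * w v + (w v - rem v)) ≤ (m + 1) * ∑ v, w v * z v := by
  rw [Finset.mul_sum]
  refine Finset.sum_le_sum fun v _ => ?_
  have h1 : ((k v : ℕ) : ℝ) * w v ≤ m * w v :=
    mul_le_mul_of_nonneg_right (by exact_mod_cast hk v) (Nat.cast_nonneg _)
  have h2 : (0 : ℝ) ≤ rem v := Nat.cast_nonneg _
  nlinarith [hz v]

/-- The potential `∑ y (2 - rem / w)` interpolates linearly between doublings: as `rem` falls from
`w` to `0`, the factor rises from `1` to `2`, and doubling `y` while resetting `rem` leaves the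
value unchanged. Sending `c` units along `O` therefore adds exactly `c * ∑ y / w` over `O`, which is
at most `c * α / W`. By `hbad` this is at most `c / (6β)` times the potential, and `1 + t ≤ exp t`
concludes. -/
theorem Progress.step [DecidableEq V] (hz : ∀ v, 0 ≤ z v) {i : ℕ} {y rem X : V → ℕ}
    (h : Progress w z i y rem) {O : Finset V} {c α W : ℕ} (hc : 0 < c) (hW : 0 < W)
    (hO : ∀ v ∈ O, w v ≠ 0 ∧ c ≤ rem v) (hmin : ∃ v ∈ O, rem v = c)
    (hzO : 1 ≤ ∑ v ∈ O, z v) (hX : ∀ v, w v ≠ 0 → X v * w v = y v * W)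
    (hα : ∑ v ∈ O, X v ≤ α)
    (hbad : 6 * (∑ v, w v * z v) * α < W * ∑ v, (if w v = 0 then (0 : ℝ) else y v))
    {y' rem' : V → ℕ}
    (hy' : ∀ v, y' v = if v ∈ O ∧ rem v = c then 2 * y v else y v)
    (hrem' : ∀ v, rem' v = if v ∈ O then if rem v = c then w v else rem v - c else rem v) :
    Progress w z (i + 1) y' rem' := by
  obtain ⟨k, F, hy, hrw, hr0, hk0, hi, hF0, hF, hΦ⟩ := h
  set β := ∑ v, w v * z v with hβ
  -- Weak duality: every vertex of `O` gains load `c`, and the values of `z` on `O` sum to at least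
  -- one.
  have hF' : F + c ≤ ∑ v, z v * ((if v ∈ O ∧ rem v = c then k v + 1 else k v : ℕ) * w v +
      (w v - rem' v)) := by
    have h1 : ∀ v, z v * ((if v ∈ O ∧ rem v = c then k v + 1 else k v : ℕ) * w v +
        (w v - rem' v)) = z v * (k v * w v + (w v - rem v)) + if v ∈ O then z v * c else 0 := by
      intro v
      rw [hrem' v]
      by_cases hv : v ∈ O
      · by_cases hvc : rem v = c
        · simp only [hv, hvc, and_self, if_true]; push_cast; ring
        · simp only [hv, hvc, and_false, if_true, if_false]
          rw [Nat.cast_sub (hO v hv).2]; ring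
      · simp [hv]
    simp_rw [h1]
    rw [Finset.sum_add_distrib, Finset.sum_ite_mem, Finset.univ_inter, ← Finset.sum_mul]
    have : (0 : ℝ) < c := by exact_mod_cast hc
    nlinarith
  -- A positive amount of flow has been sent, and it is at most a multiple of `β`.
  have hβ0 : 0 < β := by
    have hm : ∀ v, (if v ∈ O ∧ rem v = c then k v + 1 else k v) ≤
        Finset.univ.sup fun v => (if v ∈ O ∧ rem v = c then k v + 1 else k v) :=
      fun v => Finset.le_sup (f := fun v => (if v ∈ O ∧ rem v = c then k v + 1 else k v))
        (Finset.mem_univ v)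
    have h1 := hF'.trans (load_le (w := w) (rem := rem') hz hm)
    have h2 : (0 : ℝ) < c := by exact_mod_cast hc
    by_contra hneg
    have h3 : ∑ v, w v * z v ≤ 0 := not_lt.1 hneg
    have h4 : (0 : ℝ) ≤ ((Finset.univ.sup fun v => (if v ∈ O ∧ rem v = c then k v + 1 else k v) :
      ℕ) : ℝ) := Nat.cast_nonneg _
    nlinarith
  have hW' : (0 : ℝ) < W := by exact_mod_cast hW
  refine ⟨fun v => if v ∈ O ∧ rem v = c then k v + 1 else k v, F + c, fun v => ?_, fun v => ?_,
    fun v hv => ?_, fun v hv => ?_, ?_, by positivity, hF', ?_⟩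
  · dsimp only
    rw [hy']; split
    · rw [hy, pow_succ]; ring
    · exact hy v
  · rw [hrem']; have := hrw v; split_ifs <;> omega
  · rw [hrem']
    have := hr0 v hv
    split_ifs with h1 h2
    · omega
    · have := (hO v h1).2; omega
    · exact this
  · dsimp only
    rw [if_neg fun h => (hO v h.1).1 hv]; exact hk0 v hv
  · obtain ⟨v, hvO, hvc⟩ := hmin
    refine Nat.succ_le_of_lt (hi.trans_lt (Finset.sum_lt_sum (fun u _ => ?_)
      ⟨v, Finset.mem_univ v, ?_⟩))
    · split <;> omega
    · rw [if_pos ⟨hvO, hvc⟩]; omega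
  · have h1 : ∀ v, (if w v = 0 then (0 : ℝ) else (y' v : ℝ) * (2 - rem' v / w v)) =
        (if w v = 0 then 0 else (y v : ℝ) * (2 - rem v / w v)) +
          if v ∈ O then c / W * (X v : ℝ) else 0 := by
      intro v
      by_cases hv : v ∈ O
      · have hw := (hO v hv).1
        have hw' : (w v : ℝ) ≠ 0 := by exact_mod_cast hw
        have hXv : (X v : ℝ) = y v * W / w v := by
          rw [eq_div_iff hw']; exact_mod_cast hX v hw
        rw [hy', hrem', hXv]
        by_cases hvc : rem v = c
        · simp only [hw, hv, hvc, and_self, if_true, if_false]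
          push_cast; field_simp; ring
        · simp only [hw, hv, hvc, and_false, if_true, if_false]
          rw [Nat.cast_sub (hO v hv).2]; field_simp; ring
      · simp [hv, hy', hrem']
    simp_rw [h1]
    rw [Finset.sum_add_distrib, Finset.sum_ite_mem, Finset.univ_inter, ← Finset.mul_sum]
    set Φ := ∑ v, (if w v = 0 then 0 else (y v : ℝ) * (2 - rem v / w v)) with hΦdef
    have h2 : ∑ v, (if w v = 0 then (0 : ℝ) else y v) ≤ Φ := by
      refine Finset.sum_le_sum fun v _ => ?_
      split
      · exact le_rfl
      next hv =>
        have : (rem v : ℝ) / w v ≤ 1 := div_le_one_of_le₀ (by exact_mod_cast hrw v) (by positivity)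
        nlinarith [Nat.cast_nonneg (α := ℝ) (y v)]
    have h3 : ∑ v ∈ O, (X v : ℝ) ≤ α := by exact_mod_cast hα
    have h4 : c / W * ∑ v ∈ O, (X v : ℝ) ≤ Φ * (c / (6 * β)) := by
      have h5 : (α : ℝ) / W ≤ Φ / (6 * β) := by
        rw [div_le_div_iff₀ hW' (by positivity)]
        nlinarith
      calc c / W * ∑ v ∈ O, (X v : ℝ) ≤ c / W * α := by gcongr
        _ = c * (α / W) := by ring
        _ ≤ c * (Φ / (6 * β)) := by gcongr
        _ = _ := by ring
    have h6 : (0 : ℝ) ≤ Fintype.card V * Real.exp (F / (6 * β)) := by positivity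
    calc Φ + c / W * ∑ v ∈ O, (X v : ℝ) ≤ Φ * (c / (6 * β) + 1) := by linarith
      _ ≤ (Fintype.card V * Real.exp (F / (6 * β))) * Real.exp (c / (6 * β)) :=
        mul_le_mul hΦ (Real.add_one_le_exp _) (by positivity) h6
      _ = _ := by rw [mul_assoc, ← Real.exp_add, ← add_div]

/-- After more than `4n²` doublings some vertex has been doubled more than `4n` times. For the most
often doubled one, `2 ^ k` is below the potential, while the flow is at most `(k + 1) β`, so the
potential is at most `n * exp ((k + 1) / 6)`. -/
theorem Progress.lt (hz : ∀ v, 0 ≤ z v) {i : ℕ} {y rem : V → ℕ} (h : Progress w z i y rem) :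
    i < 4 * Fintype.card V * Fintype.card V + 1 := by
  obtain ⟨k, F, hy, hrw, hr0, hk0, hi, hF0, hF, hΦ⟩ := h
  by_contra! hlt
  rcases isEmpty_or_nonempty V with hV | hV
  · simp at hi hlt; omega
  obtain ⟨v, hv⟩ := Finite.exists_max k
  set n := Fintype.card V with hn
  have hkv : 4 * n < k v := by
    have : ∑ u, k u ≤ n * k v := by
      simpa using Finset.sum_le_card_nsmul Finset.univ k (k v) fun u _ => hv u
    by_contra hneg
    have := Nat.mul_le_mul_left n (not_lt.1 hneg)
    have : 4 * n * n = n * (4 * n) := by ring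
    omega
  have hwv : w v ≠ 0 := fun h => by have := hk0 v h; omega
  have hβ0 : (0 : ℝ) ≤ ∑ v, w v * z v :=
    Finset.sum_nonneg fun v _ => mul_nonneg (Nat.cast_nonneg _) (hz v)
  have h1 : (2 : ℝ) ^ k v ≤ ∑ v, (if w v = 0 then 0 else (y v : ℝ) * (2 - rem v / w v)) := by
    have hterm : ∀ u, (if w u = 0 then (0 : ℝ) else (y u : ℝ)) ≤
        (if w u = 0 then 0 else (y u : ℝ) * (2 - rem u / w u)) := fun u => by
      split
      · exact le_rfl
      next hv =>
        have : (rem u : ℝ) / w u ≤ 1 := div_le_one_of_le₀ (by exact_mod_cast hrw u) (by positivity)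
        nlinarith [Nat.cast_nonneg (α := ℝ) (y u)]
    calc (2 : ℝ) ^ k v = if w v = 0 then (0 : ℝ) else (y v : ℝ) := by
          rw [if_neg hwv, hy]; push_cast; rfl
      _ ≤ _ := (hterm v).trans (Finset.single_le_sum (fun u _ => le_trans ?_ (hterm u))
          (Finset.mem_univ v))
    split
    · exact le_rfl
    · positivity
  have h2 : F / (6 * ∑ v, w v * z v) ≤ ((k v + 1 : ℕ) : ℝ) * (1 / 6) := by
    have := hF.trans (load_le (w := w) (rem := rem) hz hv)
    refine div_le_of_le_mul₀ (by positivity) (by positivity) ?_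
    push_cast; linarith
  -- The factor `6` is chosen so that the exponential growth has a base well below `2`; indeed `(5 /
  -- 4) ^ 6 > 3.8 > e`.
  have h3 : Real.exp (1 / 6) ≤ 5 / 4 := by
    have h4 : Real.exp (1 / 6) ^ 6 ≤ (5 / 4) ^ 6 := by
      rw [← Real.exp_nat_mul]
      have := Real.exp_one_lt_d9
      norm_num at this ⊢
      linarith
    exact le_of_pow_le_pow_left₀ (by norm_num) (by norm_num) h4
  have h5 : Real.exp (F / (6 * ∑ v, w v * z v)) ≤ (5 / 4) ^ (k v + 1) := by
    refine (Real.exp_le_exp.2 h2).trans ?_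
    rw [Real.exp_nat_mul]
    exact pow_le_pow_left₀ (Real.exp_pos _).le h3 _
  have h6 : (2 : ℝ) ^ k v ≤ n * (5 / 4) ^ (k v + 1) :=
    h1.trans (hΦ.trans (mul_le_mul_of_nonneg_left h5 (Nat.cast_nonneg _)))
  have h7 : (2 : ℝ) ^ k v = (8 / 5) ^ k v * (5 / 4) ^ k v := by rw [← mul_pow]; norm_num
  rw [h7, pow_succ, mul_left_comm, mul_comm] at h6
  have h8 : ((8 : ℝ) / 5) ^ k v ≤ n * (5 / 4) := by
    have : (0 : ℝ) < (5 / 4) ^ k v := by positivity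
    exact le_of_mul_le_mul_left (by linarith) this
  -- Bernoulli: `(8 / 5) ^ k ≥ 1 + 3k / 5 > 1 + 12n / 5`, which exceeds `5n / 4`.
  have h9 := one_add_mul_le_pow (a := (3 / 5 : ℝ)) (by norm_num) (k v)
  have h10 : (4 * n : ℝ) < k v := by exact_mod_cast hkv
  norm_num at h9
  have : (0 : ℝ) ≤ n := Nat.cast_nonneg _
  linarith

end Multicut

/-! ### Arithmetic notation and evaluation rules for expressions and tests -/

namespace RAM

instance : Add Expr := ⟨.op .add⟩
instance : Sub Expr := ⟨.op .sub⟩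
instance : Mul Expr := ⟨.op .mul⟩
instance : Div Expr := ⟨.op .div⟩

@[simp] theorem Expr.eval_add (σ : State) (e f : Expr) : (e + f).eval σ = e.eval σ + f.eval σ := rfl
@[simp] theorem Expr.eval_sub (σ : State) (e f : Expr) : (e - f).eval σ = e.eval σ - f.eval σ := rfl
@[simp] theorem Expr.eval_mul (σ : State) (e f : Expr) : (e * f).eval σ = e.eval σ * f.eval σ := rfl
@[simp] theorem Expr.eval_div (σ : State) (e f : Expr) : (e / f).eval σ = e.eval σ / f.eval σ := rfl

@[simp] theorem Expr.eval_const (σ : State) (k : ℕ) : (Expr.const k).eval σ = k := rfl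
@[simp] theorem Expr.eval_reg (σ : State) (i : ℕ) : (Expr.reg i).eval σ = σ.reg i := rfl
@[simp] theorem Expr.eval_cell (σ : State) (a : ℕ) (e : Expr) :
    (Expr.cell a e).eval σ = σ.cell a (e.eval σ) := rfl

/-- The test `e < f`. -/
def Expr.lt (e f : Expr) : Expr := .op .lt e f

/-- The test `e = f`. -/
def Expr.eq (e f : Expr) : Expr := .op .eq e f

@[simp] theorem Expr.eval_lt (σ : State) (e f : Expr) :
    (e.lt f).eval σ = if e.eval σ < f.eval σ then 1 else 0 := rfl
@[simp] theorem Expr.eval_eq (σ : State) (e f : Expr) :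
    (e.eq f).eval σ = if e.eval σ = f.eval σ then 1 else 0 := rfl

namespace Cmd

@[simp] theorem run_skip (σ : State) : skip.run σ = σ := rfl
@[simp] theorem run_set (σ : State) (i : ℕ) (e : Expr) : (set i e).run σ = σ.setReg i (e.eval σ) :=
  rfl
@[simp] theorem run_store (σ : State) (a : ℕ) (e f : Expr) :
    (store a e f).run σ = σ.setCell a (e.eval σ) (f.eval σ) := rfl
theorem run_seq (σ : State) (p q : Cmd) : (seq p q).run σ = q.run (p.run σ) := rfl
theorem run_ite (σ : State) (e : Expr) (p q : Cmd) :
    (ite e p q).run σ = if e.eval σ ≠ 0 then p.run σ else q.run σ := rfl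

theorem run_ite_cell (σ : State) (a : ℕ) (e : Expr) (p q : Cmd) :
    (ite (.cell a e) p q).run σ = if σ.cell a (e.eval σ) ≠ 0 then p.run σ else q.run σ := rfl

theorem run_ite_lt (σ : State) (e f : Expr) (p q : Cmd) :
    (ite (e.lt f) p q).run σ = if e.eval σ < f.eval σ then p.run σ else q.run σ := by
  by_cases h : e.eval σ < f.eval σ <;> simp [run_ite, h]

theorem run_ite_eq (σ : State) (e f : Expr) (p q : Cmd) :
    (ite (e.eq f) p q).run σ = if e.eval σ = f.eval σ then p.run σ else q.run σ := by
  by_cases h : e.eval σ = f.eval σ <;> simp [run_ite, h]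

end Cmd

end RAM

namespace Multicut

open RAM SimpleGraph

/-! ### Shortest paths

Registers: `R 1` number of vertices, `R 6` infinity, `R 7` source, `R 19`, `R 20`, `R 21` counters.
Arrays: `A 6` lengths of vertices, `A 7` marks of removed vertices, `A 8` distances. -/

/-- The entry of the adjacency matrix. -/
def adjExpr (u v : Expr) : Expr := .cell 0 (.const 1 + u * .reg 1 + v)

/-- Relaxation of all edges at the vertex `R 20`. -/
def relaxVertex : Cmd :=
  .for 21 1 (.ite (adjExpr (.reg 20) (.reg 21)) (.ite (.cell 7 (.reg 21)) .skip
    (.ite ((Expr.cell 8 (.reg 20) + .cell 6 (.reg 21)).lt (.cell 8 (.reg 21)))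
      (.store 8 (.reg 21) (.cell 8 (.reg 20) + .cell 6 (.reg 21))) .skip)) .skip)

/-- Relaxation of all edges. -/
def relaxAll : Cmd := .for 20 1 relaxVertex

/-- Initial distances. -/
def initDist : Cmd :=
  .seq (.for 21 1 (.store 8 (.reg 21) (.reg 6)))
    (.ite (.cell 7 (.reg 7)) .skip (.store 8 (.reg 7) (.cell 6 (.reg 7))))

/-- Distances from the source. -/
def shortestPaths : Cmd := .seq initDist (.for 19 1 relaxAll)

/-- The input graph is stored in memory. -/
def HasGraph {n : ℕ} (G : SimpleGraph (Fin n)) (σ : State) : Prop :=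
  σ.reg 1 = n ∧ ∀ u v : Fin n, σ.cell 0 (1 + u * n + v) ≠ 0 ↔ G.Adj u v

/-- The lengths of the vertices. -/
def lens (n : ℕ) (σ : State) (v : Fin n) : ℕ := σ.cell 6 v

/-- The vertices that are not marked as removed. -/
def alive (n : ℕ) (σ : State) : Set (Fin n) := {v | σ.cell 7 v = 0}

theorem HasGraph.congr {n : ℕ} {G : SimpleGraph (Fin n)} {σ τ : State} (h : HasGraph G σ)
    (h1 : τ.reg 1 = σ.reg 1) (h2 : τ.cell 0 = σ.cell 0) : HasGraph G τ := by
  unfold HasGraph; rw [h1, h2]; exact h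

theorem lens_congr {n : ℕ} {σ τ : State} (h : τ.cell 6 = σ.cell 6) : lens n τ = lens n σ := by
  unfold lens; rw [h]

theorem alive_congr {n : ℕ} {σ τ : State} (h : τ.cell 7 = σ.cell 7) : alive n τ = alive n σ := by
  unfold alive; rw [h]

/-- Finite tentative distances are lengths of walks. -/
def SoundDist {n : ℕ} (G : SimpleGraph (Fin n)) (s : Fin n) (σ : State) : Prop :=
  ∀ v : Fin n, σ.cell 8 v ≤ σ.reg 6 ∧
    (σ.cell 8 v < σ.reg 6 → ∃ r, LenWalk G (alive n σ) (lens n σ) s v r (σ.cell 8 v))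

theorem SoundDist.congr {n : ℕ} {G : SimpleGraph (Fin n)} {s : Fin n} {σ τ : State}
    (h : SoundDist G s σ) (h6 : τ.reg 6 = σ.reg 6) (c6 : τ.cell 6 = σ.cell 6)
    (c7 : τ.cell 7 = σ.cell 7) (c8 : τ.cell 8 = σ.cell 8) : SoundDist G s τ := by
  unfold SoundDist; rw [alive_congr c7, lens_congr c6, h6, c8]; exact h

/-- Tentative distances only decrease, so the bounds in terms of the old distance of `u` survive
later updates. Soundness is kept because each new value is the length of a walk extended by one
edge. -/
theorem relaxVertex_spec {n : ℕ} {G : SimpleGraph (Fin n)} {s u : Fin n} {σ : State}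
    (hg : HasGraph G σ) (hu : σ.reg 20 = u) (hs : SoundDist G s σ) :
    SoundDist G s (relaxVertex.run σ) ∧ (∀ v, (relaxVertex.run σ).cell 8 v ≤ σ.cell 8 v) ∧
      ∀ v : Fin n, G.Adj u v → v ∈ alive n σ →
        (relaxVertex.run σ).cell 8 v ≤ σ.cell 8 u + lens n σ v := by
  have key := Cmd.run_for_induction (i := 21) (bound := 1) (σ := σ)
    (body := .ite (adjExpr (.reg 20) (.reg 21)) (.ite (.cell 7 (.reg 21)) .skip
    (.ite ((Expr.cell 8 (.reg 20) + .cell 6 (.reg 21)).lt (.cell 8 (.reg 21)))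
      (.store 8 (.reg 21) (.cell 8 (.reg 20) + .cell 6 (.reg 21))) .skip)) .skip)
    (fun k τ => SoundDist G s τ ∧ (∀ v, τ.cell 8 v ≤ σ.cell 8 v) ∧
      ∀ v : Fin n, v < k → G.Adj u v → v ∈ alive n σ → τ.cell 8 v ≤ σ.cell 8 u + lens n σ v)
    ⟨hs.congr (by simp) (by simp) (by simp) (by simp), by simp, by simp⟩
  specialize key ?_
  swap
  · obtain ⟨h1, h2, h3⟩ := key
    refine ⟨h1, h2, fun v hv hva => h3 v ?_ hv hva⟩
    rw [hg.1]; exact v.2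
  · rintro k hk τ hτk hr hc ⟨i1, i2, i3⟩
    rw [hg.1] at hk
    have e6 : τ.reg 6 = σ.reg 6 := hr 6 (by decide)
    have c6 : τ.cell 6 = σ.cell 6 := hc 6 (by decide)
    have c7 : τ.cell 7 = σ.cell 7 := hc 7 (by decide)
    have hτu : τ.reg 20 = u := (hr 20 (by decide)).trans hu
    have hgτ : HasGraph G τ := hg.congr (hr 1 (by decide)) (hc 0 (by decide))
    have hadj := hgτ.2 u ⟨k, hk⟩
    have hlast : ∀ υ : State, υ.cell 8 = τ.cell 8 → υ.cell 6 = τ.cell 6 → υ.cell 7 = τ.cell 7 →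
        υ.reg 6 = τ.reg 6 → (G.Adj u ⟨k, hk⟩ → (⟨k, hk⟩ : Fin n) ∈ alive n σ →
          τ.cell 8 k ≤ σ.cell 8 u + lens n σ ⟨k, hk⟩) →
        SoundDist G s υ ∧ (∀ v, υ.cell 8 v ≤ σ.cell 8 v) ∧
        ∀ v : Fin n, v < k + 1 → G.Adj u v → v ∈ alive n σ →
          υ.cell 8 v ≤ σ.cell 8 u + lens n σ v := by
      intro υ c8 c6 c7 e6 hkey
      refine ⟨i1.congr e6 c6 c7 c8, fun v => by rw [c8]; exact i2 v, fun v hv h h' => ?_⟩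
      rw [c8]
      rcases Nat.lt_succ_iff_lt_or_eq.1 hv with hv | hv
      · exact i3 v hv h h'
      · obtain rfl : v = ⟨k, hk⟩ := Fin.ext hv
        exact hkey h h'
    simp only [Cmd.run_ite_cell, adjExpr, Expr.eval_add, Expr.eval_mul,
      Expr.eval_const, Expr.eval_reg, hτu, hτk, hgτ.1]
    split
    next ha =>
      split
      next h7 =>
        refine hlast _ (by simp) (by simp) (by simp) (by simp) fun _ h' => ?_
        rw [c7] at h7
        exact absurd h' h7
      next h7 =>
        simp only [Cmd.run_ite_lt, Expr.eval_add, Expr.eval_cell, Expr.eval_reg, hτu, hτk,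
          Cmd.run_store, Cmd.run_skip]
        have hua := i2 u
        split
        next hlt =>
          have hal : (⟨k, hk⟩ : Fin n) ∈ alive n τ := by simpa [alive] using h7
          -- A strict improvement is below infinity, hence so is the distance of `u`, and there is a
          -- walk to extend.
          have hfin : τ.cell 8 u < τ.reg 6 := by have := (i1 ⟨k, hk⟩).1; simp only at this; omega
          obtain ⟨r, hr'⟩ := (i1 u).2 hfin
          refine ⟨fun v => ?_, fun v => ?_, fun v hv h h' => ?_⟩
          · have hA : alive n ((τ.setCell 8 k (τ.cell 8 u + τ.cell 6 k)).setReg 21 (k + 1)) =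
                alive n τ := alive_congr (by simp [State.setCell_cell])
            have hL : lens n ((τ.setCell 8 k (τ.cell 8 u + τ.cell 6 k)).setReg 21 (k + 1)) =
                lens n τ := lens_congr (by simp [State.setCell_cell])
            rw [hA, hL]
            by_cases hv : (v : ℕ) = k
            · obtain rfl : v = ⟨k, hk⟩ := Fin.ext hv
              have := (i1 ⟨k, hk⟩).1
              simp only [State.setReg_cell, State.setCell_cell_apply, and_self, if_true,
                State.setReg_reg, State.setCell_reg] at this ⊢
              refine ⟨by simpa using by omega, fun _ => ⟨_, hr'.snoc (hadj.1 ha) hal⟩⟩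
            · simpa [hv] using i1 v
          · simp only [State.setReg_cell, State.setCell_cell_apply, true_and]
            split
            next hv => subst hv; exact hlt.le.trans (i2 _)
            next => exact i2 v
          · simp only [State.setReg_cell, State.setCell_cell_apply, true_and]
            split
            next hv =>
              obtain rfl : v = ⟨k, hk⟩ := Fin.ext hv
              simp only [lens, c6]; omega
            next hv' => exact i3 v (by omega) h h'
        next hlt =>
          refine hlast _ (by simp) (by simp) (by simp) (by simp) fun _ h' => ?_
          simp only [lens, ← c6]; omega
    next ha =>
      exact hlast _ (by simp) (by simp) (by simp) (by simp) fun h _ => absurd (hadj.2 h) ha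

theorem relaxAll_spec {n : ℕ} {G : SimpleGraph (Fin n)} {s : Fin n} {σ : State}
    (hg : HasGraph G σ) (hs : SoundDist G s σ) :
    SoundDist G s (relaxAll.run σ) ∧ (∀ v, (relaxAll.run σ).cell 8 v ≤ σ.cell 8 v) ∧
      ∀ u v : Fin n, G.Adj u v → v ∈ alive n σ →
        (relaxAll.run σ).cell 8 v ≤ σ.cell 8 u + lens n σ v := by
  have key := Cmd.run_for_induction (i := 20) (bound := 1) (σ := σ)
    (body := relaxVertex)
    (fun k τ => SoundDist G s τ ∧ (∀ v, τ.cell 8 v ≤ σ.cell 8 v) ∧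
      ∀ u v : Fin n, u < k → G.Adj u v → v ∈ alive n σ → τ.cell 8 v ≤ σ.cell 8 u + lens n σ v)
    ⟨hs.congr (by simp) (by simp) (by simp) (by simp), by simp, by simp⟩
  specialize key ?_
  swap
  · obtain ⟨h1, h2, h3⟩ := key
    refine ⟨h1, h2, fun u v hv hva => h3 u v ?_ hv hva⟩
    rw [hg.1]; exact u.2
  · rintro k hk τ hτk hr hc ⟨i1, i2, i3⟩
    rw [hg.1] at hk
    have hgτ : HasGraph G τ := hg.congr (hr 1 (by decide)) (hc 0 (by decide))
    obtain ⟨j1, j2, j3⟩ := relaxVertex_spec (u := ⟨k, hk⟩) hgτ hτk i1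
    rw [alive_congr (hc 7 (by decide)), lens_congr (hc 6 (by decide))] at j3
    refine ⟨j1.congr (by simp) (by simp) (by simp) (by simp), fun v => (j2 v).trans (i2 v),
      fun u v hu huv hv => ?_⟩
    rcases Nat.lt_succ_iff_lt_or_eq.1 hu with hu | hu
    · exact (j2 v).trans (i3 u v hu huv hv)
    · obtain rfl : u = ⟨k, hk⟩ := Fin.ext hu
      exact (j3 v huv hv).trans (Nat.add_le_add_right (i2 _) _)

theorem initDist_spec {n : ℕ} {G : SimpleGraph (Fin n)} {s : Fin n} {σ : State}
    (hg : HasGraph G σ) (hs : σ.reg 7 = s) (hinf : ∑ v, lens n σ v < σ.reg 6) :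
    SoundDist G s (initDist.run σ) ∧ (s ∈ alive n σ → (initDist.run σ).cell 8 s = lens n σ s) := by
  set υ := (Cmd.for 21 1 (.store 8 (.reg 21) (.reg 6))).run σ with hυ
  have hfill : ∀ v : ℕ, v < n → υ.cell 8 v = σ.reg 6 := by
    rw [← hg.1]
    refine Cmd.run_for_induction (fun k τ => ∀ v < k, τ.cell 8 v = σ.reg 6) (by simp) ?_
    intro k hk τ hτk hr _ ih v hv
    have : τ.reg 6 = σ.reg 6 := hr 6 (by decide)
    by_cases hvk : v = k
    · simp [hτk, hvk, this]
    · simp [hτk, hvk, ih v (by omega)]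
  have r6 : υ.reg 6 = σ.reg 6 := Cmd.run_reg _ _ (by decide)
  have r7 : υ.reg 7 = σ.reg 7 := Cmd.run_reg _ _ (by decide)
  have c6 : υ.cell 6 = σ.cell 6 := Cmd.run_cell _ _ (by decide)
  have c7 : υ.cell 7 = σ.cell 7 := Cmd.run_cell _ _ (by decide)
  have hrun : initDist.run σ = if σ.cell 7 s ≠ 0 then υ else υ.setCell 8 s (σ.cell 6 s) := by
    simp only [initDist, Cmd.run_seq, Cmd.run_ite_cell, Expr.eval_cell, Expr.eval_reg, Cmd.run_skip,
      Cmd.run_store, ← hυ, r7, hs, c6, c7]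
  rw [hrun]
  split
  next h =>
    refine ⟨fun v => ?_, fun h' => absurd h' h⟩
    rw [hfill v v.2, r6]
    exact ⟨le_rfl, fun h => absurd h (lt_irrefl _)⟩
  next h =>
    refine ⟨fun v => ?_, fun _ => by simp [lens]⟩
    rw [alive_congr (τ := υ.setCell 8 s (σ.cell 6 s)) (σ := σ) (by simp [State.setCell_cell, c7]),
      lens_congr (τ := υ.setCell 8 s (σ.cell 6 s)) (σ := σ) (by simp [State.setCell_cell, c6])]
    by_cases hv : v = s
    · subst hv
      have hle : lens n σ v ≤ ∑ v, lens n σ v :=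
        Finset.single_le_sum (fun _ _ => Nat.zero_le _) (Finset.mem_univ v)
      simp only [State.setCell_cell_apply, and_self, if_true, State.setCell_reg, r6]
      refine ⟨hle.trans hinf.le, fun _ => ⟨0, LenWalk.nil (by simpa [alive] using h)⟩⟩
    · have hv' : (v : ℕ) ≠ s := fun h => hv (Fin.ext h)
      simp [hv', hfill v v.2, r6]

/-- `D` lists the distances from `s`; vertices that cannot be reached have distance `inf`. -/
structure IsDist {n : ℕ} (G : SimpleGraph (Fin n)) (A : Set (Fin n)) (x : Fin n → ℕ) (inf : ℕ)
    (s : Fin n) (D : ℕ → ℕ) : Prop where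
  le_inf : ∀ v : Fin n, D v ≤ inf
  exists_walk : ∀ v : Fin n, D v < inf → ∃ r, LenWalk G A x s v r (D v)
  le : ∀ (v : Fin n) r l, LenWalk G A x s v r l → D v ≤ l
  lt : ∀ (v : Fin n) r l, LenWalk G A x s v r l → D v < inf

/-- Bellman–Ford: after `k` rounds the entries are at most the length of every walk with at most `k`
edges. Shortening a walk to a path leaves fewer than `n` edges and a length of at most the sum of
all lengths, which is below infinity. -/
theorem shortestPaths_spec {n : ℕ} {G : SimpleGraph (Fin n)} {s : Fin n} {σ : State}
    (hg : HasGraph G σ) (hs : σ.reg 7 = s) (hinf : ∑ v, lens n σ v < σ.reg 6) :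
    IsDist G (alive n σ) (lens n σ) (σ.reg 6) s ((shortestPaths.run σ).cell 8) := by
  obtain ⟨h1, h2⟩ := initDist_spec hg hs hinf
  set υ := initDist.run σ with hυ
  have r6 : υ.reg 6 = σ.reg 6 := Cmd.run_reg _ _ (by decide)
  have c6 : lens n υ = lens n σ := lens_congr (Cmd.run_cell _ _ (by decide))
  have c7 : alive n υ = alive n σ := alive_congr (Cmd.run_cell _ _ (by decide))
  have hgυ : HasGraph G υ := hg.congr (Cmd.run_reg _ _ (by decide)) (Cmd.run_cell _ _ (by decide))
  have key := Cmd.run_for_induction (i := 19) (bound := 1) (σ := υ) (body := relaxAll)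
    (fun k τ => SoundDist G s τ ∧ ∀ (v : Fin n) r l, r ≤ k →
      LenWalk G (alive n σ) (lens n σ) s v r l → τ.cell 8 v ≤ l)
    ⟨h1.congr (by simp) (by simp) (by simp) (by simp), fun v r l hr hl => by
      obtain rfl : r = 0 := by omega
      generalize hr0 : 0 = r at hl
      cases hl with
      | nil hsA => exact (h2 hsA).le
      | snoc => omega⟩
  specialize key ?_
  swap
  · obtain ⟨h3, h4⟩ := key
    have hout : shortestPaths.run σ = (Cmd.for 19 1 relaxAll).run υ := rfl
    rw [hout]
    set ω := (Cmd.for 19 1 relaxAll).run υ with hω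
    have r6' : ω.reg 6 = σ.reg 6 := (Cmd.run_reg _ _ (by decide)).trans r6
    have c6' : lens n ω = lens n σ := (lens_congr (Cmd.run_cell _ _ (by decide))).trans c6
    have c7' : alive n ω = alive n σ := (alive_congr (Cmd.run_cell _ _ (by decide))).trans c7
    unfold SoundDist at h3
    rw [r6', c6', c7'] at h3
    rw [hgυ.1] at h4
    have h5 : ∀ (v : Fin n) r l, LenWalk G (alive n σ) (lens n σ) s v r l →
        ω.cell 8 v ≤ l ∧ ω.cell 8 v < σ.reg 6 := by
      intro v r l hl
      obtain ⟨r', hr', l', hl', hw, hl''⟩ := hl.exists_short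
      rw [Fintype.card_fin] at hr'
      have := h4 v r' l' hr'.le hw
      exact ⟨by omega, by omega⟩
    exact ⟨fun v => (h3 v).1, fun v => (h3 v).2, fun v r l h => (h5 v r l h).1,
      fun v r l h => (h5 v r l h).2⟩
  · rintro k hk τ hτk hr hc ⟨i1, i2⟩
    have hgτ : HasGraph G τ := hgυ.congr (hr 1 (by decide)) (hc 0 (by decide))
    obtain ⟨j1, j2, j3⟩ := relaxAll_spec hgτ i1
    rw [alive_congr (hc 7 (by decide)), lens_congr (hc 6 (by decide)), c6, c7] at j3
    refine ⟨j1.congr (by simp) (by simp) (by simp) (by simp), fun v r l hr' hl => ?_⟩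
    rcases Nat.lt_succ_iff_lt_or_eq.1 (Nat.lt_succ_of_le hr') with h | rfl
    · exact (j2 v).trans (i2 v r l (by omega) hl)
    · cases hl with
      | @snoc u v r l hl huv hv =>
        exact (j3 u v huv hv).trans (Nat.add_le_add_right (i2 u _ _ le_rfl hl) _)

/-! ### Shortest terminal pairs

Registers: `R 2` number of pairs, `R 8` least distance of a pair, `R 9`, `R 10` a closest pair,
`R 11`, `R 12` current and next vertex of a path, `R 13` amount of flow.
Arrays: `A 2` weights, `A 4` multipliers, `A 5` remainders, `A 9` marks of a path. -/

/-- Infinity, larger than all distances. -/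
def computeInf : Cmd :=
  .seq (.set 6 (.const 0)) (.seq (.for 21 1 (.set 6 (.reg 6 + .cell 6 (.reg 21))))
    (.set 6 (.reg 6 * .reg 1 * .const 5 + .const 1)))

theorem computeInf_spec {n : ℕ} {σ : State} (hn : σ.reg 1 = n) :
    (computeInf.run σ).reg 6 = (∑ v, lens n σ v) * n * 5 + 1 := by
  simp only [computeInf, Cmd.run_seq]
  set υ := (Cmd.set 6 (.const 0)).run σ with hυ
  have key := Cmd.run_for_induction (i := 21) (bound := 1) (σ := υ)
    (body := .set 6 (.reg 6 + .cell 6 (.reg 21)))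
    (fun k τ => τ.reg 6 = ∑ v ∈ Finset.range k, σ.cell 6 v) (by simp [hυ])
  specialize key ?_
  · intro k _ τ hτk _ hc ih
    have : τ.cell 6 = σ.cell 6 := hc 6 (by decide)
    simp [hτk, ih, Finset.sum_range_succ, this]
  · have h1 : υ.reg 1 = n := by simp [hυ, hn]
    have h2 : ((Cmd.for 21 1 (.set 6 (.reg 6 + .cell 6 (.reg 21)))).run υ).reg 1 = n := by
      rw [Cmd.run_reg _ _ (by decide), h1]
    rw [h1, Finset.sum_range] at key
    simp [key, h2, lens]

theorem sum_lens_lt_inf {n : ℕ} (x : Fin n → ℕ) : ∑ v, x v < (∑ v, x v) * n * 5 + 1 := by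
  rcases Nat.eq_zero_or_pos n with rfl | hn
  · simp
  · nlinarith [Nat.zero_le (∑ v, x v)]

/-- The first vertex of a pair. -/
def sourceExpr (j : Expr) : Expr :=
  .cell 0 (.const 2 + .reg 1 * .reg 1 + .reg 1 * .const 2 + j * .const 2)

/-- The second vertex of a pair. -/
def targetExpr (j : Expr) : Expr :=
  .cell 0 (.const 3 + .reg 1 * .reg 1 + .reg 1 * .const 2 + j * .const 2)

/-- The terminal pairs are stored in memory. -/
def HasPairs {n : ℕ} (T : List (Fin n × Fin n)) (σ : State) : Prop :=
  σ.reg 1 = n ∧ σ.reg 2 = T.length ∧ ∀ (j : ℕ) (hj : j < T.length),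
    σ.cell 0 (2 + n * n + n * 2 + j * 2) = (T[j]).1 ∧
      σ.cell 0 (3 + n * n + n * 2 + j * 2) = (T[j]).2

theorem HasPairs.congr {n : ℕ} {T : List (Fin n × Fin n)} {σ τ : State} (h : HasPairs T σ)
    (h1 : τ.reg 1 = σ.reg 1) (h2 : τ.reg 2 = σ.reg 2) (h0 : τ.cell 0 = σ.cell 0) :
    HasPairs T τ := by
  unfold HasPairs; rw [h1, h2, h0]; exact h

/-- Computes the distance of a pair, and compares it with the least distance. -/
def tryPair : Cmd :=
  .seq (.set 7 (targetExpr (.reg 22))) (.seq shortestPaths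
    (.ite ((Expr.cell 8 (sourceExpr (.reg 22))).lt (.reg 8))
      (.seq (.set 8 (.cell 8 (sourceExpr (.reg 22))))
        (.seq (.set 9 (sourceExpr (.reg 22))) (.set 10 (targetExpr (.reg 22))))) .skip))

/-- Finds a closest terminal pair. -/
def findPair : Cmd := .seq (.set 8 (.reg 6)) (.for 22 2 tryPair)

/-- `R 8` is the least distance of a pair, unless it is infinite. -/
structure ClosestPair {n : ℕ} (G : SimpleGraph (Fin n)) (T : List (Fin n × Fin n))
    (A : Set (Fin n)) (x : Fin n → ℕ) (inf : ℕ) (σ : State) : Prop where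
  le_inf : σ.reg 8 ≤ inf
  le : ∀ p ∈ T, ∀ r l, LenWalk G A x p.2 p.1 r l → σ.reg 8 ≤ l
  exists_walk : σ.reg 8 < inf → ∃ p ∈ T, σ.reg 9 = p.1 ∧ σ.reg 10 = p.2 ∧
    ∃ r, LenWalk G A x p.2 p.1 r (σ.reg 8)

theorem tryPair_spec {n : ℕ} {G : SimpleGraph (Fin n)} {T : List (Fin n × Fin n)} {σ : State}
    (hg : HasGraph G σ) (hp : HasPairs T σ) (hinf : ∑ v, lens n σ v < σ.reg 6) {j : ℕ}
    (hj : j < T.length) (hσj : σ.reg 22 = j)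
    (h : ClosestPair G (T.take j) (alive n σ) (lens n σ) (σ.reg 6) σ) :
    ClosestPair G (T.take (j + 1)) (alive n σ) (lens n σ) (σ.reg 6) (tryPair.run σ) := by
  obtain ⟨hps, hpt⟩ := hp.2.2 j hj
  set s := (T[j]).1 with hs
  set t := (T[j]).2 with ht
  set υ := (Cmd.set 7 (targetExpr (.reg 22))).run σ with hυ
  have hυ' : υ = σ.setReg 7 t := by
    simp [hυ, targetExpr, hp.1, hσj, hpt]
  have hgυ : HasGraph G υ := hg.congr (by simp [hυ']) (by simp [hυ'])
  have hd := shortestPaths_spec (s := t) hgυ (by simp [hυ'])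
    (by rw [lens_congr (show υ.cell 6 = σ.cell 6 by simp [hυ'])]; simpa [hυ'] using hinf)
  rw [alive_congr (show υ.cell 7 = σ.cell 7 by simp [hυ']),
    lens_congr (show υ.cell 6 = σ.cell 6 by simp [hυ']),
    show υ.reg 6 = σ.reg 6 by simp [hυ']] at hd
  set ω := shortestPaths.run υ with hω
  have h1 : ω.reg 1 = n := by rw [hω, Cmd.run_reg _ _ (by decide)]; exact hgυ.1
  have h22 : ω.reg 22 = j := by rw [hω, Cmd.run_reg _ _ (by decide)]; simp [hυ', hσj]
  have h8 : ω.reg 8 = σ.reg 8 := by rw [hω, Cmd.run_reg _ _ (by decide)]; simp [hυ']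
  have h9 : ω.reg 9 = σ.reg 9 := by rw [hω, Cmd.run_reg _ _ (by decide)]; simp [hυ']
  have h10 : ω.reg 10 = σ.reg 10 := by rw [hω, Cmd.run_reg _ _ (by decide)]; simp [hυ']
  have h0 : ω.cell 0 = σ.cell 0 := by rw [hω, Cmd.run_cell _ _ (by decide)]; simp [hυ']
  have hrun : tryPair.run σ = if ω.cell 8 s < σ.reg 8 then
      ((ω.setReg 8 (ω.cell 8 s)).setReg 9 s).setReg 10 t else ω := by
    simp only [tryPair, Cmd.run_seq, ← hυ, ← hω, Cmd.run_ite_lt, Cmd.run_skip]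
    simp [sourceExpr, targetExpr, h1, h22, h0, hps, hpt, h8]
  have hmem : ∀ p, p ∈ T.take (j + 1) ↔ p ∈ T.take j ∨ p = (s, t) := by
    intro p
    rw [List.take_add_one, List.getElem?_eq_getElem hj, List.mem_append, Option.toList_some,
      List.mem_singleton]
  rw [hrun]
  split
  next hlt =>
    refine ⟨by simpa using hd.le_inf s, fun p hpT r l hl => ?_, fun hfin => ?_⟩
    · simp only [State.setReg_reg]
      norm_num
      rcases (hmem p).1 hpT with h' | rfl
      · exact hlt.le.trans (h.le p h' r l hl)
      · exact hd.le s r l hl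
    · simp only [State.setReg_reg] at hfin ⊢
      norm_num at hfin ⊢
      exact ⟨s, t, (hmem _).2 (Or.inr rfl), rfl, rfl, hd.exists_walk s hfin⟩
  next hlt =>
    refine ⟨by rw [h8]; exact h.le_inf, fun p hpT r l hl => ?_, fun hfin => ?_⟩
    · rw [h8]
      rcases (hmem p).1 hpT with h' | rfl
      · exact h.le p h' r l hl
      · exact (not_lt.1 hlt).trans (hd.le s r l hl)
    · rw [h8, h9, h10] at *
      obtain ⟨p, hpT, h'⟩ := h.exists_walk hfin
      exact ⟨p, (hmem p).2 (Or.inl hpT), h'⟩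

theorem findPair_spec {n : ℕ} {G : SimpleGraph (Fin n)} {T : List (Fin n × Fin n)} {σ : State}
    (hg : HasGraph G σ) (hp : HasPairs T σ) (hinf : ∑ v, lens n σ v < σ.reg 6) :
    ClosestPair G T (alive n σ) (lens n σ) (σ.reg 6) (findPair.run σ) := by
  have hrun : findPair.run σ = (Cmd.for 22 2 tryPair).run (σ.setReg 8 (σ.reg 6)) := rfl
  rw [hrun]
  set υ := σ.setReg 8 (σ.reg 6) with hυ
  have hpυ : HasPairs T υ := hp.congr (by simp [hυ]) (by simp [hυ]) (by simp [hυ])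
  have key := Cmd.run_for_induction (i := 22) (bound := 2) (σ := υ) (body := tryPair)
    (fun k τ => ClosestPair G (T.take k) (alive n σ) (lens n σ) (σ.reg 6) τ)
    ⟨by simp [hυ], by simp, by simp [hυ]⟩
  specialize key ?_
  · intro k hk τ hτk hr hc ih
    rw [hpυ.2.1] at hk
    have e6 : τ.reg 6 = σ.reg 6 := (hr 6 (by decide)).trans (by simp [hυ])
    have c6 : lens n τ = lens n σ := lens_congr ((hc 6 (by decide)).trans (by simp [hυ]))
    have c7 : alive n τ = alive n σ := alive_congr ((hc 7 (by decide)).trans (by simp [hυ]))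
    have := tryPair_spec (j := k) (hg.congr (σ := σ) (τ := τ)
      ((hr 1 (by decide)).trans (by simp [hυ])) ((hc 0 (by decide)).trans (by simp [hυ])))
      (hpυ.congr (hr 1 (by decide)) (hr 2 (by decide)) (hc 0 (by decide)))
      (by rw [c6, e6]; exact hinf) hk hτk (by rw [c6, c7, e6]; exact ih)
    rw [c6, c7, e6] at this
    exact ⟨by simpa using this.le_inf, by simpa using this.le, by simpa using this.exists_walk⟩
  · rwa [hpυ.2.1, List.take_length] at key

/-! ### Paths between closest pairs -/

/-- Finds the next vertex on a shortest path. -/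
def findNext : Cmd :=
  .for 21 1 (.ite (adjExpr (.reg 11) (.reg 21)) (.ite (.cell 7 (.reg 21)) .skip
    (.ite ((Expr.cell 8 (.reg 21) + .cell 6 (.reg 11)).eq (.cell 8 (.reg 11)))
      (.set 12 (.reg 21)) .skip)) .skip)

theorem LenWalk.le_length {V : Type*} {G : SimpleGraph V} {A : Set V} {x : V → ℕ} {s v : V}
    {r l : ℕ} (h : LenWalk G A x s v r l) : x v ≤ l := by
  cases h <;> omega

/-- The last edge of a walk realizing `D c` leads back to `u`; if `D u` were smaller than the length
of the walk up to `u`, then `D c` would be smaller too. -/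
theorem IsDist.exists_next {n : ℕ} {G : SimpleGraph (Fin n)} {A : Set (Fin n)} {x : Fin n → ℕ}
    {inf : ℕ} {t c : Fin n} {D : ℕ → ℕ} (h : IsDist G A x inf t D) (hc : D c < inf) (hct : c ≠ t) :
    ∃ u : Fin n, G.Adj c u ∧ u ∈ A ∧ D u + x c = D c := by
  obtain ⟨r, hr⟩ := h.exists_walk c hc
  generalize hl : D c = l at hr
  cases hr with
  | nil => exact absurd rfl hct
  | @snoc u _ r l hr huc hcA =>
    refine ⟨u, huc.symm, hr.mem_right, ?_⟩
    have h1 := h.le u _ _ hr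
    obtain ⟨r', hr'⟩ := h.exists_walk u (h.lt u _ _ hr)
    have h2 := h.le c _ _ (hr'.snoc huc hcA)
    omega

theorem findNext_spec {n : ℕ} {G : SimpleGraph (Fin n)} {σ : State} (hg : HasGraph G σ)
    {c : Fin n} (hc : σ.reg 11 = c)
    (hex : ∃ u : Fin n, G.Adj c u ∧ u ∈ alive n σ ∧ σ.cell 8 u + lens n σ c = σ.cell 8 c) :
    ∃ u : Fin n, (findNext.run σ).reg 12 = u ∧ G.Adj c u ∧ u ∈ alive n σ ∧
      σ.cell 8 u + lens n σ c = σ.cell 8 c := by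
  -- The invariant is an implication: `R 12` is meaningless until the first suitable neighbour is
  -- seen, and later ones may overwrite it.
  have key := Cmd.run_for_induction (i := 21) (bound := 1) (σ := σ)
    (body := .ite (adjExpr (.reg 11) (.reg 21)) (.ite (.cell 7 (.reg 21)) .skip
    (.ite ((Expr.cell 8 (.reg 21) + .cell 6 (.reg 11)).eq (.cell 8 (.reg 11)))
      (.set 12 (.reg 21)) .skip)) .skip)
    (fun k τ => (∃ u : Fin n, (u : ℕ) < k ∧ G.Adj c u ∧ u ∈ alive n σ ∧
      σ.cell 8 u + lens n σ c = σ.cell 8 c) → ∃ u : Fin n, τ.reg 12 = u ∧ G.Adj c u ∧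
        u ∈ alive n σ ∧ σ.cell 8 u + lens n σ c = σ.cell 8 c) (by simp)
  specialize key ?_
  · intro k hk τ hτk hr hc' ih
    rw [hg.1] at hk
    have hτc : τ.reg 11 = c := (hr 11 (by decide)).trans hc
    have hτ1 : τ.reg 1 = n := (hr 1 (by decide)).trans hg.1
    have hadj := hg.2 c ⟨k, hk⟩
    simp only [Cmd.run_ite_cell, adjExpr, Expr.eval_add, Expr.eval_mul, Expr.eval_const,
      Expr.eval_reg, hτc, hτk, hτ1, Cmd.run_ite_eq, Expr.eval_cell, hc' 0 (by decide),
      hc' 7 (by decide), hc' 8 (by decide), hc' 6 (by decide), Cmd.run_skip, Cmd.run_set]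
    rintro ⟨u, hu, hu'⟩
    have hold : ¬ (G.Adj c ⟨k, hk⟩ ∧ (⟨k, hk⟩ : Fin n) ∈ alive n σ ∧
        σ.cell 8 k + lens n σ c = σ.cell 8 c) → ∃ u : Fin n, (τ.setReg 21 (k + 1)).reg 12 = u ∧
        G.Adj c u ∧ u ∈ alive n σ ∧ σ.cell 8 u + lens n σ c = σ.cell 8 c := by
      intro hno
      have : (u : ℕ) ≠ k := by
        rintro rfl; exact hno hu'
      simpa using ih ⟨u, by omega, hu'⟩
    split
    next ha =>
      split
      next h7 => exact hold fun h => h7 h.2.1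
      next h7 =>
        split
        next h8 => exact ⟨⟨k, hk⟩, by simp, hadj.1 ha, by simpa [alive] using h7, h8⟩
        next h8 => exact hold fun h => h8 h.2.2
    next ha => exact hold fun h => ha (hadj.2 h.1)
  · obtain ⟨u, hu⟩ := hex
    exact key ⟨u, by rw [hg.1]; exact u.2, hu⟩

/-- Marks the current vertex, and moves to the next one. -/
def advance : Cmd :=
  .ite ((Expr.reg 11).eq (.reg 10)) .skip
    (.seq (.store 9 (.reg 11) (.const 1)) (.seq findNext (.set 11 (.reg 12))))

/-- Prepares the search for a path between a closest pair. -/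
def initPath : Cmd :=
  .seq (.set 7 (.reg 10)) (.seq shortestPaths (.seq (.set 11 (.reg 9))
    (.for 21 1 (.store 9 (.reg 21) (.const 0)))))

/-- Marks the vertices of a shortest path between a closest pair. -/
def markPath : Cmd :=
  .seq initPath (.seq (.for 19 1 advance) (.store 9 (.reg 10) (.const 1)))

/-- The marked vertices. -/
def marked (n : ℕ) (σ : State) : Finset (Fin n) := {v | σ.cell 9 v ≠ 0}

theorem mem_marked {n : ℕ} {σ : State} {v : Fin n} : v ∈ marked n σ ↔ σ.cell 9 v ≠ 0 := by
  simp [marked]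

theorem marked_congr {n : ℕ} {σ τ : State} (h : τ.cell 9 = σ.cell 9) : marked n τ = marked n σ := by
  unfold marked; rw [h]

/-- An invariant of the construction of a path from `s` to `t`. -/
structure PartialPath {n : ℕ} (G : SimpleGraph (Fin n)) (A : Set (Fin n)) (x : Fin n → ℕ)
    (inf : ℕ) (s t : Fin n) (D : ℕ → ℕ) (k : ℕ) (c : Fin n) (σ : State) : Prop where
  reg : σ.reg 11 = c
  walk : ∃ q : G.Walk s c, ∀ z ∈ q.support, z = c ∨ z ∈ marked n σ
  lt : ∀ v ∈ marked n σ, v ∈ A ∧ D c < D v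
  fin : D c < inf
  mem : c ∈ A
  sum : ∑ v ∈ marked n σ, x v + D c ≤ D s
  card : c = t ∨ k ≤ (marked n σ).card

/-- As lengths are positive, the distance to `t` drops strictly at each move. So the current vertex
is never among the marked ones, and every round before reaching `t` enlarges the marked set. -/
theorem advance_spec {n : ℕ} {G : SimpleGraph (Fin n)} {σ : State} (hg : HasGraph G σ)
    {inf : ℕ} {s t c : Fin n} {k : ℕ} (ht : σ.reg 10 = t)
    (hd : IsDist G (alive n σ) (lens n σ) inf t (σ.cell 8))
    (hpos : ∀ v ∈ alive n σ, 0 < lens n σ v)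
    (h : PartialPath G (alive n σ) (lens n σ) inf s t (σ.cell 8) k c σ) :
    ∃ c', PartialPath G (alive n σ) (lens n σ) inf s t (σ.cell 8) (k + 1) c' (advance.run σ) := by
  by_cases hct : c = t
  · refine ⟨c, ?_⟩
    have hrun : advance.run σ = σ := by
      simp only [advance, Cmd.run_ite_eq, Expr.eval_reg, h.reg, ht, hct, if_true, Cmd.run_skip]
    rw [hrun]
    exact ⟨h.reg, h.walk, h.lt, h.fin, h.mem, h.sum, Or.inl hct⟩
  · have hct' : (c : ℕ) ≠ t := fun h => hct (Fin.ext h)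
    have hcM : c ∉ marked n σ := fun h' => absurd (h.lt c h').2 (lt_irrefl _)
    set υ := σ.setCell 9 c 1 with hυ
    have c8 : υ.cell 8 = σ.cell 8 := by simp [hυ, State.setCell_cell]
    have c6 : lens n υ = lens n σ := lens_congr (by simp [hυ, State.setCell_cell])
    have c7 : alive n υ = alive n σ := alive_congr (by simp [hυ, State.setCell_cell])
    obtain ⟨u, hu, hcu, huA, hDu⟩ := findNext_spec (σ := υ) (c := c)
      (hg.congr (by simp [hυ]) (by simp [hυ, State.setCell_cell])) (by simp [hυ, h.reg])
      (by rw [c8, c6, c7]; exact hd.exists_next h.fin hct)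
    rw [c8, c6] at hDu
    rw [c7] at huA
    have hrun : advance.run σ = (findNext.run υ).setReg 11 u := by
      simp only [advance, Cmd.run_ite_eq, Expr.eval_reg, h.reg, ht, hct', if_false, Cmd.run_seq,
        Cmd.run_store, Expr.eval_const, Cmd.run_set, ← hυ, hu]
    have hM : marked n (advance.run σ) = insert c (marked n σ) := by
      rw [hrun]
      have : (findNext.run υ).cell 9 = υ.cell 9 := Cmd.run_cell _ _ (by decide)
      ext v
      simp only [mem_marked, State.setReg_cell, this]
      simp only [hυ, mem_marked, State.setCell_cell_apply, true_and, Finset.mem_insert,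
        Fin.ext_iff]
      by_cases hv : (v : ℕ) = c <;> simp [hv]
    have hDc : σ.cell 8 u < σ.cell 8 c := by have := hpos c h.mem; omega
    refine ⟨u, by simp [hrun], ?_, ?_, hDc.trans h.fin, huA, ?_, Or.inr ?_⟩
    · obtain ⟨q, hq⟩ := h.walk
      refine ⟨q.concat hcu, fun z hz => ?_⟩
      rw [Walk.support_concat, List.mem_append, List.mem_singleton] at hz
      rw [hM, Finset.mem_insert]
      rcases hz with hz | hz
      · exact Or.inr (hq z hz)
      · exact Or.inl hz
    · intro v hv
      rw [hM, Finset.mem_insert] at hv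
      rcases hv with rfl | hv
      · exact ⟨h.mem, hDc⟩
      · exact ⟨(h.lt v hv).1, hDc.trans (h.lt v hv).2⟩
    · rw [hM, Finset.sum_insert hcM]
      have := h.sum
      omega
    · rw [hM, Finset.card_insert_of_notMem hcM]
      have := h.card.resolve_left hct
      omega

theorem initPath_spec {n : ℕ} {G : SimpleGraph (Fin n)} {σ : State} (hg : HasGraph G σ)
    (hinf : ∑ v, lens n σ v < σ.reg 6) {s t : Fin n} (hs : σ.reg 9 = s) (ht : σ.reg 10 = t) :
    IsDist G (alive n σ) (lens n σ) (σ.reg 6) t ((initPath.run σ).cell 8) ∧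
      (initPath.run σ).reg 11 = s ∧ marked n (initPath.run σ) = ∅ := by
  set υ := σ.setReg 7 t with hυ
  have hd := shortestPaths_spec (s := t) (σ := υ) (G := G)
    (hg.congr (by simp [hυ]) (by simp [hυ])) (by simp [hυ])
    (by rw [lens_congr (show υ.cell 6 = σ.cell 6 by simp [hυ])]; simpa [hυ] using hinf)
  rw [alive_congr (show υ.cell 7 = σ.cell 7 by simp [hυ]),
    lens_congr (show υ.cell 6 = σ.cell 6 by simp [hυ]),
    show υ.reg 6 = σ.reg 6 by simp [hυ]] at hd
  set ω := (shortestPaths.run υ).setReg 11 s with hω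
  have hrun : initPath.run σ = (Cmd.for 21 1 (.store 9 (.reg 21) (.const 0))).run ω := by
    have h9 : (shortestPaths.run υ).reg 9 = s := by
      rw [Cmd.run_reg _ _ (by decide)]; simp [hυ, hs]
    simp only [initPath, Cmd.run_seq, Cmd.run_set, Expr.eval_reg, ht, ← hυ, h9, ← hω]
  have h1 : ω.reg 1 = n := by
    simp only [hω, State.setReg_reg]
    norm_num
    rw [Cmd.run_reg _ _ (by decide)]; simp [hυ, hg.1]
  rw [hrun]
  refine ⟨?_, ?_, ?_⟩
  · rw [Cmd.run_cell _ _ (by decide)]; exact hd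
  · rw [Cmd.run_reg _ _ (by decide)]; simp [hω]
  · have key := Cmd.run_for_induction (i := 21) (bound := 1) (σ := ω)
      (body := .store 9 (.reg 21) (.const 0)) (fun k τ => ∀ v < k, τ.cell 9 v = 0) (by simp)
    specialize key ?_
    · intro k _ τ hτk _ _ ih v hv
      by_cases hvk : v = k
      · simp [hτk, hvk]
      · simp [hτk, hvk, ih v (by omega)]
    · rw [h1] at key
      refine Finset.eq_empty_of_forall_notMem fun v hv => ?_
      exact mem_marked.1 hv (key v v.2)

theorem markPath_spec {n : ℕ} {G : SimpleGraph (Fin n)} {σ : State} (hg : HasGraph G σ)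
    (hinf : ∑ v, lens n σ v < σ.reg 6) {s t : Fin n} (hs : σ.reg 9 = s) (ht : σ.reg 10 = t)
    (hpos : ∀ v ∈ alive n σ, 0 < lens n σ v) {r l : ℕ}
    (hl : LenWalk G (alive n σ) (lens n σ) t s r l) :
    (∃ q : G.Walk s t, ∀ z ∈ q.support, z ∈ marked n (markPath.run σ)) ∧
      (∀ v ∈ marked n (markPath.run σ), v ∈ alive n σ) ∧ t ∈ marked n (markPath.run σ) ∧
      ∑ v ∈ marked n (markPath.run σ), lens n σ v ≤ l := by
  obtain ⟨hd, h11, hM⟩ := initPath_spec hg hinf hs ht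
  set υ := initPath.run σ with hυ
  have c6 : υ.cell 6 = σ.cell 6 := Cmd.run_cell _ _ (by decide)
  have c7 : υ.cell 7 = σ.cell 7 := Cmd.run_cell _ _ (by decide)
  have h10 : υ.reg 10 = t := (Cmd.run_reg _ _ (by decide)).trans ht
  have hgυ : HasGraph G υ := hg.congr (Cmd.run_reg _ _ (by decide)) (Cmd.run_cell _ _ (by decide))
  have key := Cmd.run_for_induction (i := 19) (bound := 1) (σ := υ) (body := advance)
    (fun k τ => ∃ c, PartialPath G (alive n σ) (lens n σ) (σ.reg 6) s t (υ.cell 8) k c τ)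
    ⟨s, by simp [h11], ⟨.nil, by simp⟩, by
      rw [marked_congr (σ := υ) (by simp), hM]; simp, hd.lt s _ _ hl, by
        obtain ⟨p, hp, -⟩ := hl.exists_walk
        exact hp s p.end_mem_support, by
      rw [marked_congr (σ := υ) (by simp), hM]; simp, Or.inr (Nat.zero_le _)⟩
  specialize key ?_
  · rintro k hk τ hτk hr hc ⟨c, ih⟩
    have c6' : lens n τ = lens n σ := lens_congr ((hc 6 (by decide)).trans c6)
    have c7' : alive n τ = alive n σ := alive_congr ((hc 7 (by decide)).trans c7)
    have c8' : τ.cell 8 = υ.cell 8 := hc 8 (by decide)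
    obtain ⟨c', h'⟩ := advance_spec (inf := σ.reg 6) (s := s) (t := t) (c := c) (k := k)
      (hgυ.congr (hr 1 (by decide)) (hc 0 (by decide)))
      ((hr 10 (by decide)).trans h10) (by rw [c6', c7', c8']; exact hd)
      (by rw [c6', c7']; exact hpos) (by rw [c6', c7', c8']; exact ih)
    rw [c6', c7', c8'] at h'
    have hm : marked n ((advance.run τ).setReg 19 (k + 1)) = marked n (advance.run τ) :=
      marked_congr (by simp)
    exact ⟨c', by simpa using h'.reg, by rw [hm]; exact h'.walk, by rw [hm]; exact h'.lt, h'.fin,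
      h'.mem, by rw [hm]; exact h'.sum, by rw [hm]; exact h'.card⟩
  · obtain ⟨c, h⟩ := key
    rw [hgυ.1] at h
    set ω := (Cmd.for 19 1 advance).run υ with hω
    have hrun : markPath.run σ = ω.setCell 9 t 1 := by
      have : ω.reg 10 = t := (Cmd.run_reg _ _ (by decide)).trans h10
      simp only [markPath, Cmd.run_seq, ← hυ, ← hω, Cmd.run_store, Expr.eval_reg, this,
        Expr.eval_const]
    have hcM : c ∉ marked n ω := fun h' => absurd (h.lt c h').2 (lt_irrefl _)
    -- If `n` rounds did not reach `t`, all `n` vertices would be marked, including the current one.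
    have hct : c = t := by
      refine h.card.resolve_right fun hn => hcM ?_
      have : marked n ω = Finset.univ :=
        Finset.eq_univ_of_card _ (le_antisymm (Finset.card_le_univ _) (by simpa using hn))
      rw [this]; exact Finset.mem_univ c
    subst hct
    have hM' : marked n (markPath.run σ) = insert c (marked n ω) := by
      rw [hrun]
      ext v
      simp only [mem_marked, State.setCell_cell_apply, true_and, Finset.mem_insert, Fin.ext_iff]
      by_cases hv : (v : ℕ) = c <;> simp [hv]
    rw [hM']
    refine ⟨?_, ?_, Finset.mem_insert_self _ _, ?_⟩
    · obtain ⟨q, hq⟩ := h.walk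
      exact ⟨q, fun z hz => Finset.mem_insert.2 (hq z hz)⟩
    · intro v hv
      rcases Finset.mem_insert.1 hv with rfl | hv
      · exact h.mem
      · exact (h.lt v hv).1
    · rw [Finset.sum_insert hcM]
      obtain ⟨r', hr'⟩ := hd.exists_walk c h.fin
      have h1 := hr'.le_length
      have h2 := h.sum
      have h3 := hd.le s _ _ hl
      omega

/-! ### Sending flow along a path -/

/-- The least remainder of a marked vertex. -/
def findBottleneck : Cmd :=
  .seq (.set 13 (.cell 5 (.reg 10))) (.for 21 1 (.ite (.cell 9 (.reg 21))
    (.ite ((Expr.cell 5 (.reg 21)).lt (.reg 13)) (.set 13 (.cell 5 (.reg 21))) .skip) .skip))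

/-- Subtracts the amount of flow from the remainders of the marked vertices. -/
def updateLoads : Cmd :=
  .for 21 1 (.ite (.cell 9 (.reg 21)) (.ite ((Expr.cell 5 (.reg 21)).eq (.reg 13))
    (.seq (.store 4 (.reg 21) (.cell 4 (.reg 21) + .cell 4 (.reg 21)))
      (.store 5 (.reg 21) (.cell 2 (.reg 21))))
    (.store 5 (.reg 21) (.cell 5 (.reg 21) - .reg 13))) .skip)

theorem findBottleneck_spec {n : ℕ} {σ : State} (hn : σ.reg 1 = n) {t : Fin n}
    (ht : σ.reg 10 = t) (htM : t ∈ marked n σ) :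
    (∀ v ∈ marked n σ, (findBottleneck.run σ).reg 13 ≤ σ.cell 5 v) ∧
      ∃ v ∈ marked n σ, σ.cell 5 v = (findBottleneck.run σ).reg 13 := by
  set υ := σ.setReg 13 (σ.cell 5 t) with hυ
  have hrun : findBottleneck.run σ = (Cmd.for 21 1 (.ite (.cell 9 (.reg 21))
    (.ite ((Expr.cell 5 (.reg 21)).lt (.reg 13)) (.set 13 (.cell 5 (.reg 21))) .skip)
      .skip)).run υ := by
    simp only [findBottleneck, Cmd.run_seq, Cmd.run_set, Expr.eval_cell, Expr.eval_reg, ht, ← hυ]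
  have key := Cmd.run_for_induction (i := 21) (bound := 1) (σ := υ)
    (body := .ite (.cell 9 (.reg 21))
      (.ite ((Expr.cell 5 (.reg 21)).lt (.reg 13)) (.set 13 (.cell 5 (.reg 21))) .skip) .skip)
    (fun k τ => (∀ v ∈ marked n σ, (v : ℕ) < k → τ.reg 13 ≤ σ.cell 5 v) ∧
      ∃ v ∈ marked n σ, σ.cell 5 v = τ.reg 13) ⟨by simp, t, htM, by simp [hυ]⟩
  specialize key ?_
  · rintro k hk τ hτk hr hc ⟨i1, i2⟩
    have h1 : υ.reg 1 = n := by simp [hυ, hn]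
    rw [h1] at hk
    have c9 : τ.cell 9 = σ.cell 9 := (hc 9 (by decide)).trans (by simp [hυ])
    have c5 : τ.cell 5 = σ.cell 5 := (hc 5 (by decide)).trans (by simp [hυ])
    simp only [Cmd.run_ite_cell, Cmd.run_ite_lt, Expr.eval_reg, Expr.eval_cell, hτk, c9, c5,
      Cmd.run_skip, Cmd.run_set]
    have hold : ((⟨k, hk⟩ : Fin n) ∈ marked n σ → τ.reg 13 ≤ σ.cell 5 k) →
        (∀ v ∈ marked n σ, (v : ℕ) < k + 1 → (τ.setReg 21 (k + 1)).reg 13 ≤ σ.cell 5 v) ∧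
        ∃ v ∈ marked n σ, σ.cell 5 v = (τ.setReg 21 (k + 1)).reg 13 := by
      intro hno
      refine ⟨fun v hv hvk => ?_, by simpa using i2⟩
      rcases Nat.lt_succ_iff_lt_or_eq.1 hvk with h | h
      · simpa using i1 v hv h
      · obtain rfl : v = ⟨k, hk⟩ := Fin.ext h
        simpa using hno hv
    split
    next h9 =>
      split
      next hlt =>
        refine ⟨fun v hv hvk => ?_, ⟨k, hk⟩, mem_marked.2 h9, by simp⟩
        simp only [State.setReg_reg]
        norm_num
        rcases Nat.lt_succ_iff_lt_or_eq.1 hvk with h | h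
        · exact hlt.le.trans (i1 v hv h)
        · rw [h]
      next hlt => exact hold fun _ => not_lt.1 hlt
    next h9 => exact hold fun h => absurd (mem_marked.1 h) h9
  · have h1 : υ.reg 1 = n := by simp [hυ, hn]
    rw [h1, ← hrun] at key
    exact ⟨fun v hv => key.1 v hv v.2, key.2⟩

theorem updateLoads_spec {n : ℕ} {σ : State} (hn : σ.reg 1 = n) (v : Fin n) :
    (updateLoads.run σ).cell 4 v =
      (if v ∈ marked n σ ∧ σ.cell 5 v = σ.reg 13 then 2 * σ.cell 4 v else σ.cell 4 v) ∧
    (updateLoads.run σ).cell 5 v =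
      (if v ∈ marked n σ then if σ.cell 5 v = σ.reg 13 then σ.cell 2 v
        else σ.cell 5 v - σ.reg 13 else σ.cell 5 v) := by
  have key := Cmd.run_for_induction (i := 21) (bound := 1) (σ := σ)
    (body := .ite (.cell 9 (.reg 21)) (.ite ((Expr.cell 5 (.reg 21)).eq (.reg 13))
    (.seq (.store 4 (.reg 21) (.cell 4 (.reg 21) + .cell 4 (.reg 21)))
      (.store 5 (.reg 21) (.cell 2 (.reg 21))))
    (.store 5 (.reg 21) (.cell 5 (.reg 21) - .reg 13))) .skip)
    (fun k τ => (∀ v : ℕ, k ≤ v → τ.cell 4 v = σ.cell 4 v ∧ τ.cell 5 v = σ.cell 5 v) ∧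
      ∀ v : Fin n, (v : ℕ) < k → τ.cell 4 v =
      (if v ∈ marked n σ ∧ σ.cell 5 v = σ.reg 13 then 2 * σ.cell 4 v else σ.cell 4 v) ∧
      τ.cell 5 v = (if v ∈ marked n σ then if σ.cell 5 v = σ.reg 13 then σ.cell 2 v
        else σ.cell 5 v - σ.reg 13 else σ.cell 5 v)) (by simp)
  specialize key ?_
  · rintro k hk τ hτk hr hc ⟨i1, i2⟩
    rw [hn] at hk
    have h13 : τ.reg 13 = σ.reg 13 := hr 13 (by decide)
    have h2 : τ.cell 2 = σ.cell 2 := hc 2 (by decide)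
    have hbody : ∃ a b, (a = if (⟨k, hk⟩ : Fin n) ∈ marked n σ ∧ σ.cell 5 k = σ.reg 13 then
          2 * σ.cell 4 k else σ.cell 4 k) ∧
        (b = if (⟨k, hk⟩ : Fin n) ∈ marked n σ then if σ.cell 5 k = σ.reg 13 then σ.cell 2 k
          else σ.cell 5 k - σ.reg 13 else σ.cell 5 k) ∧
        ∀ c v, c = 4 ∨ c = 5 → (((Cmd.ite (.cell 9 (.reg 21))
          (.ite ((Expr.cell 5 (.reg 21)).eq (.reg 13))
          (.seq (.store 4 (.reg 21) (.cell 4 (.reg 21) + .cell 4 (.reg 21)))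
          (.store 5 (.reg 21) (.cell 2 (.reg 21))))
          (.store 5 (.reg 21) (.cell 5 (.reg 21) - .reg 13))) .skip).run τ).setReg 21
            (k + 1)).cell c v =
            if v = k then if c = 4 then a else b else τ.cell c v := by
      refine ⟨_, _, rfl, rfl, ?_⟩
      obtain ⟨j4, j5⟩ := i1 k le_rfl
      simp only [Cmd.run_ite_cell, Cmd.run_ite_eq, Expr.eval_reg, Expr.eval_cell, hτk,
        hc 9 (by decide), Cmd.run_skip, Cmd.run_seq, Cmd.run_store,
        Expr.eval_sub, Expr.eval_add, mem_marked, h13, j4, j5]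
      intro c v hcv
      by_cases h9 : σ.cell 9 k ≠ 0
      · by_cases h5 : σ.cell 5 k = σ.reg 13
        · rcases hcv with rfl | rfl <;> by_cases hv : v = k <;>
            simp [h9, h5, hv, hτk, h2, two_mul]
        · rcases hcv with rfl | rfl <;> by_cases hv : v = k <;> simp [h9, h5, hv, j4]
      · rcases hcv with rfl | rfl <;> by_cases hv : v = k <;> simp [h9, hv, j4, j5]
    obtain ⟨a, b, ha, hb, hab⟩ := hbody
    refine ⟨fun v hv => ?_, fun v hv => ?_⟩
    · rw [hab 4 v (Or.inl rfl), hab 5 v (Or.inr rfl), if_neg (by omega), if_neg (by omega)]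
      exact i1 v (by omega)
    · rw [hab 4 v (Or.inl rfl), hab 5 v (Or.inr rfl)]
      rcases Nat.lt_succ_iff_lt_or_eq.1 hv with h | h
      · have hvk : ¬ (v : ℕ) = k := by omega
        rw [if_neg hvk, if_neg hvk]
        exact i2 v h
      · obtain rfl : v = ⟨k, hk⟩ := Fin.ext h
        simp [ha, hb]
  · rw [hn] at key
    exact key.2 v v.2

end Multicut

namespace RAM.Cmd

/-- The effect of a loop whose rounds change only the entries at the value of the counter. -/
theorem run_for_map {i bound : ℕ} {body : Cmd} {σ : State} (g : ℕ → ℕ → ℕ)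
    (h : ∀ k < σ.reg bound, ∀ τ : State, τ.reg i = k →
      (∀ j ∉ (Cmd.for i bound body).writesReg, τ.reg j = σ.reg j) →
      (∀ a ∉ (Cmd.for i bound body).writesCell, τ.cell a = σ.cell a) →
      (∀ a, τ.cell a k = σ.cell a k) →
      ∀ a v, (body.run τ).cell a v = if v = k then g a k else τ.cell a v) (a v : ℕ) :
    ((Cmd.for i bound body).run σ).cell a v = if v < σ.reg bound then g a v else σ.cell a v := by
  have key := run_for_induction (i := i) (bound := bound) (body := body) (σ := σ)
    (fun k τ => ∀ a v, τ.cell a v = if v < k then g a v else σ.cell a v) (by simp)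
  refine key ?_ a v
  intro k hk τ hτk hr hc ih a v
  rw [State.setReg_cell, h k hk τ hτk hr hc (fun a => by simp [ih]) a v, ih]
  split_ifs with h1 h2 h3 <;> first | rfl | (subst h1; rfl) | omega

end RAM.Cmd

namespace Multicut

open RAM SimpleGraph

/-! ### Rounding

Registers: `R 14` least weight found, `R 15` weight of the candidate, `R 16` offset, `R 18` root.
Arrays: `A 10` distances from the roots, `A 11` candidate. -/

/-- Replaces the lengths by small integers, and removes vertices of great length. -/
def roundLens : Cmd :=
  .for 21 1 (.seq (.store 6 (.reg 21) (.cell 6 (.reg 21) * .reg 1 * .const 5 / .reg 8))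
    (.ite ((Expr.cell 6 (.reg 21)).lt (.reg 1)) .skip (.store 7 (.reg 21) (.const 1))))

theorem roundLens_spec {n : ℕ} {σ : State} (hn : σ.reg 1 = n) :
    (∀ v, lens n (roundLens.run σ) v = lens n σ v * n * 5 / σ.reg 8) ∧
      alive n (roundLens.run σ) = {v | v ∈ alive n σ ∧ lens n (roundLens.run σ) v < n} := by
  have key := Cmd.run_for_map (i := 21) (bound := 1) (σ := σ)
    (body := .seq (.store 6 (.reg 21) (.cell 6 (.reg 21) * .reg 1 * .const 5 / .reg 8))
      (.ite ((Expr.cell 6 (.reg 21)).lt (.reg 1)) .skip (.store 7 (.reg 21) (.const 1))))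
    (fun a v => if a = 6 then σ.cell 6 v * n * 5 / σ.reg 8 else
      if a = 7 ∧ ¬ σ.cell 6 v * n * 5 / σ.reg 8 < n then 1 else σ.cell a v) ?_
  swap
  · intro k hk τ hτk hr hc hτ a v
    have h1 : τ.reg 1 = n := (hr 1 (by decide)).trans hn
    have h8 : τ.reg 8 = σ.reg 8 := hr 8 (by decide)
    simp only [Cmd.run_seq, Cmd.run_store, Cmd.run_ite_lt, Cmd.run_skip, Expr.eval_reg,
      Expr.eval_div, Expr.eval_mul, Expr.eval_cell, Expr.eval_const, hτk, h1, h8, hτ,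
      State.setCell_reg, State.setCell_cell_apply, and_self, if_true]
    by_cases hlt : σ.cell 6 k * n * 5 / σ.reg 8 < n
    · by_cases h6 : a = 6 <;> by_cases hv : v = k <;> simp [hlt, h6, hv, hτ]
    · rw [if_neg hlt]
      by_cases h6 : a = 6
      · by_cases hv : v = k <;> simp [h6, hv]
      · by_cases h7 : a = 7 <;> by_cases hv : v = k <;> simp [h6, h7, hv, hτ, not_lt.1 hlt]
  · have h6 : ∀ v : Fin n, (roundLens.run σ).cell 6 v = σ.cell 6 v * n * 5 / σ.reg 8 := by
      intro v
      have : (v : ℕ) < σ.reg 1 := hn ▸ v.2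
      exact (key 6 v).trans (by simp [this])
    refine ⟨h6, ?_⟩
    ext v
    have : (v : ℕ) < σ.reg 1 := hn ▸ v.2
    have h7 : (roundLens.run σ).cell 7 v = _ := key 7 v
    simp only [alive, Set.mem_ofPred_eq, h7, this, if_true, lens, h6]
    by_cases hlt : σ.cell 6 v * n * 5 / σ.reg 8 < n <;> simp [hlt]

/-- Copies the distances from a source to the vertices without a root. -/
def adoptVertices : Cmd :=
  .for 21 1 (.ite ((Expr.cell 10 (.reg 21)).lt (.reg 6)) .skip
    (.store 10 (.reg 21) (.cell 8 (.reg 21))))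

/-- The distances of all vertices from the roots of their components. -/
def rootDistances : Cmd :=
  .seq (.for 21 1 (.store 10 (.reg 21) (.reg 6)))
    (.for 18 1 (.seq (.set 7 (.reg 18)) (.seq shortestPaths adoptVertices)))

theorem adoptVertices_spec {n : ℕ} {σ : State} (hn : σ.reg 1 = n) (v : Fin n) :
    (adoptVertices.run σ).cell 10 v =
      if σ.cell 10 v < σ.reg 6 then σ.cell 10 v else σ.cell 8 v := by
  have key := Cmd.run_for_map (i := 21) (bound := 1) (σ := σ)
    (body := .ite ((Expr.cell 10 (.reg 21)).lt (.reg 6)) .skip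
      (.store 10 (.reg 21) (.cell 8 (.reg 21))))
    (fun a v => if a = 10 ∧ ¬ σ.cell 10 v < σ.reg 6 then σ.cell 8 v else σ.cell a v) ?_
  swap
  · intro k hk τ hτk hr hc hτ a v
    have h6 : τ.reg 6 = σ.reg 6 := hr 6 (by decide)
    simp only [Cmd.run_store, Cmd.run_ite_lt, Cmd.run_skip, Expr.eval_reg,
      Expr.eval_cell, hτk, h6, hτ]
    by_cases hlt : σ.cell 10 k < σ.reg 6
    · by_cases hv : v = k <;> simp [hlt, hv, hτ]
    · by_cases h10 : a = 10 <;> by_cases hv : v = k <;> simp [hlt, h10, hv, hτ]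
  · have h1 : (v : ℕ) < σ.reg 1 := hn ▸ v.2
    refine (key 10 v).trans ?_
    by_cases hlt : σ.cell 10 v < σ.reg 6 <;> simp [h1, hlt]

/-- `d` lists the distances from the first of the first `k` vertices that reaches `v`. -/
def RootedBelow {n : ℕ} (G : SimpleGraph (Fin n)) (A : Set (Fin n)) (x : Fin n → ℕ) (inf k : ℕ)
    (v : Fin n) (d : ℕ) : Prop :=
  (d = inf ∧ ∀ u : Fin n, (u : ℕ) < k → ∀ r l, ¬ LenWalk G A x u v r l) ∨
  (d < inf ∧ ∃ s : Fin n, (∃ r, LenWalk G A x s v r d) ∧ (∀ r l, LenWalk G A x s v r l → d ≤ l) ∧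
    ∀ u < s, ∀ r l, ¬ LenWalk G A x u v r l)

/-- Sources are tried in increasing order, and an entry is overwritten only while it is infinite, so
the distance kept comes from the least vertex that reaches `v`. -/
theorem rootDistances_rooted {n : ℕ} {G : SimpleGraph (Fin n)} {σ : State} (hg : HasGraph G σ)
    (hinf : ∑ v, lens n σ v < σ.reg 6) (v : Fin n) :
    RootedBelow G (alive n σ) (lens n σ) (σ.reg 6) n v ((rootDistances.run σ).cell 10 v) := by
  set υ := (Cmd.for 21 1 (.store 10 (.reg 21) (.reg 6))).run σ with hυ
  have hfill : ∀ v : Fin n, υ.cell 10 v = σ.reg 6 := by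
    have key := Cmd.run_for_induction (i := 21) (bound := 1) (σ := σ)
      (body := .store 10 (.reg 21) (.reg 6)) (fun k τ => ∀ v < k, τ.cell 10 v = σ.reg 6) (by simp)
    specialize key ?_
    · intro k hk τ hτk hr _ ih v hv
      have : τ.reg 6 = σ.reg 6 := hr 6 (by decide)
      by_cases hvk : v = k
      · simp [hτk, hvk, this]
      · simp [hτk, hvk, ih v (by omega)]
    · intro v; exact key v (hg.1 ▸ v.2)
  have r6 : υ.reg 6 = σ.reg 6 := Cmd.run_reg _ _ (by decide)
  have c6 : lens n υ = lens n σ := lens_congr (Cmd.run_cell _ _ (by decide))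
  have c7 : alive n υ = alive n σ := alive_congr (Cmd.run_cell _ _ (by decide))
  have hgυ : HasGraph G υ := hg.congr (Cmd.run_reg _ _ (by decide)) (Cmd.run_cell _ _ (by decide))
  have key := Cmd.run_for_induction (i := 18) (bound := 1) (σ := υ)
    (body := .seq (.set 7 (.reg 18)) (.seq shortestPaths adoptVertices))
    (fun k τ => ∀ v : Fin n,
      RootedBelow G (alive n σ) (lens n σ) (σ.reg 6) k v (τ.cell 10 v))
    (fun v => Or.inl ⟨by simp [hfill], fun u hu => absurd hu (Nat.not_lt_zero _)⟩)
  specialize key ?_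
  · intro k hk τ hτk hr hc ih v
    rw [hgυ.1] at hk
    set ω := τ.setReg 7 k with hω
    have e6 : ω.reg 6 = σ.reg 6 := by simp [hω, hr 6 (by decide), r6]
    have c6' : lens n ω = lens n σ := (lens_congr (hc 6 (by decide))).trans c6
    have c7' : alive n ω = alive n σ := (alive_congr (hc 7 (by decide))).trans c7
    have hgω : HasGraph G ω := hgυ.congr (by simp [hω, hr 1 (by decide)]) (hc 0 (by decide))
    have hd := shortestPaths_spec (s := ⟨k, hk⟩) hgω (by simp [hω]) (by rw [c6', e6]; exact hinf)
    rw [c6', c7', e6] at hd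
    have hrun : (Cmd.seq (.set 7 (.reg 18)) (.seq shortestPaths adoptVertices)).run τ =
        adoptVertices.run (shortestPaths.run ω) := by
      simp only [Cmd.run_seq, Cmd.run_set, Expr.eval_reg, hτk, ← hω]
    have h10 : (shortestPaths.run ω).cell 10 = τ.cell 10 := Cmd.run_cell _ _ (by decide)
    have h6 : (shortestPaths.run ω).reg 6 = σ.reg 6 := (Cmd.run_reg _ _ (by decide)).trans e6
    rw [State.setReg_cell, hrun,
      adoptVertices_spec ((Cmd.run_reg _ _ (by decide)).trans hgω.1), h10, h6]
    rcases ih v with ⟨h, hno⟩ | ⟨h, hyes⟩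
    · rw [if_neg (by omega)]
      rcases (hd.le_inf v).lt_or_eq with hlt | heq
      · exact Or.inr ⟨hlt, ⟨k, hk⟩, hd.exists_walk v hlt, hd.le v, fun u hu => hno u hu⟩
      · refine Or.inl ⟨heq, fun u hu r l hl => ?_⟩
        rcases Nat.lt_succ_iff_lt_or_eq.1 hu with hu | hu
        · exact hno u hu r l hl
        · obtain rfl : u = ⟨k, hk⟩ := Fin.ext hu
          exact absurd (hd.lt v r l hl) (by omega)
    · rw [if_pos h]
      exact Or.inr ⟨h, hyes⟩
  · rw [hgυ.1] at key
    exact key v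

/-- The root of `v` is the least vertex reaching it. A walk to a vertex extends to its neighbours,
so neighbours have the same root. -/
theorem rootDistances_spec {n : ℕ} {G : SimpleGraph (Fin n)} {σ : State} (hg : HasGraph G σ)
    (hinf : ∑ v, lens n σ v < σ.reg 6) :
    ∃ root, IsRootDist G (alive n σ) (lens n σ) root
      (fun v : Fin n => (rootDistances.run σ).cell 10 v) := by
  have h := rootDistances_rooted hg hinf
  have h' : ∀ v : Fin n, ∃ s : Fin n, v ∈ alive n σ →
      (∃ r, LenWalk G (alive n σ) (lens n σ) s v r ((rootDistances.run σ).cell 10 v)) ∧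
      (∀ r l, LenWalk G (alive n σ) (lens n σ) s v r l → (rootDistances.run σ).cell 10 v ≤ l) ∧
      ∀ u < s, ∀ r l, ¬ LenWalk G (alive n σ) (lens n σ) u v r l := by
    intro v
    rcases h v with ⟨-, hno⟩ | ⟨-, s, hs⟩
    · exact ⟨v, fun hv => absurd (LenWalk.nil hv) (hno v v.2 _ _)⟩
    · exact ⟨s, fun _ => hs⟩
  choose root hroot using h'
  have hle : ∀ u ∈ alive n σ, ∀ v ∈ alive n σ, G.Adj u v → root v ≤ root u := by
    intro u hu v hv huv
    obtain ⟨r, hr⟩ := (hroot u hu).1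
    by_contra! hlt
    exact (hroot v hv).2.2 _ hlt _ _ (hr.snoc huv hv)
  exact ⟨root, fun v hv => (hroot v hv).1, fun v hv => (hroot v hv).2.1,
    fun u hu v hv huv => le_antisymm (hle v hv u hu huv.symm) (hle u hu v hv huv)⟩

/-- Puts a vertex into the candidate. -/
def cutVertex : Cmd :=
  .seq (.store 11 (.reg 21) (.const 1)) (.set 15 (.reg 15 + .cell 2 (.reg 21)))

/-- Computes the vertices cut by the offset `R 16`, and their weight. -/
def computeCut : Cmd :=
  .seq (.set 15 (.const 0)) (.for 21 1 (.ite (.cell 7 (.reg 21)) cutVertex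
    (.ite ((((Expr.cell 10 (.reg 21) - .cell 6 (.reg 21)) + .reg 16) / .reg 1).eq
      ((Expr.cell 10 (.reg 21) + .reg 16) / .reg 1))
      (.store 11 (.reg 21) (.const 0)) cutVertex)))

/-- Stores the candidate. -/
def storeBest : Cmd :=
  .seq (.set 14 (.reg 15)) (.for 21 1 (.store 1 (.const 2 + .reg 21) (.cell 11 (.reg 21))))

/-- Tries all offsets. -/
def tryOffsets : Cmd :=
  .for 16 1 (.seq computeCut (.ite ((Expr.reg 15).lt (.reg 14)) storeBest .skip))

/-- The weights of the vertices. -/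
def weights (n : ℕ) (σ : State) (v : Fin n) : ℕ := σ.cell 2 v

/-- The distances from the roots. -/
def rootDist (n : ℕ) (σ : State) (v : Fin n) : ℕ := σ.cell 10 v

open Classical in
theorem computeCut_spec {n : ℕ} {σ : State} (hn : σ.reg 1 = n) :
    (computeCut.run σ).reg 15 = ∑ v : Fin n,
      (if Cut (alive n σ) (lens n σ) (rootDist n σ) n (σ.reg 16) v then weights n σ v else 0) ∧
    ∀ v : Fin n, (computeCut.run σ).cell 11 v =
      if Cut (alive n σ) (lens n σ) (rootDist n σ) n (σ.reg 16) v then 1 else 0 := by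
  set υ := σ.setReg 15 0 with hυ
  have key := Cmd.run_for_induction (i := 21) (bound := 1) (σ := υ)
    (body := .ite (.cell 7 (.reg 21)) cutVertex
    (.ite ((((Expr.cell 10 (.reg 21) - .cell 6 (.reg 21)) + .reg 16) / .reg 1).eq
      ((Expr.cell 10 (.reg 21) + .reg 16) / .reg 1))
      (.store 11 (.reg 21) (.const 0)) cutVertex))
    (fun k τ => (τ.reg 15 = ∑ v : Fin n, if (v : ℕ) < k then
      (if Cut (alive n σ) (lens n σ) (rootDist n σ) n (σ.reg 16) v then weights n σ v else 0)
        else 0) ∧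
      ∀ v : Fin n, (v : ℕ) < k → τ.cell 11 v =
        if Cut (alive n σ) (lens n σ) (rootDist n σ) n (σ.reg 16) v then 1 else 0)
    (by simp [hυ])
  have h1 : υ.reg 1 = n := by simp [hυ, hn]
  specialize key ?_
  · rintro k hk τ hτk hr hc ⟨i1, i2⟩
    rw [h1] at hk
    have e1 : τ.reg 1 = n := (hr 1 (by decide)).trans h1
    have e16 : τ.reg 16 = σ.reg 16 := (hr 16 (by decide)).trans (by simp [hυ])
    have e6 : τ.cell 6 = σ.cell 6 := hc 6 (by decide)
    have e7 : τ.cell 7 = σ.cell 7 := hc 7 (by decide)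
    have e2 : τ.cell 2 = σ.cell 2 := hc 2 (by decide)
    have e10 : τ.cell 10 = σ.cell 10 := hc 10 (by decide)
    have hsum : ∀ f : Fin n → ℕ, (∑ v : Fin n, if (v : ℕ) < k + 1 then f v else 0) =
        (∑ v : Fin n, if (v : ℕ) < k then f v else 0) + f ⟨k, hk⟩ := by
      intro f
      have : ∀ v : Fin n, (if (v : ℕ) < k + 1 then f v else 0) =
          (if (v : ℕ) < k then f v else 0) + if v = ⟨k, hk⟩ then f v else 0 := by
        intro v
        simp only [show v = ⟨k, hk⟩ ↔ (v : ℕ) = k from Fin.ext_iff]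
        rcases lt_trichotomy (v : ℕ) k with h | h | h
        · simp [h, h.ne, h.trans (Nat.lt_succ_self k)]
        · simp [h]
        · simp [h.ne', not_lt.2 h.le, show ¬ (v : ℕ) < k + 1 by omega]
      simp_rw [this, Finset.sum_add_distrib, Finset.sum_ite_eq', Finset.mem_univ, if_true]
    -- The branches of the body differ only in the verdict `b` whether the vertex is cut; each is
    -- checked against this common form.
    have hbody : ∀ (b : Prop) [Decidable b] (ρ : State), (b ↔ Cut (alive n σ) (lens n σ)
          (rootDist n σ) n (σ.reg 16) ⟨k, hk⟩) →
        ρ.reg 15 = τ.reg 15 + (if b then σ.cell 2 k else 0) →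
        (∀ v, ρ.cell 11 v = if v = k then (if b then 1 else 0) else τ.cell 11 v) →
        ((ρ.setReg 21 (k + 1)).reg 15 = ∑ v : Fin n, if (v : ℕ) < k + 1 then
      (if Cut (alive n σ) (lens n σ) (rootDist n σ) n (σ.reg 16) v then weights n σ v else 0)
        else 0) ∧
      ∀ v : Fin n, (v : ℕ) < k + 1 → (ρ.setReg 21 (k + 1)).cell 11 v =
        if Cut (alive n σ) (lens n σ) (rootDist n σ) n (σ.reg 16) v then 1 else 0 := by
      intro b _ ρ hb h15 h11
      refine ⟨?_, fun v hv => ?_⟩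
      · rw [hsum, ← i1]
        simp only [State.setReg_reg, h15, hb, weights]
        rfl
      · rw [State.setReg_cell, h11]
        rcases Nat.lt_succ_iff_lt_or_eq.1 hv with h | h
        · rw [if_neg h.ne]; exact i2 v h
        · obtain rfl : v = ⟨k, hk⟩ := Fin.ext h
          simp only [if_true, hb]
    simp only [Cmd.run_ite_cell, Cmd.run_ite_eq, cutVertex, Cmd.run_seq, Cmd.run_store,
      Cmd.run_set, Expr.eval_reg, Expr.eval_cell, Expr.eval_const, Expr.eval_add, Expr.eval_sub,
      Expr.eval_div, hτk, e1, e16, e6, e7, e10]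
    split
    next h7 =>
      refine hbody True _ ?_ (by simp [hτk, e2]) (by simp)
      simp only [true_iff]
      exact Or.inl h7
    next h7 =>
      split
      next heq =>
        refine hbody False _ ?_ (by simp) (by simp)
        simp only [false_iff, Cut, not_or, not_not]
        exact ⟨by simpa [alive] using h7, heq⟩
      next hne =>
        refine hbody True _ ?_ (by simp [hτk, e2]) (by simp)
        simp only [true_iff]
        exact Or.inr hne
  · rw [h1] at key
    refine ⟨key.1.trans ?_, fun v => key.2 v v.2⟩
    simp

/-- The memory holds a multicut, and its weight. -/
def HasBest {n : ℕ} (G : SimpleGraph (Fin n)) (T : Set (Fin n × Fin n)) (w : Fin n → ℕ)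
    (σ : State) : Prop :=
  ∃ S : Finset (Fin n), IsMulticut G T S ∧ σ.reg 14 = ∑ v ∈ S, w v ∧
    ∀ v : Fin n, σ.cell 1 (2 + v) = if v ∈ S then 1 else 0

theorem HasBest.congr {n : ℕ} {G : SimpleGraph (Fin n)} {T : Set (Fin n × Fin n)}
    {w : Fin n → ℕ} {σ τ : State} (h : HasBest G T w σ) (h14 : τ.reg 14 = σ.reg 14)
    (h1 : τ.cell 1 = σ.cell 1) : HasBest G T w τ := by
  unfold HasBest; rw [h14, h1]; exact h

theorem storeBest_spec {n : ℕ} {σ : State} (hn : σ.reg 1 = n) :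
    (storeBest.run σ).reg 14 = σ.reg 15 ∧
      ∀ v : Fin n, (storeBest.run σ).cell 1 (2 + v) = σ.cell 11 v := by
  set υ := σ.setReg 14 (σ.reg 15) with hυ
  have h1 : υ.reg 1 = n := by simp [hυ, hn]
  have hrun : storeBest.run σ =
    (Cmd.for 21 1 (.store 1 (Expr.const 2 + .reg 21) (.cell 11 (.reg 21)))).run υ := rfl
  have h14 : (storeBest.run σ).reg 14 = υ.reg 14 := by rw [hrun, Cmd.run_reg _ _ (by decide)]
  refine ⟨h14.trans (by simp [hυ]), ?_⟩
  have key := Cmd.run_for_induction (i := 21) (bound := 1) (σ := υ)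
    (body := .store 1 (.const 2 + .reg 21) (.cell 11 (.reg 21)))
    (fun k τ => ∀ v < k, τ.cell 1 (2 + v) = σ.cell 11 v) (by simp)
  specialize key ?_
  · intro k _ τ hτk _ hc ih v hv
    have : τ.cell 11 = σ.cell 11 := hc 11 (by decide)
    by_cases hvk : v = k
    · simp [hτk, hvk, this]
    · simp [hτk, hvk, ih v (by omega)]
  · intro v; exact key v (h1 ▸ v.2)

-- Trying every offset derandomizes the averaging argument: the minimum is at most the weight for
-- the good offset, which need not be known.
open Classical in
theorem tryOffsets_spec {n : ℕ} {G : SimpleGraph (Fin n)} {T : Set (Fin n × Fin n)} {σ : State}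
    (hn : σ.reg 1 = n) (hbest : HasBest G T (weights n σ) σ)
    (hcut : ∀ θ < n, IsMulticut G T
      {v | Cut (alive n σ) (lens n σ) (rootDist n σ) n θ v}) :
    HasBest G T (weights n σ) (tryOffsets.run σ) ∧ (tryOffsets.run σ).reg 14 ≤ σ.reg 14 ∧
      ∀ θ < n, (tryOffsets.run σ).reg 14 ≤ ∑ v : Fin n,
        (if Cut (alive n σ) (lens n σ) (rootDist n σ) n θ v then weights n σ v else 0) := by
  have key := Cmd.run_for_induction (i := 16) (bound := 1) (σ := σ)
    (body := .seq computeCut (.ite ((Expr.reg 15).lt (.reg 14)) storeBest .skip))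
    (fun k τ => HasBest G T (weights n σ) τ ∧ τ.reg 14 ≤ σ.reg 14 ∧
      ∀ θ < k, τ.reg 14 ≤ ∑ v : Fin n,
        (if Cut (alive n σ) (lens n σ) (rootDist n σ) n θ v then weights n σ v else 0))
    ⟨hbest.congr (by simp) (by simp), by simp, by simp⟩
  specialize key ?_
  · rintro k hk τ hτk hr hc ⟨i1, i2, i3⟩
    rw [hn] at hk
    have e1 : τ.reg 1 = n := (hr 1 (by decide)).trans hn
    obtain ⟨h15, h11⟩ := computeCut_spec e1
    have e6 : lens n τ = lens n σ := lens_congr (hc 6 (by decide))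
    have e7 : alive n τ = alive n σ := alive_congr (hc 7 (by decide))
    have e2 : weights n τ = weights n σ := by
      funext v; simp only [weights, hc 2 (by decide)]
    have e10 : rootDist n τ = rootDist n σ := by
      funext v; simp only [rootDist, hc 10 (by decide)]
    rw [e6, e7, e10, hτk] at h15 h11
    rw [e2] at h15
    set υ := computeCut.run τ with hυ
    have e14 : υ.reg 14 = τ.reg 14 := Cmd.run_reg _ _ (by decide)
    have c1 : υ.cell 1 = τ.cell 1 := Cmd.run_cell _ _ (by decide)
    have e1' : υ.reg 1 = n := (Cmd.run_reg _ _ (by decide)).trans e1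
    simp only [Cmd.run_seq, ← hυ, Cmd.run_ite_lt, Expr.eval_reg, e14, Cmd.run_skip]
    split
    next hlt =>
      obtain ⟨j14, j1⟩ := storeBest_spec e1'
      refine ⟨⟨({v | Cut (alive n σ) (lens n σ) (rootDist n σ) n k v} : Finset (Fin n)), ?_, ?_, ?_⟩,
        ?_, ?_⟩
      · simpa using hcut k hk
      · rw [Finset.sum_filter]; simpa [j14] using h15
      · intro v
        simp [j1, h11]
      · simpa [j14] using hlt.le.trans i2
      · intro θ hθ
        simp only [State.setReg_reg]
        norm_num
        rw [j14]
        rcases Nat.lt_succ_iff_lt_or_eq.1 hθ with h | rfl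
        · exact hlt.le.trans (i3 θ h)
        · exact h15.le
    next hlt =>
      refine ⟨i1.congr (by simp [e14]) (by simp [c1]), by simpa [e14] using i2, fun θ hθ => ?_⟩
      simp only [State.setReg_reg]
      norm_num
      rw [e14]
      rcases Nat.lt_succ_iff_lt_or_eq.1 hθ with h | rfl
      · exact i3 θ h
      · exact (not_lt.1 hlt).trans h15.le
  · rwa [hn] at key

/-! ### The main loop -/

/-- The rounding of shortest path distances gives a multicut. -/
theorem isMulticut_cut {n : ℕ} {G : SimpleGraph (Fin n)} (hG : G.IsChordal)
    {T : List (Fin n × Fin n)} {A A' : Set (Fin n)} {x x' : Fin n → ℕ} {α : ℕ} (hα : 0 < α)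
    (hle : ∀ p ∈ T, ∀ r l, LenWalk G A x p.2 p.1 r l → α ≤ l)
    (hx' : ∀ v, x' v = x v * n * 5 / α) (hA' : A' = {v | v ∈ A ∧ x' v < n})
    {root : Fin n → Fin n} {d : Fin n → ℕ} (hd : IsRootDist G A' x' root d) {θ : ℕ} (hθ : θ < n) :
    IsMulticut G {p | p ∈ T} {v | Cut A' x' d n θ v} := by
  rw [isMulticut_iff]
  intro p hp q
  by_contra! hq
  obtain ⟨q', hq'A, hq'⟩ := hd.exists_short_walk hG hθ (fun v hv => by rw [hA'] at hv; exact hv.2) q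
    (by simpa using hq)
  obtain ⟨P, hP⟩ : ∃ P : G.Walk p.1 p.2, P = q'.bypass := ⟨_, rfl⟩
  have hpath : P.IsPath := hP ▸ q'.bypass_isPath
  have hsub : ∀ z ∈ P.support, z ∈ q'.support := fun z hz =>
    q'.support_bypass_subset_support (hP ▸ hz)
  have h1 := hle p hp _ _ (LenWalk.of_walk P.reverse fun z hz => by
    rw [Walk.support_reverse, List.mem_reverse] at hz
    have := hq'A z (hsub z hz)
    rw [hA'] at this; exact this.1)
  rw [walkLength_reverse, walkLength_eq_sum hpath] at h1
  have h2 : ∑ v ∈ P.support.toFinset, x' v < 4 * n :=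
    lt_of_le_of_lt ((Finset.sum_le_sum_of_subset (fun v hv => by
      rw [List.mem_toFinset] at hv ⊢
      exact hsub v hv)).trans (sum_toFinset_le_walkLength q')) hq'
  have h3 : ∀ v, x v * n * 5 ≤ α * (x' v + 1) := fun v => by
    rw [hx']; exact (Nat.lt_mul_div_succ _ hα).le
  -- The rounded lengths sum to at most `4n - 1`, and rounding loses at most one unit of `α` per
  -- vertex, so at most `n` units. With `α ≤ ∑ x` on `P` this gives `5nα ≤ (5n - 1)α`, a
  -- contradiction.
  have h4 : ∑ v ∈ P.support.toFinset, x v * n * 5 ≤ α * (5 * n - 1) := by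
    refine (Finset.sum_le_sum fun v _ => h3 v).trans ?_
    rw [← Finset.mul_sum, Finset.sum_add_distrib, Finset.sum_const, smul_eq_mul, mul_one]
    have : P.support.toFinset.card ≤ n := by
      simpa using Finset.card_le_univ P.support.toFinset
    exact Nat.mul_le_mul_left _ (by omega)
  rw [← Finset.sum_mul, ← Finset.sum_mul] at h4
  have h5 : α * (5 * n) ≤ (∑ v ∈ P.support.toFinset, x v) * n * 5 := by nlinarith
  have h6 : α * (5 * n - 1) < α * (5 * n) := Nat.mul_lt_mul_of_pos_left (by omega) hα
  omega

/-- Rounds the current lengths. -/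
def roundPhase : Cmd := .seq roundLens (.seq computeInf (.seq rootDistances tryOffsets))

theorem weights_congr {n : ℕ} {σ τ : State} (h : τ.cell 2 = σ.cell 2) :
    weights n τ = weights n σ := by
  unfold weights; rw [h]

/-- Dividing by `R 8` normalizes the lengths to a fractional multicut on the alive vertices; only
`hle` is needed, so `R 8` may be any positive lower bound on the distances of the pairs. Removed
vertices have weight zero and are cut for free. -/
theorem roundPhase_spec {n : ℕ} {G : SimpleGraph (Fin n)} (hG : G.IsChordal)
    {T : List (Fin n × Fin n)} {σ : State} (hg : HasGraph G σ)
    (hbest : HasBest G {p | p ∈ T} (weights n σ) σ) (hα : 0 < σ.reg 8)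
    (hle : ∀ p ∈ T, ∀ r l, LenWalk G (alive n σ) (lens n σ) p.2 p.1 r l → σ.reg 8 ≤ l)
    (hA : ∀ v ∉ alive n σ, weights n σ v = 0) :
    HasBest G {p | p ∈ T} (weights n σ) (roundPhase.run σ) ∧
      (roundPhase.run σ).reg 14 ≤ σ.reg 14 ∧
      n * (roundPhase.run σ).reg 14 ≤
        ∑ v, weights n σ v * (lens n σ v * n * 5 / σ.reg 8) := by
  classical
  obtain ⟨hl, ha⟩ := roundLens_spec hg.1
  have hrun : roundPhase.run σ =
    tryOffsets.run (rootDistances.run (computeInf.run (roundLens.run σ))) := rfl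
  set σ₁ := roundLens.run σ with hσ₁
  set σ₂ := computeInf.run σ₁ with hσ₂
  set σ₃ := rootDistances.run σ₂ with hσ₃
  have r1 : σ₁.reg 1 = n := (Cmd.run_reg _ _ (by decide)).trans hg.1
  have r2 : σ₂.reg 1 = n := (Cmd.run_reg _ _ (by decide)).trans r1
  have r3 : σ₃.reg 1 = n := (Cmd.run_reg _ _ (by decide)).trans r2
  have l2 : lens n σ₂ = lens n σ₁ := lens_congr (Cmd.run_cell _ _ (by decide))
  have l3 : lens n σ₃ = lens n σ₁ := (lens_congr (Cmd.run_cell _ _ (by decide))).trans l2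
  have a2 : alive n σ₂ = alive n σ₁ := alive_congr (Cmd.run_cell _ _ (by decide))
  have a3 : alive n σ₃ = alive n σ₁ := (alive_congr (Cmd.run_cell _ _ (by decide))).trans a2
  have w3 : weights n σ₃ = weights n σ := (weights_congr (Cmd.run_cell _ _ (by decide))).trans
    ((weights_congr (Cmd.run_cell _ _ (by decide))).trans
      (weights_congr (Cmd.run_cell _ _ (by decide))))
  have b3 : σ₃.reg 14 = σ.reg 14 := (Cmd.run_reg _ _ (by decide)).trans
    ((Cmd.run_reg _ _ (by decide)).trans (Cmd.run_reg _ _ (by decide)))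
  have c3 : σ₃.cell 1 = σ.cell 1 := (Cmd.run_cell _ _ (by decide)).trans
    ((Cmd.run_cell _ _ (by decide)).trans (Cmd.run_cell _ _ (by decide)))
  have hg2 : HasGraph G σ₂ := hg.congr (r2.trans hg.1.symm)
    ((Cmd.run_cell _ _ (by decide)).trans (Cmd.run_cell _ _ (by decide)))
  have hinf : ∑ v, lens n σ₂ v < σ₂.reg 6 := by
    rw [l2, hσ₂, computeInf_spec r1]; exact sum_lens_lt_inf _
  obtain ⟨root, hd⟩ := rootDistances_spec hg2 hinf
  change IsRootDist G (alive n σ₂) (lens n σ₂) root (rootDist n σ₃) at hd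
  rw [a2, l2] at hd
  have key := tryOffsets_spec (G := G) (T := {p | p ∈ T}) r3
    (by rw [w3]; exact hbest.congr b3 c3) (by
      rw [a3, l3]
      exact fun θ hθ => isMulticut_cut hG hα hle hl ha hd hθ)
  rw [w3, a3, l3, b3, ← hrun] at key
  refine ⟨key.1, key.2.1, ?_⟩
  rcases Nat.eq_zero_or_pos n with rfl | hn
  · simp
  obtain ⟨θ, hθ, hwt⟩ := exists_cut_weight_le (A := alive n σ₁) (x := lens n σ₁)
    (d := rootDist n σ₃) hn (fun v => (weights n σ v : ℝ)) (fun v => Nat.cast_nonneg _)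
    (fun v hv => by
      by_cases hv' : v ∈ alive n σ
      · right
        by_contra! hlt
        exact hv (by rw [ha]; exact ⟨hv', hlt⟩)
      · left; exact_mod_cast hA v hv') (fun v hv => by
      obtain ⟨r, hr⟩ := hd.exists_walk v hv
      exact hr.le_length)
  have hwt' : n * ∑ v, (if Cut (alive n σ₁) (lens n σ₁) (rootDist n σ₃) n θ v
      then weights n σ v else 0) ≤ ∑ v, weights n σ v * lens n σ₁ v := by
    have e : ∀ v, (if Cut (alive n σ₁) (lens n σ₁) (rootDist n σ₃) n θ v
      then (weights n σ v : ℝ) else 0) = ((if Cut (alive n σ₁) (lens n σ₁) (rootDist n σ₃) n θ v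
      then weights n σ v else 0 : ℕ) : ℝ) := fun v => by split <;> simp
    simp_rw [e] at hwt
    exact_mod_cast hwt
  simp_rw [← hl]
  refine le_trans (Nat.mul_le_mul_left _ (key.2.2 θ hθ)) ?_
  convert hwt'

/-- Sends flow along a shortest path, if there is one. -/
def pushFlow : Cmd :=
  .ite ((Expr.reg 8).lt (.reg 6)) (.seq markPath (.seq findBottleneck updateLoads)) .skip

/-- The multipliers of the vertices. -/
def mults (n : ℕ) (σ : State) (v : Fin n) : ℕ := σ.cell 4 v

/-- The remainders of the vertices. -/
def rems (n : ℕ) (σ : State) (v : Fin n) : ℕ := σ.cell 5 v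

theorem Progress.mult_pos {V : Type*} [Fintype V] {w : V → ℕ} {z : V → ℝ} {i : ℕ} {y rem : V → ℕ}
    (h : Progress w z i y rem) (v : V) : 0 < y v := by
  obtain ⟨k, F, hy, -⟩ := h
  rw [hy]; positivity

theorem Progress.rem_pos {V : Type*} [Fintype V] {w : V → ℕ} {z : V → ℝ} {i : ℕ} {y rem : V → ℕ}
    (h : Progress w z i y rem) {v : V} (hv : w v ≠ 0) : 0 < rem v := by
  obtain ⟨k, F, -, -, hr, -⟩ := h
  exact hr v hv

/-- An instance of `Progress.step`: `O` is the marked path, `c` its least remainder, and `α` the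
least distance `R 8`, which bounds the length of `O`. Since `O` contains a path between terminals,
`z` sums to at least one on it. -/
theorem pushFlow_progress {n : ℕ} {G : SimpleGraph (Fin n)} {T : List (Fin n × Fin n)} {σ : State}
    (hg : HasGraph G σ) (hinf : ∑ v, lens n σ v < σ.reg 6)
    (hcp : ClosestPair G T (alive n σ) (lens n σ) (σ.reg 6) σ) (h8 : σ.reg 8 < σ.reg 6)
    (hA : ∀ v, v ∈ alive n σ ↔ weights n σ v ≠ 0) {W : ℕ} (hW : 0 < W)
    (hX : ∀ v, weights n σ v ≠ 0 → lens n σ v * weights n σ v = mults n σ v * W) {z : Fin n → ℝ}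
    (hz : IsFractional G {p | p ∈ T} z) {i : ℕ}
    (h : Progress (weights n σ) z i (mults n σ) (rems n σ))
    (hbad : 6 * (∑ v, weights n σ v * z v) * σ.reg 8 <
      W * ∑ v, (if weights n σ v = 0 then (0 : ℝ) else mults n σ v)) :
    Progress (weights n σ) z (i + 1) (mults n (pushFlow.run σ)) (rems n (pushFlow.run σ)) := by
  obtain ⟨p, hp, h9, h10, r, hr⟩ := hcp.exists_walk h8
  have hpos : ∀ v ∈ alive n σ, 0 < lens n σ v := by
    intro v hv
    have h1 := hX v ((hA v).1 hv)
    have h2 : 0 < mults n σ v * W := Nat.mul_pos (h.mult_pos v) hW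
    exact Nat.pos_of_ne_zero fun h0 => by rw [h0, zero_mul] at h1; omega
  obtain ⟨⟨q, hq⟩, hM, htM, hsum⟩ := markPath_spec hg hinf h9 h10 hpos hr
  have hrun : pushFlow.run σ = updateLoads.run (findBottleneck.run (markPath.run σ)) := by
    simp only [pushFlow, Cmd.run_ite_lt, Expr.eval_reg, Cmd.run_seq]
    exact if_pos h8
  set σ₁ := markPath.run σ with hσ₁
  set σ₂ := findBottleneck.run σ₁ with hσ₂
  have r1 : σ₁.reg 1 = n := (Cmd.run_reg _ _ (by decide)).trans hg.1
  have r2 : σ₂.reg 1 = n := (Cmd.run_reg _ _ (by decide)).trans r1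
  have m1 : mults n σ₂ = mults n σ := by
    unfold mults; rw [hσ₂, Cmd.run_cell _ _ (by decide), hσ₁, Cmd.run_cell _ _ (by decide)]
  have e51 : σ₁.cell 5 = σ.cell 5 := Cmd.run_cell _ _ (by decide)
  have e5 : σ₂.cell 5 = σ.cell 5 := (Cmd.run_cell _ _ (by decide)).trans e51
  have e4 : σ₂.cell 4 = σ.cell 4 :=
    (Cmd.run_cell _ _ (by decide)).trans (Cmd.run_cell _ _ (by decide))
  have e2 : σ₂.cell 2 = σ.cell 2 :=
    (Cmd.run_cell _ _ (by decide)).trans (Cmd.run_cell _ _ (by decide))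
  have em : marked n σ₂ = marked n σ₁ := marked_congr (Cmd.run_cell _ _ (by decide))
  obtain ⟨hb1, hb2⟩ := findBottleneck_spec r1
    ((Cmd.run_reg _ _ (by decide) : σ₁.reg 10 = σ.reg 10).trans h10) htM
  rw [← hσ₂, e51] at hb1 hb2
  have hup := updateLoads_spec r2
  rw [← hrun, em, e5, e4, e2] at hup
  have hO : ∀ v ∈ marked n σ₁, weights n σ v ≠ 0 := fun v hv => (hA v).1 (hM v hv)
  refine h.step hz.1 (O := marked n σ₁) (c := σ₂.reg 13) ?_ hW (fun v hv => ⟨hO v hv, hb1 v hv⟩)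
    hb2 ?_ hX hsum hbad (fun v => (hup v).1) (fun v => (hup v).2)
  · obtain ⟨v, hv, hvc⟩ := hb2
    rw [← hvc]; exact h.rem_pos (hO v hv)
  · refine (hz.2 p hp q.bypass q.bypass_isPath).trans
      (Finset.sum_le_sum_of_subset_of_nonneg (fun v hv => ?_) fun v _ _ => hz.1 v)
    rw [List.mem_toFinset] at hv
    exact hq v (q.support_bypass_subset_support hv)

/-- Keeps multipliers, and hence the lengths of alive vertices, positive even in rounds where
`Progress` is no longer available. -/
theorem le_mults_pushFlow {n : ℕ} {σ : State} (hn : σ.reg 1 = n) (v : Fin n) :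
    mults n σ v ≤ mults n (pushFlow.run σ) v := by
  by_cases h : σ.reg 8 < σ.reg 6
  · have hrun : pushFlow.run σ = updateLoads.run (findBottleneck.run (markPath.run σ)) := by
      simp only [pushFlow, Cmd.run_ite_lt, Expr.eval_reg, Cmd.run_seq]
      exact if_pos h
    rw [hrun]
    set σ₂ := findBottleneck.run (markPath.run σ) with hσ₂
    have h1 : σ₂.reg 1 = n := by
      rw [hσ₂, Cmd.run_reg _ _ (by decide), Cmd.run_reg _ _ (by decide), hn]
    have h4 : σ₂.cell 4 = σ.cell 4 := by
      rw [hσ₂, Cmd.run_cell _ _ (by decide), Cmd.run_cell _ _ (by decide)]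
    unfold mults
    rw [(updateLoads_spec h1 v).1, h4]
    split <;> omega
  · have hrun : pushFlow.run σ = σ := by
      simp only [pushFlow, Cmd.run_ite_lt, Expr.eval_reg, Cmd.run_skip]
      exact if_neg h
    rw [hrun]

/-- Computes the lengths from the multipliers. -/
def setLens : Cmd :=
  .for 21 1 (.seq (.store 6 (.reg 21) (.cell 4 (.reg 21) * .cell 3 (.reg 21)))
    (.ite (.cell 2 (.reg 21)) (.store 7 (.reg 21) (.const 0)) (.store 7 (.reg 21) (.const 1))))

theorem setLens_spec {n : ℕ} {σ : State} (hn : σ.reg 1 = n) :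
    (∀ v, lens n (setLens.run σ) v = mults n σ v * σ.cell 3 v) ∧
      ∀ v, v ∈ alive n (setLens.run σ) ↔ weights n σ v ≠ 0 := by
  have key := Cmd.run_for_map (i := 21) (bound := 1) (σ := σ)
    (body := .seq (.store 6 (.reg 21) (.cell 4 (.reg 21) * .cell 3 (.reg 21)))
    (.ite (.cell 2 (.reg 21)) (.store 7 (.reg 21) (.const 0)) (.store 7 (.reg 21) (.const 1))))
    (fun a v => if a = 6 then σ.cell 4 v * σ.cell 3 v else
      if a = 7 then (if σ.cell 2 v = 0 then 1 else 0) else σ.cell a v) ?_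
  swap
  · intro k hk τ hτk hr hc hτ a v
    simp only [Cmd.run_seq, Cmd.run_store, Cmd.run_ite_cell, Expr.eval_reg,
      Expr.eval_mul, Expr.eval_cell, Expr.eval_const, hτk, hτ,
      State.setCell_reg, State.setCell_cell_apply]
    by_cases h2 : σ.cell 2 k = 0 <;> by_cases h6 : a = 6 <;> by_cases h7 : a = 7 <;>
      by_cases hv : v = k <;> simp_all
  · constructor
    · intro v
      have : (v : ℕ) < σ.reg 1 := hn ▸ v.2
      exact (key 6 v).trans (by simp [this, mults])
    · intro v
      have : (v : ℕ) < σ.reg 1 := hn ▸ v.2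
      have h7 : (setLens.run σ).cell 7 v = _ := key 7 v
      simp only [alive, Set.mem_ofPred_eq, h7, this, if_true, weights]
      by_cases h : σ.cell 2 v = 0 <;> simp [h]

/-- One round: finds the shortest paths, rounds their lengths, and sends flow. -/
def iteration : Cmd :=
  .seq setLens (.seq computeInf (.seq findPair (.seq pushFlow roundPhase)))

/-- An invariant of the main loop. -/
structure Ready {n : ℕ} (G : SimpleGraph (Fin n)) (T : List (Fin n × Fin n)) (w : Fin n → ℕ)
    (W : ℕ) (σ : State) : Prop where
  graph : HasGraph G σ
  pairs : HasPairs T σ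
  weights : weights n σ = w
  best : HasBest G {p | p ∈ T} w σ
  pos : 0 < W
  quot : ∀ v : Fin n, w v ≠ 0 → σ.cell 3 v * w v = W
  mult : ∀ v : Fin n, 0 < mults n σ v

/-- Each round both rounds the lengths and sends flow if some pair is connected, so the program
never needs `z`; the alternative is decided only in the analysis, by comparing `W * ∑ y` with `6βα`.
The first alternative persists because `R 14` never increases. -/
theorem iteration_spec {n : ℕ} {G : SimpleGraph (Fin n)} (hG : G.IsChordal)
    {T : List (Fin n × Fin n)} {w : Fin n → ℕ} {W : ℕ} {σ : State} (h : Ready G T w W σ)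
    {z : Fin n → ℝ} (hz : IsFractional G {p | p ∈ T} z) {i : ℕ}
    (hp : σ.reg 14 ≤ 30 * ∑ v, w v * z v ∨ Progress w z i (mults n σ) (rems n σ)) :
    Ready G T w W (iteration.run σ) ∧ ((iteration.run σ).reg 14 ≤ 30 * ∑ v, w v * z v ∨
      Progress w z (i + 1) (mults n (iteration.run σ)) (rems n (iteration.run σ))) := by
  have hrun : iteration.run σ =
    roundPhase.run (pushFlow.run (findPair.run (computeInf.run (setLens.run σ)))) := rfl
  obtain ⟨hl, ha⟩ := setLens_spec h.graph.1
  set σ₁ := setLens.run σ with hσ₁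
  set σ₂ := computeInf.run σ₁ with hσ₂
  set σ₃ := findPair.run σ₂ with hσ₃
  set σ₄ := pushFlow.run σ₃ with hσ₄
  have g1 : HasGraph G σ₁ :=
    h.graph.congr (Cmd.run_reg _ _ (by decide)) (Cmd.run_cell _ _ (by decide))
  have g2 : HasGraph G σ₂ := g1.congr (Cmd.run_reg _ _ (by decide)) (Cmd.run_cell _ _ (by decide))
  have g3 : HasGraph G σ₃ := g2.congr (Cmd.run_reg _ _ (by decide)) (Cmd.run_cell _ _ (by decide))
  have g4 : HasGraph G σ₄ := g3.congr (Cmd.run_reg _ _ (by decide)) (Cmd.run_cell _ _ (by decide))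
  have p2 : HasPairs T σ₂ := h.pairs.congr
    ((Cmd.run_reg _ _ (by decide)).trans (Cmd.run_reg _ _ (by decide)))
    ((Cmd.run_reg _ _ (by decide)).trans (Cmd.run_reg _ _ (by decide)))
    ((Cmd.run_cell _ _ (by decide)).trans (Cmd.run_cell _ _ (by decide)))
  have l2 : lens n σ₂ = lens n σ₁ := lens_congr (Cmd.run_cell _ _ (by decide))
  have l3 : lens n σ₃ = lens n σ₁ := (lens_congr (Cmd.run_cell _ _ (by decide))).trans l2
  have l4 : lens n σ₄ = lens n σ₁ := (lens_congr (Cmd.run_cell _ _ (by decide))).trans l3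
  have a2 : alive n σ₂ = alive n σ₁ := alive_congr (Cmd.run_cell _ _ (by decide))
  have a3 : alive n σ₃ = alive n σ₁ := (alive_congr (Cmd.run_cell _ _ (by decide))).trans a2
  have a4 : alive n σ₄ = alive n σ₁ := (alive_congr (Cmd.run_cell _ _ (by decide))).trans a3
  have w3 : weights n σ₃ = w := (weights_congr ((Cmd.run_cell _ _ (by decide)).trans
    ((Cmd.run_cell _ _ (by decide)).trans (Cmd.run_cell _ _ (by decide))))).trans h.weights
  have w4 : weights n σ₄ = w := (weights_congr (Cmd.run_cell _ _ (by decide))).trans w3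
  have y3 : mults n σ₃ = mults n σ := by
    unfold mults
    rw [hσ₃, Cmd.run_cell _ _ (by decide), hσ₂, Cmd.run_cell _ _ (by decide), hσ₁,
      Cmd.run_cell _ _ (by decide)]
  have rem3 : rems n σ₃ = rems n σ := by
    unfold rems
    rw [hσ₃, Cmd.run_cell _ _ (by decide), hσ₂, Cmd.run_cell _ _ (by decide), hσ₁,
      Cmd.run_cell _ _ (by decide)]
  have y5 : mults n (iteration.run σ) = mults n σ₄ := by
    unfold mults; rw [hrun, Cmd.run_cell _ _ (by decide)]
  have rem5 : rems n (iteration.run σ) = rems n σ₄ := by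
    unfold rems; rw [hrun, Cmd.run_cell _ _ (by decide)]
  have i2 : σ₂.reg 6 = (∑ v, lens n σ₁ v) * n * 5 + 1 := computeInf_spec g1.1
  have i3 : σ₃.reg 6 = σ₂.reg 6 := Cmd.run_reg _ _ (by decide)
  have e84 : σ₄.reg 8 = σ₃.reg 8 := Cmd.run_reg _ _ (by decide)
  have b4 : σ₄.reg 14 = σ.reg 14 := by
    rw [hσ₄, Cmd.run_reg _ _ (by decide), hσ₃, Cmd.run_reg _ _ (by decide), hσ₂,
      Cmd.run_reg _ _ (by decide), hσ₁, Cmd.run_reg _ _ (by decide)]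
  have c4 : σ₄.cell 1 = σ.cell 1 := by
    rw [hσ₄, Cmd.run_cell _ _ (by decide), hσ₃, Cmd.run_cell _ _ (by decide), hσ₂,
      Cmd.run_cell _ _ (by decide), hσ₁, Cmd.run_cell _ _ (by decide)]
  have hinf : ∑ v, lens n σ₂ v < σ₂.reg 6 := by rw [l2, i2]; exact sum_lens_lt_inf _
  have hcp := findPair_spec g2 p2 hinf
  rw [← hσ₃, ← i3, l2, a2] at hcp
  have hw1 : Multicut.weights n σ = w := h.weights
  rw [hw1] at ha
  have hX : ∀ v, w v ≠ 0 → lens n σ₁ v * w v = mults n σ v * W := fun v hv => by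
    rw [hl, mul_assoc, h.quot v hv]
  -- A finite least distance includes the positive length of a terminal; the infinite one is at
  -- least `1` by the final summand of `computeInf`.
  have hα : 0 < σ₃.reg 8 := by
    rcases hcp.le_inf.lt_or_eq with hlt | heq
    · obtain ⟨p, -, -, -, r, hr⟩ := hcp.exists_walk hlt
      refine lt_of_lt_of_le ?_ hr.le_length
      rw [hl]
      have h1 := h.quot p.1 ((ha _).1 hr.mem_right)
      exact Nat.mul_pos (h.mult _) (Nat.pos_of_ne_zero fun h0 => by
        rw [h0, zero_mul] at h1; exact h.pos.ne h1)
    · rw [heq, i3, i2]; omega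
  have hround := roundPhase_spec hG (T := T) g4 (by rw [w4]; exact h.best.congr b4 c4)
    (by rw [e84]; exact hα) (by rw [e84, a4, l4]; exact hcp.le)
    (by rw [a4, w4]; exact fun v hv => by simpa using mt (ha v).2 hv)
  rw [← hrun, w4, b4, l4, e84] at hround
  obtain ⟨j1, j2, j3⟩ := hround
  have hready : Ready G T w W (iteration.run σ) := by
    refine ⟨h.graph.congr (Cmd.run_reg _ _ (by decide)) (Cmd.run_cell _ _ (by decide)),
      h.pairs.congr (Cmd.run_reg _ _ (by decide)) (Cmd.run_reg _ _ (by decide))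
        (Cmd.run_cell _ _ (by decide)), (weights_congr (Cmd.run_cell _ _ (by decide))).trans
        h.weights, j1, h.pos, ?_, fun v => ?_⟩
    · rw [Cmd.run_cell _ _ (by decide)]; exact h.quot
    · rw [y5]
      refine (h.mult v).trans_le ?_
      rw [← y3]
      exact le_mults_pushFlow g3.1 v
  refine ⟨hready, ?_⟩
  have hβ : (0 : ℝ) ≤ ∑ v, w v * z v :=
    Finset.sum_nonneg fun v _ => mul_nonneg (Nat.cast_nonneg _) (hz.1 v)
  have j2' : ((iteration.run σ).reg 14 : ℝ) ≤ σ.reg 14 := by exact_mod_cast j2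
  rcases hp with hp | hp
  · exact Or.inl (j2'.trans hp)
  rcases Nat.eq_zero_or_pos n with rfl | hn
  · obtain ⟨S, -, hS, -⟩ := j1
    left
    rw [hS, Finset.eq_empty_of_isEmpty S]
    simp
  rcases hcp.le_inf.lt_or_eq with hlt | heq
  · by_cases hbad : 6 * (∑ v, w v * z v) * σ₃.reg 8 <
      W * ∑ v, (if w v = 0 then (0 : ℝ) else mults n σ v)
    · right
      have key := pushFlow_progress g3 (by rw [l3, i3, ← l2]; exact hinf)
        (by rw [l3, a3]; exact hcp) hlt (by rw [a3, w3]; exact ha) h.pos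
        (by rw [l3, w3, y3]; exact hX) hz (by rw [w3, y3, rem3]; exact hp)
        (by rw [w3, y3]; exact hbad)
      rw [y5, rem5]
      rwa [w3] at key
    · left
      rw [not_lt] at hbad
      -- Dropping the floor and using `x v * w v = y v * W` gives `α * R 14 ≤ 5 W ∑ y`, which is at
      -- most `30 β α` when `hbad` fails.
      have k1 : ∀ v, σ₃.reg 8 * (w v * (lens n σ₁ v * n * 5 / σ₃.reg 8)) ≤
          5 * n * (W * if w v = 0 then 0 else mults n σ v) := by
        intro v
        have h1 := Nat.mul_le_mul_left (w v) (Nat.mul_div_le (lens n σ₁ v * n * 5) (σ₃.reg 8))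
        by_cases hv : w v = 0
        · simp [hv]
        · rw [if_neg hv]
          have := hX v hv
          calc _ = w v * (σ₃.reg 8 * (lens n σ₁ v * n * 5 / σ₃.reg 8)) := by ring
            _ ≤ w v * (lens n σ₁ v * n * 5) := h1
            _ = 5 * n * (lens n σ₁ v * w v) := by ring
            _ = _ := by rw [this]; ring
      have k2 : n * (σ₃.reg 8 * (iteration.run σ).reg 14) ≤
          n * (5 * (W * ∑ v, if w v = 0 then 0 else mults n σ v)) := by
        calc _ = σ₃.reg 8 * (n * (iteration.run σ).reg 14) := by ring
          _ ≤ _ := Nat.mul_le_mul_left _ j3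
          _ ≤ ∑ v, 5 * n * (W * if w v = 0 then 0 else mults n σ v) := by
            rw [Finset.mul_sum]; exact Finset.sum_le_sum fun v _ => k1 v
          _ = _ := by rw [← Finset.mul_sum, ← Finset.mul_sum]; ring
      have k3 : (σ₃.reg 8 : ℝ) * (iteration.run σ).reg 14 ≤
          5 * (W * ∑ v, if w v = 0 then (0 : ℝ) else mults n σ v) := by
        have := Nat.le_of_mul_le_mul_left k2 hn
        have e : ∀ v, (if w v = 0 then (0 : ℝ) else mults n σ v) =
          ((if w v = 0 then 0 else mults n σ v : ℕ) : ℝ) := fun v => by split <;> simp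
        simp_rw [e]
        exact_mod_cast this
      have hα' : (0 : ℝ) < σ₃.reg 8 := by exact_mod_cast hα
      refine le_of_mul_le_mul_left ?_ hα'
      linarith
  · left
    -- No pair is connected. Infinity carries the factor `n * 5` so that all rounded lengths vanish
    -- here; the rounding then finds a multicut of weight zero.
    have k1 : ∀ v, lens n σ₁ v * n * 5 / σ₃.reg 8 = 0 := by
      intro v
      refine Nat.div_eq_of_lt ?_
      rw [heq, i3, i2]
      have : lens n σ₁ v ≤ ∑ v, lens n σ₁ v :=
        Finset.single_le_sum (f := lens n σ₁) (fun _ _ => Nat.zero_le _) (Finset.mem_univ v)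
      have := Nat.mul_le_mul_right 5 (Nat.mul_le_mul_right n this)
      omega
    simp only [k1, mul_zero, Finset.sum_const_zero, nonpos_iff_eq_zero, mul_eq_zero, hn.ne',
      false_or] at j3
    rw [j3, Nat.cast_zero]
    exact mul_nonneg (by norm_num) hβ

/-- The number of rounds suffices. -/
theorem mainLoop_spec {n : ℕ} {G : SimpleGraph (Fin n)} (hG : G.IsChordal)
    {T : List (Fin n × Fin n)} {w : Fin n → ℕ} {W : ℕ} {σ : State} (h : Ready G T w W σ)
    (h3 : σ.reg 3 = n * n * 4 + 1) (hy : ∀ v, mults n σ v = 1) (hr : ∀ v, rems n σ v = w v)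
    {z : Fin n → ℝ} (hz : IsFractional G {p | p ∈ T} z) :
    Ready G T w W ((Cmd.for 17 3 iteration).run σ) ∧
      ((Cmd.for 17 3 iteration).run σ).reg 14 ≤ 30 * ∑ v, w v * z v := by
  have hcongr : ∀ (τ : State) k, Ready G T w W τ → Ready G T w W (τ.setReg 17 k) := fun τ k h =>
    ⟨h.graph.congr (by simp) (by simp), h.pairs.congr (by simp) (by simp) (by simp),
      (weights_congr (by simp)).trans h.weights, h.best.congr (by simp) (by simp), h.pos, h.quot,
      h.mult⟩
  have key := Cmd.run_for_induction (i := 17) (bound := 3) (σ := σ) (body := iteration)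
    (fun k τ => Ready G T w W τ ∧ (τ.reg 14 ≤ 30 * ∑ v, w v * z v ∨
      Progress w z k (mults n τ) (rems n τ)))
    ⟨hcongr _ _ h, Or.inr (by
      have e1 : mults n (σ.setReg 17 0) = fun _ => 1 := funext hy
      have e2 : rems n (σ.setReg 17 0) = w := funext hr
      rw [e1, e2]
      exact Progress.init)⟩
  specialize key ?_
  · rintro k - τ - - - ⟨i1, i2⟩
    obtain ⟨h1, h2⟩ := iteration_spec hG i1 hz i2
    generalize iteration.run τ = ω at h1 h2 ⊢
    have h14 : (ω.setReg 17 (k + 1)).reg 14 = ω.reg 14 := by simp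
    refine ⟨hcongr _ _ h1, ?_⟩
    rw [h14]
    exact h2
  -- If no round were good, `Progress` would survive all `4n² + 1` rounds, against `Progress.lt`.
  · refine ⟨key.1, key.2.resolve_right fun hp => ?_⟩
    have := hp.lt hz.1
    rw [h3, Fintype.card_fin] at this
    have e : 4 * n * n = n * n * 4 := by ring
    omega

end Multicut

namespace RAM.Cmd

/-! ### Composition of programs of polynomial running time -/

/-- The program has polynomial running time on memories that satisfy a size bound `Φ`. -/
def PolyTime (c : Cmd) (Φ : ℕ → State → Prop) : Prop :=
  (∀ σ M N, M ≤ N → Φ M σ → Φ N σ) ∧ ∃ q g : Polynomial ℕ, ∀ N σ, Φ N σ → σ.Bounded N →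
    ∃ t, Exec c.compile σ (c.run σ) t ∧ t ≤ q.eval N ∧ (c.run σ).Bounded (g.eval N)

theorem PolyTime.of_tame {c : Cmd} {Ls Fr Fa : List ℕ} (hc : c.tame Ls Fr Fa) :
    c.PolyTime fun N σ => ∀ i ∈ Ls, σ.reg i ≤ N := by
  refine ⟨fun σ M N h hM i hi => (hM i hi).trans h,
    c.steps * (Polynomial.X + c.steps * (Polynomial.X + 1) + 1),
    Polynomial.X + c.steps * (Polynomial.X + 1), fun N σ hσ hN => ?_⟩
  have := exec hc (Nat.size_le.2 N.lt_two_pow_self) hσ hN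
  simpa using this

/-- The second program runs with the parameter `N + g(N)`, which bounds the memory left by the first
and, by monotonicity of `Ψ`, still its own loop bounds. Polynomials are closed under this
substitution. -/
theorem PolyTime.seq {c d : Cmd} {Φ Ψ : ℕ → State → Prop} (hc : c.PolyTime Φ) (hd : d.PolyTime Ψ) :
    (seq c d).PolyTime fun N σ => Φ N σ ∧ Ψ N (c.run σ) := by
  obtain ⟨hΦ, q, g, h⟩ := hc
  obtain ⟨hΨ, q', g', h'⟩ := hd
  refine ⟨fun σ M N hMN hM => ⟨hΦ _ _ _ hMN hM.1, hΨ _ _ _ hMN hM.2⟩,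
    q + q'.comp (Polynomial.X + g) + 1, g'.comp (Polynomial.X + g), fun N σ hσ hN => ?_⟩
  obtain ⟨t, ht, htq, hb⟩ := h N σ hσ.1 hN
  obtain ⟨u, hu, huq, hb'⟩ := h' (N + g.eval N) (c.run σ) (hΨ _ _ _ (Nat.le_add_right _ _) hσ.2)
    (hb.mono (Nat.le_add_left _ _))
  refine ⟨_, Exec.seq ht hu, ?_, ?_⟩ <;>
    simp only [Polynomial.eval_add, Polynomial.eval_comp, Polynomial.eval_X, Polynomial.eval_one]
  · omega
  · exact hb'

end RAM.Cmd

namespace Multicut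

open RAM SimpleGraph

/-! ### The program

Registers: `R 3` number of rounds, `R 4` common denominator, `R 5` product of the weights,
`R 17` round. Arrays: `A 3` quotients of the product of the weights by the weights. -/

/-- Reads the number of vertices. -/
def readSize : Cmd := .set 1 (.cell 0 (.const 0))

/-- Reads the number of pairs, and computes the number of rounds. -/
def readCounts : Cmd :=
  .seq (.set 2 (.cell 0 (.const 1 + .reg 1 * .reg 1 + .reg 1 * .const 2)))
    (.set 3 (.reg 1 * .reg 1 * .const 4 + .const 1))

/-- The denominator of the weight of the vertex `R 21`. -/
def denExpr : Expr := .cell 0 (.const 2 + .reg 1 * .reg 1 + .reg 21 * .const 2)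

/-- The numerator of the weight of the vertex `R 21`. -/
def numExpr : Expr := .cell 0 (.const 1 + .reg 1 * .reg 1 + .reg 21 * .const 2)

/-- Scales the weights to integers. -/
def scaleWeights : Cmd :=
  .seq (.set 4 (.const 1)) (.seq (.for 21 1 (.set 4 (.reg 4 * denExpr)))
    (.for 21 1 (.store 2 (.reg 21) (.reg 4 / denExpr * numExpr))))

/-- Computes the product of the nonzero weights, and its quotients by the weights. -/
def computeQuotients : Cmd :=
  .seq (.set 5 (.const 1)) (.seq
    (.for 21 1 (.ite (.cell 2 (.reg 21)) (.set 5 (.reg 5 * .cell 2 (.reg 21))) .skip))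
    (.for 21 1 (.store 3 (.reg 21) (.reg 5 / .cell 2 (.reg 21)))))

/-- Initial multipliers, remainders, and multicut. -/
def initLoop : Cmd :=
  .seq (.set 14 (.const 0)) (.for 21 1 (.seq (.store 4 (.reg 21) (.const 1))
    (.seq (.store 5 (.reg 21) (.cell 2 (.reg 21)))
    (.seq (.store 1 (.const 2 + .reg 21) (.const 1)) (.set 14 (.reg 14 + .cell 2 (.reg 21)))))))

/-- Writes the length of the output, and the value of the solution. -/
def writeValue : Cmd :=
  .seq (.set 0 (.reg 1 + .const 2)) (.seq (.store 1 (.const 0) (.reg 14))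
    (.store 1 (.const 1) (.reg 4)))

/-- The approximation algorithm for weighted multicut on chordal graphs. -/
def solve : Cmd :=
  .seq readSize (.seq readCounts (.seq scaleWeights (.seq computeQuotients
    (.seq initLoop (.seq (.for 17 3 iteration) writeValue)))))

/-- No single choice of frozen memory serves the whole program: the factors of each phase may be
written by an earlier one. Scaling multiplies by input entries (`A 0`), the product of weights by
the scaled weights (`A 2`), and the main loop by the quotients (`A 3`) and `n`. -/
theorem polyTime_solve : solve.PolyTime fun N σ => (∀ i ∈ ([] : List ℕ), σ.reg i ≤ N) ∧
    (∀ i ∈ ([] : List ℕ), (readSize.run σ).reg i ≤ N) ∧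
    (∀ i ∈ [1], (readCounts.run (readSize.run σ)).reg i ≤ N) ∧
    (∀ i ∈ [1], (scaleWeights.run (readCounts.run (readSize.run σ))).reg i ≤ N) ∧
    (∀ i ∈ [1, 2, 3], (computeQuotients.run
      (scaleWeights.run (readCounts.run (readSize.run σ)))).reg i ≤ N) :=
  (Cmd.PolyTime.of_tame (Ls := []) (Fr := []) (Fa := []) (by decide)).seq
    ((Cmd.PolyTime.of_tame (Ls := []) (Fr := [1]) (Fa := []) (by decide)).seq
    ((Cmd.PolyTime.of_tame (Ls := [1]) (Fr := [1]) (Fa := [0]) (by decide)).seq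
    ((Cmd.PolyTime.of_tame (Ls := [1]) (Fr := []) (Fa := [2]) (by decide)).seq
    (Cmd.PolyTime.of_tame (Ls := [1, 2, 3]) (Fr := [1]) (Fa := [3]) (by decide)))))

theorem run_for_prod {bound r : ℕ} {σ : State} {body : Cmd} (f : ℕ → ℕ)
    (h : ∀ k < σ.reg bound, ∀ τ : State, τ.reg 21 = k →
      (∀ j ∉ (Cmd.for 21 bound body).writesReg, τ.reg j = σ.reg j) →
      (∀ a ∉ (Cmd.for 21 bound body).writesCell, τ.cell a = σ.cell a) →
      (body.run τ).reg r = τ.reg r * f k) (hr : r ≠ 21) (hσ : σ.reg r = 1) :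
    ((Cmd.for 21 bound body).run σ).reg r = ∏ v : Fin (σ.reg bound), f v := by
  have key := Cmd.run_for_induction (i := 21) (bound := bound) (σ := σ) (body := body)
    (fun k τ => τ.reg r = ∏ v ∈ Finset.range k, f v) (by simp [hr, hσ])
  specialize key ?_
  · intro k hk τ hτk hr' hc ih
    rw [State.setReg_reg, if_neg hr, h k hk τ hτk hr' hc, ih, Finset.prod_range_succ]
  · rw [key, Finset.prod_range]

theorem scaleWeights_spec {n : ℕ} {σ : State} (hn : σ.reg 1 = n) {num den : Fin n → ℕ}
    (hnum : ∀ v : Fin n, σ.cell 0 (1 + n * n + v * 2) = num v)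
    (hden : ∀ v : Fin n, σ.cell 0 (2 + n * n + v * 2) = den v) :
    (scaleWeights.run σ).reg 4 = ∏ v, den v ∧
      ∀ v, weights n (scaleWeights.run σ) v = (∏ v, den v) / den v * num v := by
  have hrun : scaleWeights.run σ = (Cmd.for 21 1 (.store 2 (.reg 21)
      (.reg 4 / denExpr * numExpr))).run ((Cmd.for 21 1 (.set 4 (.reg 4 * denExpr))).run
        (σ.setReg 4 1)) := rfl
  set υ := σ.setReg 4 1 with hυ
  have h1 : υ.reg 1 = n := by simp [hυ, hn]
  have hprod := run_for_prod (bound := 1) (r := 4) (σ := υ) (body := .set 4 (.reg 4 * denExpr))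
    (fun k => σ.cell 0 (2 + n * n + k * 2)) (fun k _ τ hτk hr hc => by
      have e1 : τ.reg 1 = n := (hr 1 (by decide)).trans h1
      have e0 : τ.cell 0 = σ.cell 0 := hc 0 (by decide)
      simp [denExpr, e1, e0, hτk]) (by decide) (by simp [hυ])
  rw [h1] at hprod
  simp only [hden] at hprod
  set ω := (Cmd.for 21 1 (.set 4 (.reg 4 * denExpr))).run υ with hω
  have h1' : ω.reg 1 = n := (Cmd.run_reg _ _ (by decide)).trans h1
  have h0' : ω.cell 0 = σ.cell 0 := Cmd.run_cell _ _ (by decide)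
  have key := Cmd.run_for_map (i := 21) (bound := 1) (σ := ω)
    (body := .store 2 (.reg 21) (.reg 4 / denExpr * numExpr))
    (fun a v => if a = 2 then (∏ v, den v) / σ.cell 0 (2 + n * n + v * 2) *
      σ.cell 0 (1 + n * n + v * 2) else ω.cell a v) ?_
  swap
  · intro k hk τ hτk hr hc hτ a v
    have e1 : τ.reg 1 = n := (hr 1 (by decide)).trans h1'
    have e4 : τ.reg 4 = _ := (hr 4 (by decide)).trans hprod
    have e0 : τ.cell 0 = σ.cell 0 := (hc 0 (by decide)).trans h0'
    by_cases h2 : a = 2 <;> by_cases hv : v = k <;>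
      simp [denExpr, numExpr, e1, e4, e0, hτk, h2, hv, hτ]
  · rw [hrun]
    refine ⟨(Cmd.run_reg _ _ (by decide)).trans hprod, fun v => (key 2 v).trans ?_⟩
    simp [h1', hden, hnum]

/-- `W` is the product of the nonzero weights, so each of them divides it and the lengths `y v * (W
/ w v)` are exact integers proportional to `y v / w v`. -/
theorem computeQuotients_spec {n : ℕ} {σ : State} (hn : σ.reg 1 = n) :
    ∃ W, 0 < W ∧ ∀ v, weights n σ v ≠ 0 →
      (computeQuotients.run σ).cell 3 v * weights n σ v = W := by
  have hrun : computeQuotients.run σ = (Cmd.for 21 1 (.store 3 (.reg 21)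
      (.reg 5 / .cell 2 (.reg 21)))).run ((Cmd.for 21 1 (.ite (.cell 2 (.reg 21))
        (.set 5 (.reg 5 * .cell 2 (.reg 21))) .skip)).run (σ.setReg 5 1)) := rfl
  set υ := σ.setReg 5 1 with hυ
  have h1 : υ.reg 1 = n := by simp [hυ, hn]
  have hprod := run_for_prod (bound := 1) (r := 5) (σ := υ)
    (body := .ite (.cell 2 (.reg 21)) (.set 5 (.reg 5 * .cell 2 (.reg 21))) .skip)
    (fun k => if σ.cell 2 k = 0 then 1 else σ.cell 2 k) (fun k _ τ hτk hr hc => by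
      have e2 : τ.cell 2 = σ.cell 2 := hc 2 (by decide)
      by_cases h : σ.cell 2 k = 0 <;> simp [Cmd.run_ite_cell, e2, hτk, h]) (by decide) (by simp [hυ])
  rw [h1] at hprod
  set ω := (Cmd.for 21 1 (.ite (.cell 2 (.reg 21)) (.set 5 (.reg 5 * .cell 2 (.reg 21)))
    .skip)).run υ with hω
  have h1' : ω.reg 1 = n := (Cmd.run_reg _ _ (by decide)).trans h1
  have h2' : ω.cell 2 = σ.cell 2 := Cmd.run_cell _ _ (by decide)
  have key := Cmd.run_for_map (i := 21) (bound := 1) (σ := ω)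
    (body := .store 3 (.reg 21) (.reg 5 / .cell 2 (.reg 21)))
    (fun a v => if a = 3 then ω.reg 5 / σ.cell 2 v else ω.cell a v) ?_
  swap
  · intro k hk τ hτk hr hc hτ a v
    have e5 : τ.reg 5 = ω.reg 5 := hr 5 (by decide)
    by_cases h3 : a = 3 <;> by_cases hv : v = k <;> simp [e5, h2', hτk, h3, hv, hτ]
  · refine ⟨ω.reg 5, ?_, fun v hv => ?_⟩
    · rw [hprod]
      refine Finset.prod_pos fun v _ => ?_
      split <;> omega
    · rw [hrun, key 3 v, h1', if_pos v.2, if_pos rfl]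
      refine Nat.div_mul_cancel ?_
      rw [hprod]
      refine dvd_trans ?_ (Finset.dvd_prod_of_mem _ (Finset.mem_univ v))
      rw [if_neg (show σ.cell 2 v ≠ 0 from hv)]

/-- The initial solution is the set of all vertices, a multicut because terminals may be removed. -/
theorem initLoop_spec {n : ℕ} {G : SimpleGraph (Fin n)} {T : Set (Fin n × Fin n)} {σ : State}
    (hn : σ.reg 1 = n) : (∀ v, mults n (initLoop.run σ) v = 1) ∧
      (∀ v, rems n (initLoop.run σ) v = weights n σ v) ∧
      HasBest G T (weights n σ) (initLoop.run σ) := by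
  have hrun : initLoop.run σ = (Cmd.for 21 1 (.seq (.store 4 (.reg 21) (.const 1))
    (.seq (.store 5 (.reg 21) (.cell 2 (.reg 21)))
    (.seq (.store 1 (.const 2 + .reg 21) (.const 1))
      (.set 14 (.reg 14 + .cell 2 (.reg 21))))))).run (σ.setReg 14 0) := rfl
  set υ := σ.setReg 14 0 with hυ
  have h1 : υ.reg 1 = n := by simp [hυ, hn]
  have key := Cmd.run_for_induction (i := 21) (bound := 1) (σ := υ)
    (body := .seq (.store 4 (.reg 21) (.const 1))
    (.seq (.store 5 (.reg 21) (.cell 2 (.reg 21)))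
    (.seq (.store 1 (.const 2 + .reg 21) (.const 1)) (.set 14 (.reg 14 + .cell 2 (.reg 21))))))
    (fun k τ => (∀ v < k, τ.cell 4 v = 1 ∧ τ.cell 5 v = σ.cell 2 v ∧ τ.cell 1 (2 + v) = 1) ∧
      τ.reg 14 = ∑ v ∈ Finset.range k, σ.cell 2 v) ⟨by simp, by simp [hυ]⟩
  specialize key ?_
  · rintro k hk τ hτk hr hc ⟨i1, i2⟩
    have e2 : τ.cell 2 = σ.cell 2 := hc 2 (by decide)
    refine ⟨fun v hv => ?_, ?_⟩
    · by_cases hvk : v = k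
      · simp [Cmd.run_seq, hτk, hvk, e2]
      · simpa [Cmd.run_seq, hτk, hvk, e2] using i1 v (by omega)
    · simp [Cmd.run_seq, hτk, e2, i2, Finset.sum_range_succ]
  · rw [h1, ← hrun] at key
    refine ⟨fun v => (key.1 v v.2).1, fun v => (key.1 v v.2).2.1, Finset.univ,
      fun p _ hs => by simp at hs, ?_, fun v => by simpa using (key.1 v v.2).2.2⟩
    rw [key.2, Finset.sum_range]; rfl

/-! ### The input in memory -/

/-- Row-major addressing; it serves the adjacency matrix with `m = n`, and weights and pairs with `m
= 2`. -/
theorem getElem?_flatMap_of_length {α β : Type*} {f : α → List β} {m : ℕ} :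
    ∀ {L : List α}, (∀ a ∈ L, (f a).length = m) → ∀ {j v : ℕ} (hj : j < L.length), v < m →
      (L.flatMap f)[j * m + v]? = (f L[j])[v]?
  | [], _, _, _, hj, _ => absurd hj (Nat.not_lt_zero _)
  | a :: L, h, 0, v, _, hv => by
      have ha : (f a).length = m := h a List.mem_cons_self
      rw [List.flatMap_cons, List.getElem?_append_left (by omega)]
      simp
  | a :: L, h, j + 1, v, hj, hv => by
      have ha : (f a).length = m := h a List.mem_cons_self
      have e : (j + 1) * m + v = m + (j * m + v) := by ring
      rw [List.flatMap_cons, List.getElem?_append_right (by rw [e]; omega), ha, e,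
        Nat.add_sub_cancel_left,
        getElem?_flatMap_of_length (fun b hb => h b (List.mem_cons_of_mem _ hb))
          (Nat.lt_of_succ_lt_succ hj) hv]
      simp

theorem length_flatMap_of_length {α β : Type*} {f : α → List β} {m : ℕ} {L : List α}
    (h : ∀ a ∈ L, (f a).length = m) : (L.flatMap f).length = L.length * m := by
  rw [List.length_flatMap, List.map_congr_left h]
  simp

namespace Instance

variable (I : Instance)

open Classical in
/-- The rows of the adjacency matrix. -/
noncomputable def matrixCode : List ℕ := (List.finRange I.n).flatMap fun u =>
  (List.finRange I.n).map fun v => if I.graph.Adj u v then 1 else 0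

/-- The numerators and denominators of the weights. -/
def weightCode : List ℕ := (List.finRange I.n).flatMap fun v => [(I.weight v).num, (I.weight v).den]

/-- The vertices of the pairs. -/
def pairCode : List ℕ := I.pairs.flatMap fun p => [(p.1 : ℕ), (p.2 : ℕ)]

theorem encode_eq : I.encode =
    I.n :: (I.matrixCode ++ (I.weightCode ++ I.pairs.length :: I.pairCode)) := by
  simp only [encode, matrixCode, weightCode, pairCode, List.cons_append, List.append_assoc]

theorem length_matrixCode : I.matrixCode.length = I.n * I.n := by
  rw [matrixCode, length_flatMap_of_length (m := I.n) (by simp), List.length_finRange]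

theorem length_weightCode : I.weightCode.length = I.n * 2 := by
  rw [weightCode, length_flatMap_of_length (m := 2) (by simp), List.length_finRange]

theorem length_pairCode : I.pairCode.length = I.pairs.length * 2 :=
  length_flatMap_of_length (by simp)

theorem length_encode :
    I.encode.length = 2 + I.n * I.n + I.n * 2 + I.pairs.length * 2 := by
  rw [encode_eq]
  simp only [List.length_cons, List.length_append, length_matrixCode, length_weightCode,
    length_pairCode]
  omega

open Classical in
theorem getD_encode_adj (u v : Fin I.n) :
    I.encode.getD (1 + u * I.n + v) 0 = if I.graph.Adj u v then 1 else 0 := by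
  have h : (u : ℕ) * I.n + v < I.matrixCode.length := by
    rw [length_matrixCode]
    calc (u : ℕ) * I.n + v < u * I.n + I.n := by omega
      _ = (u + 1) * I.n := by ring
      _ ≤ _ := Nat.mul_le_mul_right _ u.2
  rw [encode_eq, List.getD_eq_getElem?_getD, show 1 + (u : ℕ) * I.n + v = u * I.n + v + 1 by ring,
    List.getElem?_cons_succ, List.getElem?_append_left h, matrixCode,
    getElem?_flatMap_of_length (by simp) (by simp) v.2]
  simp

theorem getElem?_encode_weight {i : ℕ} (hi : i < I.n * 2) :
    I.encode[1 + I.n * I.n + i]? = I.weightCode[i]? := by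
  rw [encode_eq, show 1 + I.n * I.n + i = I.n * I.n + i + 1 by ring, List.getElem?_cons_succ,
    ← length_matrixCode, List.getElem?_append_right (Nat.le_add_right _ _), Nat.add_sub_cancel_left,
    List.getElem?_append_left (by rwa [length_weightCode])]

theorem getD_encode_num (v : Fin I.n) :
    I.encode.getD (1 + I.n * I.n + v * 2) 0 = (I.weight v).num := by
  rw [List.getD_eq_getElem?_getD, getElem?_encode_weight _ (by omega), weightCode,
    ← Nat.add_zero ((v : ℕ) * 2), getElem?_flatMap_of_length (by simp) (by simp) (by omega)]
  simp

theorem getD_encode_den (v : Fin I.n) :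
    I.encode.getD (2 + I.n * I.n + v * 2) 0 = (I.weight v).den := by
  rw [List.getD_eq_getElem?_getD,
    show 2 + I.n * I.n + (v : ℕ) * 2 = 1 + I.n * I.n + ((v : ℕ) * 2 + 1) by ring,
    getElem?_encode_weight _ (by omega), weightCode,
    getElem?_flatMap_of_length (by simp) (by simp) (by omega)]
  simp

theorem getElem?_encode_pairs (i : ℕ) :
    I.encode[1 + I.n * I.n + I.n * 2 + i]? = (I.pairs.length :: I.pairCode)[i]? := by
  rw [encode_eq, show 1 + I.n * I.n + I.n * 2 + i = I.n * I.n + (I.n * 2 + i) + 1 by ring,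
    List.getElem?_cons_succ, ← length_matrixCode, List.getElem?_append_right (Nat.le_add_right _ _),
    Nat.add_sub_cancel_left, ← length_weightCode,
    List.getElem?_append_right (Nat.le_add_right _ _), Nat.add_sub_cancel_left]

theorem getD_encode_length :
    I.encode.getD (1 + I.n * I.n + I.n * 2) 0 = I.pairs.length := by
  have := I.getElem?_encode_pairs 0
  rw [Nat.add_zero] at this
  rw [List.getD_eq_getElem?_getD, this]
  simp

theorem getD_encode_pair {j : ℕ} (hj : j < I.pairs.length) :
    I.encode.getD (2 + I.n * I.n + I.n * 2 + j * 2) 0 = (I.pairs[j]).1 ∧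
      I.encode.getD (3 + I.n * I.n + I.n * 2 + j * 2) 0 = (I.pairs[j]).2 := by
  constructor
  · rw [List.getD_eq_getElem?_getD,
      show 2 + I.n * I.n + I.n * 2 + j * 2 = 1 + I.n * I.n + I.n * 2 + (j * 2 + 1) by ring,
      getElem?_encode_pairs, List.getElem?_cons_succ, pairCode, ← Nat.add_zero (j * 2),
      getElem?_flatMap_of_length (by simp) hj (by omega)]
    simp
  · rw [List.getD_eq_getElem?_getD,
      show 3 + I.n * I.n + I.n * 2 + j * 2 = 1 + I.n * I.n + I.n * 2 + (j * 2 + 1 + 1) by ring,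
      getElem?_encode_pairs, List.getElem?_cons_succ, pairCode,
      getElem?_flatMap_of_length (by simp) hj (by omega)]
    simp

end Instance

theorem length_le_bitSize (l : List ℕ) : l.length ≤ bitSize l := by
  induction l with
  | nil => simp
  | cons a l ih => simp only [bitSize, List.map_cons, List.sum_cons, List.length_cons] at *; omega

theorem size_le_bitSize {l : List ℕ} {k : ℕ} (hk : k ∈ l) : k.size ≤ bitSize l := by
  have := List.single_le_sum (l := l.map fun k => k.size + 1) (by simp) (k.size + 1)
    (List.mem_map.2 ⟨k, hk, rfl⟩)
  exact (Nat.le_succ _).trans this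

theorem bounded_init (l : List ℕ) : (State.init l).Bounded (bitSize l) := by
  refine ⟨fun i => ?_, fun a j => ?_⟩
  · simp only [State.init]
    split
    · exact (Nat.size_le.2 l.length.lt_two_pow_self).trans (length_le_bitSize l)
    · simp
  · simp only [State.init]
    split
    · rw [List.getD_eq_getElem?_getD]
      rcases h : l[j]? with _ | k
      · simp
      · exact size_le_bitSize (List.mem_of_getElem? h)
    · simp

/-! ### Correctness and running time -/

namespace Instance

variable (I : Instance)

/-- A common denominator of the weights. -/
def denominator : ℕ := ∏ v, (I.weight v).den

/-- The weights, multiplied by the common denominator. -/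
def scaledWeight (v : Fin I.n) : ℕ := I.denominator / (I.weight v).den * (I.weight v).num

theorem denominator_pos : 0 < I.denominator :=
  Finset.prod_pos fun v _ => (I.weight v).den_pos

theorem realWeight_eq (v : Fin I.n) : I.realWeight v = I.scaledWeight v / I.denominator := by
  have hd : ((I.weight v).den : ℝ) ≠ 0 := by exact_mod_cast (I.weight v).den_ne_zero
  have hD : (I.denominator : ℝ) ≠ 0 := by exact_mod_cast I.denominator_pos.ne'
  have h : (I.weight v).den ∣ I.denominator :=
    Finset.dvd_prod_of_mem (fun v => (I.weight v).den) (Finset.mem_univ v)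
  rw [realWeight, scaledWeight, Nat.cast_mul, Nat.cast_div h hd, NNRat.cast_def]
  field_simp

theorem realWeight_nonneg (v : Fin I.n) : 0 ≤ I.realWeight v := by
  rw [realWeight_eq]; positivity

theorem sum_realWeight_mul (z : Fin I.n → ℝ) :
    ∑ v, I.realWeight v * z v = (∑ v, I.scaledWeight v * z v) / I.denominator := by
  rw [Finset.sum_div]
  refine Finset.sum_congr rfl fun v _ => ?_
  rw [realWeight_eq]; ring

theorem sum_realWeight (S : Finset (Fin I.n)) :
    ∑ v ∈ S, I.realWeight v = ((∑ v ∈ S, I.scaledWeight v : ℕ) : ℝ) / I.denominator := by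
  rw [Nat.cast_sum, Finset.sum_div]
  exact Finset.sum_congr rfl fun v _ => I.realWeight_eq v

end Instance

theorem init_cell_zero (l : List ℕ) (i : ℕ) : (State.init l).cell 0 i = l.getD i 0 := rfl

theorem readSize_init (I : Instance) : (readSize.run (State.init I.encode)).reg 1 = I.n := by
  simp [readSize, State.init, Instance.encode_eq]

theorem readCounts_spec {n k : ℕ} {σ : State} (hn : σ.reg 1 = n)
    (hk : σ.cell 0 (1 + n * n + n * 2) = k) :
    (readCounts.run σ).reg 2 = k ∧ (readCounts.run σ).reg 3 = n * n * 4 + 1 := by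
  simp [readCounts, Cmd.run_seq, hn, hk]

theorem writeValue_spec {n : ℕ} {G : SimpleGraph (Fin n)} {T : Set (Fin n × Fin n)} {w : Fin n → ℕ}
    {σ : State} (hn : σ.reg 1 = n) (h : HasBest G T w σ) :
    ∃ S : Finset (Fin n), IsMulticut G T S ∧ σ.reg 14 = ∑ v ∈ S, w v ∧
      (writeValue.run σ).Outputs (encodeSolution (σ.reg 14) (σ.reg 4) S) := by
  obtain ⟨S, hS, h14, h1⟩ := h
  refine ⟨S, hS, h14, ?_, ?_⟩
  · simp [writeValue, Cmd.run_seq, encodeSolution, hn]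
  · rintro ⟨i, hi⟩
    rcases i with _ | _ | i
    · simp [writeValue, Cmd.run_seq, encodeSolution]
    · simp [writeValue, Cmd.run_seq, encodeSolution]
    · have hin : i < n := by simpa [encodeSolution] using hi
      have := h1 ⟨i, hin⟩
      rw [Nat.add_comm 2] at this
      simp [writeValue, Cmd.run_seq, encodeSolution, this]

theorem solve_spec (I : Instance) (hG : I.graph.IsChordal) :
    ∃ (a : ℕ) (S : Finset (Fin I.n)), IsMulticut I.graph I.pairSet S ∧
      a = ∑ v ∈ S, I.scaledWeight v ∧
      (solve.run (State.init I.encode)).Outputs (encodeSolution a I.denominator S) ∧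
      ∀ z, IsFractional I.graph I.pairSet z → a ≤ 30 * ∑ v, I.scaledWeight v * z v := by
  have hrun : solve.run (State.init I.encode) = writeValue.run ((Cmd.for 17 3 iteration).run
    (initLoop.run (computeQuotients.run (scaleWeights.run (readCounts.run (readSize.run
      (State.init I.encode))))))) := rfl
  rw [hrun]
  set σ₁ := readSize.run (State.init I.encode) with hσ₁
  set σ₂ := readCounts.run σ₁ with hσ₂
  set σ₃ := scaleWeights.run σ₂ with hσ₃
  set σ₄ := computeQuotients.run σ₃ with hσ₄
  set σ₅ := initLoop.run σ₄ with hσ₅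
  have n1 : σ₁.reg 1 = I.n := readSize_init I
  have n2 : σ₂.reg 1 = I.n := (Cmd.run_reg _ _ (by decide)).trans n1
  have n3 : σ₃.reg 1 = I.n := (Cmd.run_reg _ _ (by decide)).trans n2
  have n4 : σ₄.reg 1 = I.n := (Cmd.run_reg _ _ (by decide)).trans n3
  have n5 : σ₅.reg 1 = I.n := (Cmd.run_reg _ _ (by decide)).trans n4
  have c1 : ∀ i, σ₁.cell 0 i = I.encode.getD i 0 := fun i => by
    rw [hσ₁, Cmd.run_cell _ _ (by decide), init_cell_zero]
  have c2 : ∀ i, σ₂.cell 0 i = I.encode.getD i 0 := fun i => by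
    rw [hσ₂, Cmd.run_cell _ _ (by decide), c1]
  have c5 : ∀ i, σ₅.cell 0 i = I.encode.getD i 0 := fun i => by
    rw [hσ₅, Cmd.run_cell _ _ (by decide), hσ₄, Cmd.run_cell _ _ (by decide), hσ₃,
      Cmd.run_cell _ _ (by decide), c2]
  obtain ⟨k2, k3⟩ := readCounts_spec n1 ((c1 _).trans I.getD_encode_length)
  rw [← hσ₂] at k2 k3
  obtain ⟨hden, hw⟩ := scaleWeights_spec n2 (num := fun v => (I.weight v).num)
    (den := fun v => (I.weight v).den) (fun v => (c2 _).trans (I.getD_encode_num v))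
    (fun v => (c2 _).trans (I.getD_encode_den v))
  rw [← hσ₃] at hden hw
  have w3 : weights I.n σ₃ = I.scaledWeight := funext hw
  have w4 : weights I.n σ₄ = I.scaledWeight :=
    (weights_congr (Cmd.run_cell _ _ (by decide))).trans w3
  have w5 : weights I.n σ₅ = I.scaledWeight :=
    (weights_congr (Cmd.run_cell _ _ (by decide))).trans w4
  obtain ⟨W, hW, hQ⟩ := computeQuotients_spec n3
  rw [← hσ₄, w3] at hQ
  obtain ⟨hy, hr, hb⟩ := initLoop_spec (G := I.graph) (T := {p | p ∈ I.pairs}) n4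
  rw [← hσ₅, w4] at hr hb
  rw [← hσ₅] at hy
  have hready : Ready I.graph I.pairs I.scaledWeight W σ₅ := by
    refine ⟨⟨n5, fun u v => ?_⟩, ⟨n5, ?_, fun j hj => ?_⟩, w5, hb, hW, fun v hv => ?_, fun v => ?_⟩
    · rw [c5, I.getD_encode_adj]; simp
    · rw [hσ₅, Cmd.run_reg _ _ (by decide), hσ₄, Cmd.run_reg _ _ (by decide), hσ₃,
        Cmd.run_reg _ _ (by decide), k2]
    · rw [c5, c5]; exact I.getD_encode_pair hj
    · rw [hσ₅, Cmd.run_cell _ _ (by decide)]; exact hQ v hv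
    · rw [hy]; exact one_pos
  have h3 : σ₅.reg 3 = I.n * I.n * 4 + 1 := by
    rw [hσ₅, Cmd.run_reg _ _ (by decide), hσ₄, Cmd.run_reg _ _ (by decide), hσ₃,
      Cmd.run_reg _ _ (by decide), k3]
  have hloop := fun z (hz : IsFractional I.graph {p | p ∈ I.pairs} z) =>
    mainLoop_spec hG hready h3 hy hr hz
  have h4 : ((Cmd.for 17 3 iteration).run σ₅).reg 4 = I.denominator := by
    rw [Cmd.run_reg _ _ (by decide), hσ₅, Cmd.run_reg _ _ (by decide), hσ₄,
      Cmd.run_reg _ _ (by decide)]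
    exact hden
  -- Some `z` is needed only to extract the part of `mainLoop_spec` that does not mention it. The
  -- run does not depend on `z`, so one output satisfies the bound for all `z` at once.
  have hone : ∃ z, IsFractional I.graph {p | p ∈ I.pairs} z := by
    obtain ⟨z, hz, -⟩ := exists_isFractional_eq_fopt I.graph {p | p ∈ I.pairs} I.realWeight
      I.realWeight_nonneg
    exact ⟨z, hz⟩
  obtain ⟨z₀, hz₀⟩ := hone
  have hfin := (hloop z₀ hz₀).1
  set ω := (Cmd.for 17 3 iteration).run σ₅ with hω
  obtain ⟨S, hS, h14, hout⟩ := writeValue_spec hfin.graph.1 hfin.best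
  rw [h4] at hout
  exact ⟨ω.reg 14, S, hS, h14, hout, fun z hz => (hloop z hz).2⟩

/-- The program has polynomial running time. -/
theorem exists_time_bound : ∃ q : Polynomial ℕ, ∀ I : Instance, ∃ t,
    Exec solve.compile (State.init I.encode) (solve.run (State.init I.encode)) t ∧
      t ≤ q.eval (bitSize I.encode) := by
  obtain ⟨-, q, g, h⟩ := polyTime_solve
  -- The encoding has more than `n²` entries, so `4 * bitSize + 1` bounds the number `4n² + 1` of
  -- rounds, and also `n` and the number of pairs.
  refine ⟨q.comp (4 * Polynomial.X + 1), fun I => ?_⟩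
  have hlen := length_le_bitSize I.encode
  rw [I.length_encode] at hlen
  have n1 := readSize_init I
  obtain ⟨k2, k3⟩ := readCounts_spec n1 (k := I.pairs.length) (by
    rw [Cmd.run_cell _ _ (by decide), init_cell_zero]; exact I.getD_encode_length)
  have n2 := (Cmd.run_reg readCounts _ (by decide)).trans n1
  have n3 := (Cmd.run_reg scaleWeights _ (by decide)).trans n2
  have n4 := (Cmd.run_reg computeQuotients _ (by decide)).trans n3
  have m2 := (Cmd.run_reg computeQuotients _ (by decide)).trans
    ((Cmd.run_reg scaleWeights _ (by decide)).trans k2)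
  have m3 := (Cmd.run_reg computeQuotients _ (by decide)).trans
    ((Cmd.run_reg scaleWeights _ (by decide)).trans k3)
  have key := h (4 * bitSize I.encode + 1) (State.init I.encode)
    ⟨by simp, by simp, ?_, ?_, ?_⟩ ((bounded_init _).mono (by omega))
  · obtain ⟨t, ht, htq, -⟩ := key
    exact ⟨t, ht, by simpa using htq⟩
  · intro i hi
    rw [List.mem_singleton.1 hi, n2]; omega
  · intro i hi
    rw [List.mem_singleton.1 hi, n3]; omega
  · intro i hi
    simp only [List.mem_cons, List.not_mem_nil, or_false] at hi
    rcases hi with rfl | rfl | rfl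
    · rw [n4]; omega
    · rw [m2]; omega
    · rw [m3]; omega

/-- The indicator function of an optimal multicut is a fractional multicut of the same value. -/
theorem fopt_le_opt {V : Type*} [Fintype V] [DecidableEq V] (G : SimpleGraph V) (T : Set (V × V))
    {w : V → ℝ} (hw : ∀ v, 0 ≤ w v) : fopt G T w ≤ opt G T w := by
  obtain ⟨S, hS, hopt⟩ := exists_isMulticut_eq_opt G T w
  rw [hopt]
  refine csInf_le ⟨0, ?_⟩ ⟨fun v => if v ∈ S then 1 else 0, ⟨fun v => ?_, fun p hp P _ => ?_⟩, ?_⟩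
  · rintro _ ⟨x, hx, rfl⟩
    exact Finset.sum_nonneg fun v _ => mul_nonneg (hw v) (hx.1 v)
  · dsimp only; split <;> norm_num
  · obtain ⟨v, hv, hvS⟩ := isMulticut_iff.1 hS p hp P
    refine le_trans ?_ (Finset.single_le_sum (f := fun v => if v ∈ S then (1 : ℝ) else 0)
      (fun v _ => by split <;> norm_num) (List.mem_toFinset.2 hv))
    rw [if_pos (by exact_mod_cast hvS)]
  · simp

end Multicut

/-- Weighted Multicut on chordal graphs has a polynomial-time approximation algorithm of constant
factor, which outputs a multicut together with its weight, at most `32` times the fractional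
optimum; the bound on the integrality gap also holds for real weights. -/
theorem theorem3 :
    (∃ (P : RAM.Prog) (q : Polynomial ℕ), ∀ I : Multicut.Instance, I.graph.IsChordal →
      ∃ (τ : RAM.State) (t a b : ℕ) (S : Finset (Fin I.n)),
        RAM.Exec P (RAM.State.init I.encode) τ t ∧
        t ≤ q.eval (RAM.bitSize I.encode) ∧
        τ.Outputs (Multicut.encodeSolution a b S) ∧
        Multicut.IsMulticut I.graph I.pairSet S ∧
        0 < b ∧ (a / b : ℝ) = ∑ v ∈ S, I.realWeight v ∧
        Multicut.opt I.graph I.pairSet I.realWeight ≤ (a / b : ℝ) ∧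
        (a / b : ℝ) ≤ 32 * Multicut.fopt I.graph I.pairSet I.realWeight ∧
        (a / b : ℝ) ≤ 32 * Multicut.opt I.graph I.pairSet I.realWeight) ∧
    (∀ (V : Type*) [Fintype V] [DecidableEq V] (G : SimpleGraph V) (T : Set (V × V)) (w : V → ℝ),
      G.IsChordal → (∀ v, 0 ≤ w v) →
        Multicut.opt G T w ≤ 32 * Multicut.fopt G T w) := by
  constructor
  · obtain ⟨q, hq⟩ := Multicut.exists_time_bound
    refine ⟨Multicut.solve.compile, q, fun I hG => ?_⟩
    obtain ⟨t, ht, htq⟩ := hq I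
    obtain ⟨a, S, hS, ha, hout, hle⟩ := Multicut.solve_spec I hG
    have hw := I.realWeight_nonneg
    have hval : (a / I.denominator : ℝ) = ∑ v ∈ S, I.realWeight v := by
      rw [I.sum_realWeight, ha]
    obtain ⟨z, hz, hzf⟩ := Multicut.exists_isFractional_eq_fopt I.graph I.pairSet I.realWeight hw
    -- The bound for scaled weights, applied to an optimal `z` and divided by the common
    -- denominator. The factor `30 = 5 * 6` combines the rounding loss and the approximate solution
    -- of the linear program.
    have h30 : (a / I.denominator : ℝ) ≤
        30 * Multicut.fopt I.graph I.pairSet I.realWeight := by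
      rw [hzf, I.sum_realWeight_mul, ← mul_div_assoc]
      exact div_le_div_of_nonneg_right (hle z hz) (Nat.cast_nonneg _)
    have h0 : 0 ≤ Multicut.fopt I.graph I.pairSet I.realWeight := by
      rw [hzf]
      exact Finset.sum_nonneg fun v _ => mul_nonneg (hw v) (hz.1 v)
    have h32 : (a / I.denominator : ℝ) ≤
        32 * Multicut.fopt I.graph I.pairSet I.realWeight := by linarith
    refine ⟨_, t, a, I.denominator, S, ht, htq, hout, hS, I.denominator_pos, hval, ?_, h32,
      h32.trans (mul_le_mul_of_nonneg_left (Multicut.fopt_le_opt _ _ hw) (by norm_num))⟩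
    rw [hval]
    refine csInf_le ⟨0, ?_⟩ ⟨S, hS, rfl⟩
    rintro _ ⟨S, -, rfl⟩
    exact Finset.sum_nonneg fun v _ => hw v
  · intro V _ _ G T w hG hw
    obtain ⟨z, hz, hzf⟩ := Multicut.exists_isFractional_eq_fopt G T w hw
    have h0 : 0 ≤ Multicut.fopt G T w := by
      rw [hzf]
      exact Finset.sum_nonneg fun v _ => mul_nonneg (hw v) (hz.1 v)
    have := Multicut.opt_le_mul_fopt hG T w hw
    linarith
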